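/- **Theorem 1.4.** Let $K$ be a Noetherian commutative ring, $S=K[x_1,\dots,x_m,y_1,\dots,y_n]$, $P=(x_1,\dots,x_m)$, $Q=(y_1,\dots,y_n)$. Let $\Gamma$ be an abelian group and let $S$ be $\Gamma$-graded by assigning arbitrary degrees in $\Gamma$ to the variables, the elements of $K$ having degree $0$. For a graded $S$-module $N$ and $I\in\{P,Q\}$ let $H^i_I(N)$ ($i\in\mathbb Z$) be the cohomology of the Čech complex of $N$ with respect to the variables generating $I$ (local cohomology). Assume that the grading is *$P$-sharp*: $H^i_P(S)_\gamma$ is a finitely generated $K$-module for all $i$ and all $\gamma\in\Gamma$. Let $S(-a)_\gamma=S_{\gamma-a}$, let $\sigma=\sum_i\deg x_i+\sum_j\deg y_j$, and put $\omega_{S/K}=S(-\sigma)$. For a graded module $N$ let $N^*=\bigoplus_\gamma (N^*)_\gamma$ with $(N^*)_\gamma=\operatorname{Hom}_K(N_{-\gamma},K)$ be its graded $K$-dual. Let $M$ be a finitely generated $\Gamma$-graded $S$-module and let $F$ be any graded resolution of $M$ by finitely generated graded free $S$-modules (for example a minimal one, when it exists), with $F_i=0$ for $i<0$. All isomorphisms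 below are isomorphisms of $\Gamma$-graded $S$-modules, and all spectral sequences are $E_2$-spectral sequences of $\Gamma$-graded $S$-modules with differentials $d_r\colon E_r^{i,j}\to E_r^{i+r,j-r+1}$; convergence means that for each $(i,j)$ the differentials into and out of $E_r^{i,j}$ vanish for large $r$, and that the abutment in each degree has a finite decreasing filtration by graded submodules with quotients $E_\infty^{i,j}$. (a) For all $i\in\mathbb Z$ there is an isomorphism $$H^i_P(M)\cong H_{m-i}\bigl(H^m_P(F)\bigr),$$ functorial in the sense that it commutes with the maps induced by a graded homomorphism $f\colon M\to M'$ of finitely generated graded modules and by any chain map $F\to F'$ of such resolutions lifting $f$. (b) There is a convergent spectral sequence $$E_2^{i,j}=H^i_Q\bigl(\operatorname{Ext}^j_S(M,\omega_{S/K})\bigr)\;\Rightarrow\; H^{i+j-n}\bigl(H^m_P(F)^*\bigr),$$ where $\operatorname{Ext}^j_S(M,\omega_{S/K})=H^j(\operatorname{Hom}_S(G,\omega_{S/K}))$ for any graded resolution $G$ of $M$ by finitely generated graded free modules. If $K$ is a field, then $\dim S=m+n$ and there is a convergent spectral sequence $$E_2^{i,j}=H^i_Q\bigl(\operatorname{Ext}^j_S(M,\omega_{S/K})\bigr)\;\Rightarrow\;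 H^{\dim S-(i+j)}_P(M)^*.$$ -/

import Mathlib

open MvPolynomial

universe u v

namespace GradedDuality

noncomputable section

/-! ### Graded modules over a graded polynomial ring

`S = MvPolynomial ι K` carries the `Γ`-grading in which the variable `X k` has degree `w k` and
the elements of `K` have degree `0`; its piece of degree `γ` is
`weightedHomogeneousSubmodule K w γ`. -/

/-- An `S`-module with a family of `K`-submodules indexed by `Γ`, the *pieces*.
It is a `Γ`-graded `S`-module when `GMod.IsGraded` holds. -/
structure GMod (K : Type u) [CommRing K] {Γ : Type v} [AddCommGroup Γ] {ι : Type}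
    (w : ι → Γ) where
  carrier : Type u
  [addCommGroup : AddCommGroup carrier]
  [moduleK : Module K carrier]
  [moduleS : Module (MvPolynomial ι K) carrier]
  [tower : IsScalarTower K (MvPolynomial ι K) carrier]
  piece : Γ → Submodule K carrier

section Basic

variable {K : Type u} [CommRing K] {Γ : Type v} [AddCommGroup Γ] {ι : Type} {w : ι → Γ}

instance : CoeSort (GMod K w) (Type u) := ⟨GMod.carrier⟩

attribute [instance] GMod.addCommGroup GMod.moduleK GMod.moduleS GMod.tower

open scoped Classical in
/-- The pieces make `M` a `Γ`-graded `S`-module: `M` is the direct sum of its pieces, and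
`S_a M_γ ⊆ M_{a + γ}`. -/
structure GMod.IsGraded (M : GMod K w) : Prop where
  internal : DirectSum.IsInternal M.piece
  smul_mem : ∀ (a γ : Γ) (s : MvPolynomial ι K) (x : M),
    s ∈ weightedHomogeneousSubmodule K w a → x ∈ M.piece γ → s • x ∈ M.piece (a + γ)

/-- Homomorphisms of graded modules (homogeneous of degree `0`). -/
structure GHom (A B : GMod K w) where
  toLin : A →ₗ[MvPolynomial ι K] B
  map_piece : ∀ γ, ∀ x ∈ A.piece γ, toLin x ∈ B.piece γ

/-- Isomorphisms of graded modules (homogeneous of degree `0`). -/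
structure GIso (A B : GMod K w) where
  toEquiv : A ≃ₗ[MvPolynomial ι K] B
  mem_piece_iff : ∀ γ x, toEquiv x ∈ B.piece γ ↔ x ∈ A.piece γ

/-- The subquotient `Z / (Z ∩ W)`; its piece of degree `γ` is the image of `Z ∩ M_γ`. -/
def GMod.subquotient (M : GMod K w) (Z W : Submodule (MvPolynomial ι K) M) : GMod K w where
  carrier := Z ⧸ W.submoduleOf Z
  piece γ := ((M.piece γ).comap (Z.subtype.restrictScalars K)).map
    ((W.submoduleOf Z).mkQ.restrictScalars K)

/-- The homology `ker g / im f` at the middle of `A --f--> B --g--> C` (meant for `g ∘ f = 0`). -/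
def homology {A B C : GMod K w} (f : A →ₗ[MvPolynomial ι K] B) (g : B →ₗ[MvPolynomial ι K] C) :
    GMod K w :=
  B.subquotient (LinearMap.ker g) (LinearMap.range f)

/-- The map induced on homology by a graded map `b` that preserves cycles and boundaries. -/
def homologyMap {A B C A' B' C' : GMod K w}
    {f : A →ₗ[MvPolynomial ι K] B} {g : B →ₗ[MvPolynomial ι K] C}
    {f' : A' →ₗ[MvPolynomial ι K] B'} {g' : B' →ₗ[MvPolynomial ι K] C'} (b : GHom B B')
    (hk : LinearMap.ker g ≤ (LinearMap.ker g').comap b.toLin)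
    (hr : LinearMap.range f ≤ (LinearMap.range f').comap b.toLin) :
    GHom (homology f g) (homology f' g') where
  toLin := Submodule.mapQ _ _ (b.toLin.restrict hk) (fun x hx => hr hx)
  map_piece := by
    rintro γ _ ⟨x, hx, rfl⟩
    exact ⟨b.toLin.restrict hk x, b.map_piece γ _ hx, rfl⟩

variable (K w) in
/-- The graded module `S(-a)`: the `S`-module `S` with `S(-a)_γ = S_{γ - a}`. -/
def shiftS (a : Γ) : GMod K w where
  carrier := MvPolynomial ι K
  piece γ := weightedHomogeneousSubmodule K w (γ - a)

/-- `Hom_S(A, B)`; its piece of degree `γ` consists of the `φ` with `φ(A_δ) ⊆ B_{δ + γ}` for all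
`δ`. (Only used for finitely generated `A`, where this is a graded module.) -/
def homMod (A B : GMod K w) : GMod K w where
  carrier := A →ₗ[MvPolynomial ι K] B
  piece γ :=
    { carrier := {φ | ∀ δ, ∀ x ∈ A.piece δ, φ x ∈ B.piece (δ + γ)}
      add_mem' := fun h h' δ x hx => add_mem (h δ x hx) (h' δ x hx)
      zero_mem' := fun _ _ _ => zero_mem _
      smul_mem' := fun c _ h δ x hx => Submodule.smul_mem _ c (h δ x hx) }

/-- `Hom_S(f, N) : Hom_S(B, N) → Hom_S(A, N)`. -/
def homModMap {A B : GMod K w} (f : GHom A B) (N : GMod K w) :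
    GHom (homMod B N) (homMod A N) where
  toLin := (LinearMap.lcomp (MvPolynomial ι K) N f.toLin :
    (B →ₗ[MvPolynomial ι K] N) →ₗ[MvPolynomial ι K] (A →ₗ[MvPolynomial ι K] N))
  map_piece := fun _ _ hφ δ x hx => hφ δ _ (f.map_piece δ x hx)

/-! ### The graded `K`-dual -/

/-- All `K`-linear functionals on `N`, with the `S`-module structure `(s • φ) x = φ (s • x)`. -/
def FullDual (N : GMod K w) : Type u := N →ₗ[K] K

/-- The underlying `K`-linear functional. -/
def FullDual.ev {N : GMod K w} (φ : FullDual N) : N →ₗ[K] K := φ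

instance (N : GMod K w) : AddCommGroup (FullDual N) :=
  inferInstanceAs (AddCommGroup (N →ₗ[K] K))

instance (N : GMod K w) : Module K (FullDual N) :=
  inferInstanceAs (Module K (N →ₗ[K] K))

instance (N : GMod K w) : Module (MvPolynomial ι K) (FullDual N) where
  smul s φ := φ.ev ∘ₗ (LinearMap.lsmul (MvPolynomial ι K) N s).restrictScalars K
  one_smul φ := LinearMap.ext fun x => congrArg φ.ev (one_smul _ x)
  mul_smul s t φ := LinearMap.ext fun x => congrArg φ.ev (by
    change (s * t) • x = t • s • x
    rw [mul_comm, mul_smul])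
  smul_zero _ := rfl
  smul_add _ _ _ := rfl
  add_smul s t φ := LinearMap.ext fun x =>
    (congrArg φ.ev (add_smul s t x)).trans (map_add φ.ev _ _)
  zero_smul φ := LinearMap.ext fun x =>
    (congrArg φ.ev (zero_smul _ x)).trans (map_zero φ.ev)

instance (N : GMod K w) : IsScalarTower K (MvPolynomial ι K) (FullDual N) where
  smul_assoc c s φ := LinearMap.ext fun x =>
    (congrArg φ.ev (smul_assoc c s x)).trans (map_smul φ.ev c (s • x))

/-- Functionals that vanish on `N_δ` for all `δ ≠ -γ`; for graded `N` they form
`Hom_K(N_{-γ}, K)`. -/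
def dualPiece (N : GMod K w) (γ : Γ) : Submodule K (FullDual N) where
  carrier := {φ | ∀ δ, δ ≠ -γ → ∀ x ∈ N.piece δ, φ.ev x = 0}
  add_mem' {φ ψ} h h' δ hδ x hx := by
    change φ.ev x + ψ.ev x = 0
    rw [h δ hδ x hx, h' δ hδ x hx, add_zero]
  zero_mem' _ _ _ _ := rfl
  smul_mem' c φ h δ hδ x hx := by
    change c • φ.ev x = 0
    rw [h δ hδ x hx, smul_zero]

/-- The `S`-submodule of the full dual generated by the homogeneous functionals. -/
def dualSub (N : GMod K w) : Submodule (MvPolynomial ι K) (FullDual N) :=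
  Submodule.span _ (⋃ γ, (dualPiece N γ : Set (FullDual N)))

/-- The graded `K`-dual `N^* = ⨁_γ Hom_K(N_{-γ}, K)`, with `(N^*)_γ = Hom_K(N_{-γ}, K)`. -/
def dual (N : GMod K w) : GMod K w where
  carrier := dualSub N
  piece γ := (dualPiece N γ).comap ((dualSub N).subtype.restrictScalars K)

/-- Precomposition with a graded map, on full duals. -/
def fullDualMap {A B : GMod K w} (f : GHom A B) :
    FullDual B →ₗ[MvPolynomial ι K] FullDual A where
  toFun φ := (φ.ev ∘ₗ f.toLin.restrictScalars K : A →ₗ[K] K)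
  map_add' _ _ := rfl
  map_smul' s φ := LinearMap.ext fun x => congrArg φ.ev (map_smul f.toLin s x).symm

theorem fullDualMap_mem {A B : GMod K w} (f : GHom A B) {γ : Γ} {φ : FullDual B}
    (h : φ ∈ dualPiece B γ) : fullDualMap f φ ∈ dualPiece A γ :=
  fun δ hδ x hx => h δ hδ _ (f.map_piece δ x hx)

theorem dualSub_le {A B : GMod K w} (f : GHom A B) :
    dualSub B ≤ (dualSub A).comap (fullDualMap f) := by
  refine Submodule.span_le.2 (Set.iUnion_subset fun γ φ hφ => ?_)
  exact Submodule.subset_span (Set.mem_iUnion.2 ⟨γ, fullDualMap_mem f hφ⟩)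

/-- The map `f^* : B^* → A^*`. -/
def dualMap {A B : GMod K w} (f : GHom A B) : GHom (dual B) (dual A) where
  toLin := ((fullDualMap f).restrict (dualSub_le f) : dualSub B →ₗ[MvPolynomial ι K] dualSub A)
  map_piece := fun _ _ hx => fullDualMap_mem f hx

/-! ### Local cohomology through the Čech complex

`t : Fin r → ι` lists the variables `X (t 0), …, X (t (r - 1))`. -/

variable {r : ℕ}

variable (K) in
/-- The submonoid of `S` generated by the variables `X (t k)`, `k ∈ I`. -/
def cechMonoid (t : Fin r → ι) (I : Finset (Fin r)) : Submonoid (MvPolynomial ι K) :=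
  Submonoid.closure ((fun k => X (t k)) '' (I : Set (Fin r)))

variable (K) in
theorem cechMonoid_mono (t : Fin r → ι) {I J : Finset (Fin r)} (h : I ⊆ J) :
    cechMonoid K t I ≤ cechMonoid K t J :=
  Submonoid.closure_mono (Set.image_mono (Finset.coe_subset.2 h))

section Cech

variable (t : Fin r → ι)
  (N : Type u) [AddCommGroup N] [Module (MvPolynomial ι K) N]
  {N' : Type u} [AddCommGroup N'] [Module (MvPolynomial ι K) N']

variable (K) in
/-- The localization of `N` at the variables `X (t k)`, `k ∈ I`. -/
abbrev CechLoc (I : Finset (Fin r)) : Type u := LocalizedModule (cechMonoid K t I) N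

/-- The localization map for `I ⊆ J`. -/
def cechRes {I J : Finset (Fin r)} (h : I ⊆ J) :
    CechLoc K t N I →ₗ[MvPolynomial ι K] CechLoc K t N J :=
  LocalizedModule.liftOfLE (cechMonoid K t I) (cechMonoid K t J) (cechMonoid_mono K t h)

variable {N} in
/-- Localization of a map. -/
def cechLocMap (f : N →ₗ[MvPolynomial ι K] N') (I : Finset (Fin r)) :
    CechLoc K t N I →ₗ[MvPolynomial ι K] CechLoc K t N' I :=
  IsLocalizedModule.map (cechMonoid K t I) (LocalizedModule.mkLinearMap _ N)
    (LocalizedModule.mkLinearMap _ N') f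

variable (K) in
/-- The term of degree `p` of the Čech complex: the product of the localizations of `N` at the
`p`-element sets of variables. -/
abbrev CechObj (p : ℤ) : Type u := ∀ I : {I : Finset (Fin r) // (I.card : ℤ) = p}, CechLoc K t N I.1

theorem card_erase_eq {p q : ℤ} (h : p + 1 = q) (J : {J : Finset (Fin r) // (J.card : ℤ) = q})
    (k : J.1) : ((J.1.erase k.1).card : ℤ) = p := by
  have h1 := Finset.card_erase_add_one k.2
  have h2 := J.2
  omega

/-- The Čech differential for `q = p + 1` (and `0` otherwise):
`(d f)_J = ∑_{k ∈ J} (-1)^{#{l ∈ J | l < k}} f_{J \ {k}}`. -/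
def cechD (p q : ℤ) : CechObj K t N p →ₗ[MvPolynomial ι K] CechObj K t N q :=
  if h : p + 1 = q then
    LinearMap.pi fun J => ∑ k : J.1, ((-1 : ℤ) ^ (J.1.filter (· < k.1)).card) •
      (cechRes t N (Finset.erase_subset k.1 J.1) ∘ₗ
        LinearMap.proj (⟨J.1.erase k.1, card_erase_eq h J k⟩ :
          {I : Finset (Fin r) // (I.card : ℤ) = p}))
  else 0

theorem cechD_apply {p q : ℤ} (h : p + 1 = q) (x : CechObj K t N p)
    (J : {J : Finset (Fin r) // (J.card : ℤ) = q}) :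
    cechD t N p q x J = ∑ k : J.1, ((-1 : ℤ) ^ (J.1.filter (· < k.1)).card) •
      cechRes t N (Finset.erase_subset k.1 J.1) (x ⟨J.1.erase k.1, card_erase_eq h J k⟩) := by
  unfold cechD
  rw [dif_pos h]
  exact LinearMap.sum_apply _ _ _

variable {N} in
/-- The map of Čech complexes induced by a linear map. -/
def cechObjMap (f : N →ₗ[MvPolynomial ι K] N') (p : ℤ) :
    CechObj K t N p →ₗ[MvPolynomial ι K] CechObj K t N' p :=
  LinearMap.pi fun I => cechLocMap t f I.1 ∘ₗ LinearMap.proj I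

theorem cechRes_mk {I J : Finset (Fin r)} (h : I ⊆ J) (y : N) (s : cechMonoid K t I) :
    cechRes t N h (LocalizedModule.mk y s) =
      LocalizedModule.mk y ⟨s.1, cechMonoid_mono K t h s.2⟩ := by
  rw [IsLocalizedModule.mk_eq_mk', IsLocalizedModule.mk_eq_mk']
  exact IsLocalizedModule.liftOfLE_mk' _ _ _ _ _ y s

variable {N}

theorem cechLocMap_mk (f : N →ₗ[MvPolynomial ι K] N') (I : Finset (Fin r)) (y : N)
    (s : cechMonoid K t I) :
    cechLocMap t f I (LocalizedModule.mk y s) = LocalizedModule.mk (f y) s :=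
  IsLocalizedModule.map_LocalizedModules _ f y s

theorem cechLocMap_cechRes (f : N →ₗ[MvPolynomial ι K] N') {I J : Finset (Fin r)} (h : I ⊆ J)
    (z : CechLoc K t N I) : cechLocMap t f J (cechRes t N h z) = cechRes t N' h (cechLocMap t f I z) := by
  induction z using LocalizedModule.induction_on with
  | h y s => rw [cechRes_mk, cechLocMap_mk, cechLocMap_mk, cechRes_mk]

theorem cechObjMap_comm (f : N →ₗ[MvPolynomial ι K] N') (p q : ℤ) (x : CechObj K t N p) :
    cechObjMap t f q (cechD t N p q x) = cechD t N' p q (cechObjMap t f p x) := by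
  by_cases h : p + 1 = q
  · funext J
    refine (congrArg (cechLocMap t f J.1) (cechD_apply t N h x J)).trans ?_
    rw [cechD_apply t N' h, map_sum]
    refine Finset.sum_congr rfl fun k _ => ?_
    rw [map_zsmul, cechLocMap_cechRes]
    rfl
  · simp [cechD, h]

end Cech

/-- The term of degree `p` of the Čech complex of a graded module. The piece of degree `γ` of a
localization is spanned by the fractions `y / s` with `s` homogeneous of degree `δ` and
`y ∈ N_{γ + δ}`. -/
def cechMod (t : Fin r → ι) (N : GMod K w) (p : ℤ) : GMod K w where
  carrier := CechObj K t N p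
  piece γ := Submodule.pi Set.univ fun I => Submodule.span K
    {z : CechLoc K t N I.1 | ∃ (δ : Γ) (s : cechMonoid K t I.1) (y : N),
      (s : MvPolynomial ι K) ∈ weightedHomogeneousSubmodule K w δ ∧ y ∈ N.piece (γ + δ) ∧
        z = LocalizedModule.mk y s}

/-- The map of Čech complexes induced by a graded map. -/
def cechMap (t : Fin r → ι) {A B : GMod K w} (f : GHom A B) (p : ℤ) :
    GHom (cechMod t A p) (cechMod t B p) where
  toLin := cechObjMap t f.toLin p
  map_piece := by
    intro γ x hx I _
    have hle : Submodule.span K {z : CechLoc K t A I.1 | ∃ (δ : Γ) (s : cechMonoid K t I.1) (y : A),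
        (s : MvPolynomial ι K) ∈ weightedHomogeneousSubmodule K w δ ∧ y ∈ A.piece (γ + δ) ∧
          z = LocalizedModule.mk y s} ≤
        (Submodule.span K {z : CechLoc K t B I.1 | ∃ (δ : Γ) (s : cechMonoid K t I.1) (y : B),
        (s : MvPolynomial ι K) ∈ weightedHomogeneousSubmodule K w δ ∧ y ∈ B.piece (γ + δ) ∧
          z = LocalizedModule.mk y s}).comap ((cechLocMap t f.toLin I.1).restrictScalars K) := by
      refine Submodule.span_le.2 ?_
      rintro _ ⟨δ, s, y, hs, hy, rfl⟩
      exact Submodule.subset_span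
        ⟨δ, s, f.toLin y, hs, f.map_piece _ _ hy, cechLocMap_mk t f.toLin I.1 y s⟩
    exact hle (hx I trivial)

/-- The `i`-th local cohomology of `N` with support in the ideal generated by the variables
`X (t k)`: the cohomology of the Čech complex. -/
def locCoh (t : Fin r → ι) (i : ℤ) (N : GMod K w) : GMod K w :=
  homology (A := cechMod t N (i - 1)) (B := cechMod t N i) (C := cechMod t N (i + 1))
    (cechD t N (i - 1) i) (cechD t N i (i + 1))

/-- Functoriality of local cohomology. -/
def locCohMap (t : Fin r → ι) (i : ℤ) {A B : GMod K w} (f : GHom A B) :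
    GHom (locCoh t i A) (locCoh t i B) :=
  homologyMap (cechMap t f i)
    (fun x (hx : cechD t A i (i + 1) x = 0) =>
      ((cechObjMap_comm t f.toLin i (i + 1) x).symm.trans (congrArg _ hx)).trans (map_zero _))
    (by
      rintro _ ⟨x, rfl⟩
      exact ⟨cechObjMap t f.toLin (i - 1) x, (cechObjMap_comm t f.toLin _ _ x).symm⟩)

theorem cechObjMap_congr (t : Fin r → ι) {A B B' C : GMod K w} {f : GHom A B} {g : GHom B C}
    {f' : GHom A B'} {g' : GHom B' C} (h : ∀ x, g.toLin (f.toLin x) = g'.toLin (f'.toLin x))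
    (p : ℤ) (x : CechObj K t A p) :
    cechObjMap t g.toLin p (cechObjMap t f.toLin p x) =
      cechObjMap t g'.toLin p (cechObjMap t f'.toLin p x) := by
  funext I
  change cechLocMap t g.toLin I.1 (cechLocMap t f.toLin I.1 (x I)) =
    cechLocMap t g'.toLin I.1 (cechLocMap t f'.toLin I.1 (x I))
  induction x I using LocalizedModule.induction_on with
  | h y s => rw [cechLocMap_mk, cechLocMap_mk, cechLocMap_mk, cechLocMap_mk, h]

/-- Local cohomology turns commutative squares into commutative squares. -/
theorem locCohMap_congr (t : Fin r → ι) (i : ℤ) {A B B' C : GMod K w} {f : GHom A B}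
    {g : GHom B C} {f' : GHom A B'} {g' : GHom B' C}
    (h : ∀ x, g.toLin (f.toLin x) = g'.toLin (f'.toLin x)) (x : locCoh t i A) :
    (locCohMap t i g).toLin ((locCohMap t i f).toLin x) =
      (locCohMap t i g').toLin ((locCohMap t i f').toLin x) := by
  obtain ⟨z, rfl⟩ := Submodule.Quotient.mk_surjective _ x
  exact congrArg (Submodule.Quotient.mk) (Subtype.ext (cechObjMap_congr t h i z.1))

variable (K w) in
/-- The grading of `S` is sharp with respect to the ideal `I` generated by the variables `X (t k)`:
every `H^i_I(S)_γ` is a finitely generated `K`-module. -/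
def IsSharp (t : Fin r → ι) : Prop :=
  ∀ (i : ℤ) (γ : Γ), ((locCoh t i (shiftS K w 0)).piece γ).FG

/-! ### Graded free resolutions -/

/-- Graded free of finite rank: `A` is a graded module with a finite homogeneous basis. -/
def GMod.IsFiniteFree (A : GMod K w) : Prop :=
  A.IsGraded ∧ ∃ (k : ℕ) (b : Module.Basis (Fin k) (MvPolynomial ι K) A),
    ∀ j, ∃ γ, b j ∈ A.piece γ

/-- A graded resolution `⋯ → F_1 → F_0 → M → 0` by graded free modules of finite rank, as a chain
complex indexed by `ℤ` that vanishes in negative degrees. -/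
structure FreeRes (M : GMod K w) where
  X : ℤ → GMod K w
  d : ∀ i j, GHom (X i) (X j)
  aug : GHom (X 0) M
  finiteFree : ∀ i, (X i).IsFiniteFree
  neg : ∀ i < 0, Subsingleton (X i)
  exact : ∀ i, 1 ≤ i → LinearMap.range (d (i + 1) i).toLin = LinearMap.ker (d i (i - 1)).toLin
  exact_zero : LinearMap.range (d 1 0).toLin = LinearMap.ker aug.toLin
  surj : Function.Surjective aug.toLin

/-- A chain map between resolutions lying over `f : M → M'`. -/
structure FreeRes.Lift {M M' : GMod K w} (F : FreeRes M) (F' : FreeRes M') (f : GHom M M') where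
  φ : ∀ i, GHom (F.X i) (F'.X i)
  comm : ∀ i j, j + 1 = i → ∀ x, (φ j).toLin ((F.d i j).toLin x) =
    (F'.d i j).toLin ((φ i).toLin x)
  comm_aug : ∀ x, f.toLin (F.aug.toLin x) = F'.aug.toLin ((φ 0).toLin x)

/-! ### The complexes derived from a resolution -/

/-- `Ext^j_S(M, N) = H^j(Hom_S(F, N))`, computed from the graded free resolution `F` of `M`. -/
def FreeRes.ext {M : GMod K w} (F : FreeRes M) (j : ℤ) (N : GMod K w) : GMod K w :=
  homology (homModMap (F.d j (j - 1)) N).toLin (homModMap (F.d (j + 1) j) N).toLin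

/-- `H_k(H^i_I(F))`: the `k`-th homology of the complex of local cohomology modules
`⋯ → H^i_I(F_{k+1}) → H^i_I(F_k) → H^i_I(F_{k-1}) → ⋯`. -/
def FreeRes.homLocCoh {M : GMod K w} (F : FreeRes M) (t : Fin r → ι) (i k : ℤ) : GMod K w :=
  homology (locCohMap t i (F.d (k + 1) k)).toLin (locCohMap t i (F.d k (k - 1))).toLin

/-- `H^k(H^i_I(F)^*)`: the `k`-th cohomology of the complex of graded `K`-duals
`⋯ → H^i_I(F_{k-1})^* → H^i_I(F_k)^* → H^i_I(F_{k+1})^* → ⋯`. -/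
def FreeRes.cohDualLocCoh {M : GMod K w} (F : FreeRes M) (t : Fin r → ι) (i k : ℤ) : GMod K w :=
  homology (dualMap (locCohMap t i (F.d k (k - 1)))).toLin
    (dualMap (locCohMap t i (F.d (k + 1) k))).toLin

/-- The map `H_k(H^i_I(F)) → H_k(H^i_I(F'))` induced by a chain map `F → F'`. -/
def FreeRes.Lift.homLocCohMap {M M' : GMod K w} {F : FreeRes M} {F' : FreeRes M'} {f : GHom M M'}
    (φ : F.Lift F' f) (t : Fin r → ι) (i k : ℤ) :
    GHom (F.homLocCoh t i k) (F'.homLocCoh t i k) :=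
  homologyMap (locCohMap t i (φ.φ k))
    (fun x hx => by
      have h := locCohMap_congr t i (fun y => φ.comm k (k - 1) (by omega) y) x
      rw [LinearMap.mem_ker.1 hx, map_zero] at h
      exact h.symm)
    (by
      rintro _ ⟨x, rfl⟩
      exact ⟨(locCohMap t i (φ.φ (k + 1))).toLin x,
        (locCohMap_congr t i (fun y => φ.comm (k + 1) k rfl y) x).symm⟩)

/-! ### Spectral sequences of graded modules -/

variable (K w) in
/-- A cohomological `E_2`-spectral sequence of graded `S`-modules. Only the pages `E r` with
`2 ≤ r` matter, and of `d r p q p' q' : E_r^{p,q} → E_r^{p',q'}` only the differentials with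
`(p', q') = (p + r, q - r + 1)`. -/
structure SpecSeq where
  E : ℕ → ℤ → ℤ → GMod K w
  d : ∀ r p q p' q', GHom (E r p q) (E r p' q')
  graded : ∀ r, 2 ≤ r → ∀ p q, (E r p q).IsGraded
  d_comp : ∀ r, 2 ≤ r → ∀ p q x,
    (d r p q (p + r) (q - r + 1)).toLin ((d r (p - r) (q + r - 1) p q).toLin x) = 0
  next : ∀ r, 2 ≤ r → ∀ p q, GIso (E (r + 1) p q)
    (homology (d r (p - r) (q + r - 1) p q).toLin (d r p q (p + r) (q - r + 1)).toLin)

/-- A submodule is homogeneous if it is spanned by its homogeneous elements. -/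
def GMod.IsHomogeneous (M : GMod K w) (W : Submodule (MvPolynomial ι K) M) : Prop :=
  W.restrictScalars K ≤ ⨆ γ, W.restrictScalars K ⊓ M.piece γ

/-- `E_2^{p,q} ⇒ A^{p+q}`: each `A^k` has a finite exhaustive and separated decreasing filtration by
graded submodules, and for all `p, q` the differentials entering and leaving `E_r^{p,q}` vanish for
large `r`, the stable value `E_∞^{p,q}` being `Fil^p A^{p+q} / Fil^{p+1} A^{p+q}`. -/
def SpecSeq.ConvergesTo (E : SpecSeq K w) (A : ℤ → GMod K w) : Prop :=
  ∃ Fil : ∀ k : ℤ, ℤ → Submodule (MvPolynomial ι K) (A k),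
    (∀ k, Antitone (Fil k)) ∧
    (∀ k p, (A k).IsHomogeneous (Fil k p)) ∧
    (∀ k, ∃ a, Fil k a = ⊤) ∧
    (∀ k, ∃ b, Fil k b = ⊥) ∧
    ∀ p q, ∃ r₀, 2 ≤ r₀ ∧ ∀ r, r₀ ≤ r →
      (E.d r p q (p + r) (q - r + 1)).toLin = 0 ∧
      (E.d r (p - r) (q + r - 1) p q).toLin = 0 ∧
      Nonempty (GIso (E.E r p q)
        ((A (p + q)).subquotient (Fil (p + q) p) (Fil (p + q) (p + 1))))

variable (K w) in
/-- The graded canonical module `ω_{S/K} = S(-σ)`, with `σ` the sum of the degrees of all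
variables. -/
def canonicalMod [Fintype ι] : GMod K w := shiftS K w (∑ k, w k)

end Basic

end

end GradedDuality

open GradedDuality

/-!
The isomorphism and the spectral sequences are read off from Čech double complexes of a graded free
resolution `F` of `M`. The Čech complex (with respect to distinct variables) of a free module is
exact below its last term, because localizations of a free module embed into Laurent polynomials
and the complex splits into its monomial parts (`exact_cechD`); its only cohomology is thus the
top one.

* The Čech complex in the variables `x` of `F` is a double complex. Localization is exact, so its
  total complex computes `H^i_P(M)`; as its rows are exact below the top, it also computes the
  homology of `H^m_P(F)`. The resulting isomorphism sends the class of one coordinate of a cycle to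
  the class of another, hence is natural (`FreeRes.topIso`, `FreeRes.topIso_natural`).

* The Čech complex in the variables `y` of `Hom_S(F, ω)` is a double complex as well. Filtering it
  by the Čech degree gives the spectral sequence with second page `H^i_Q(Ext^j(M, ω))`
  (`cechCxE2`); replacing `F` by another resolution does not change `Ext` (`exists_extIso`). As the
  modules `Hom_S(F_q, ω)` are free, the total complex computes the cohomology of the complex
  `H^n_Q(Hom_S(F, ω))`. The residue pairing between `H^m_P(A)` and `H^n_Q(Hom_S(A, ω))`, which takes
  the coefficient of `∏ x_i⁻¹ ∏ y_j⁻¹`, identifies the latter with the graded dual of the former for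
  every graded free `A` of finite rank: it is nondegenerate by inspection of monomials
  (`resDual_eq_zero_iff`), and every homogeneous functional is represented since, by sharpness, only
  finitely many monomials of `H^m_P(A)` have a given degree (`resDual_surjective`). So the abutment
  is `H^{k-n}(H^m_P(F)^*)` (`FreeRes.exists_abutmentIso`).

* Over a field the graded dual is exact, so the abutment is the graded dual of the homology of
  `H^m_P(F)`, which is `H^{m+n-k}_P(M)` by the first isomorphism (`FreeRes.exists_dualLocCohIso`).
-/

namespace GradedDuality

noncomputable section

variable {K : Type u} [CommRing K] {Γ : Type v} [AddCommGroup Γ] {ι : Type} {w : ι → Γ}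

/-! ### Graded modules, homogeneous submodules and subquotients -/

section Graded

variable {A B C M : GMod K w}

open scoped Classical in
theorem GMod.IsGraded.bijective (hM : M.IsGraded) :
    Function.Bijective (DirectSum.coeLinearMap M.piece) :=
  hM.internal

open scoped Classical in
/-- The projection of a graded module onto its piece of degree `γ`. -/
def GMod.IsGraded.proj (hM : M.IsGraded) (γ : Γ) : M →ₗ[K] M :=
  (M.piece γ).subtype ∘ₗ DirectSum.component K Γ (fun γ => M.piece γ) γ ∘ₗ
    (LinearEquiv.ofBijective (DirectSum.coeLinearMap M.piece) hM.bijective).symm.toLinearMap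

theorem GMod.IsGraded.proj_mem (hM : M.IsGraded) (γ : Γ) (x : M) :
    hM.proj γ x ∈ M.piece γ := by
  simp [GMod.IsGraded.proj]

open scoped Classical in
theorem GMod.IsGraded.proj_of_mem (hM : M.IsGraded) {γ : Γ} {x : M} (hx : x ∈ M.piece γ) :
    hM.proj γ x = x := by
  have : (LinearEquiv.ofBijective (DirectSum.coeLinearMap M.piece) hM.bijective).symm x =
      DirectSum.lof K Γ (fun γ => M.piece γ) γ ⟨x, hx⟩ := by
    rw [LinearEquiv.symm_apply_eq]
    simp
  simp [GMod.IsGraded.proj, this, DirectSum.component.lof_self]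

open scoped Classical in
theorem GMod.IsGraded.proj_of_mem_ne (hM : M.IsGraded) {γ δ : Γ} {x : M} (hx : x ∈ M.piece δ)
    (h : δ ≠ γ) : hM.proj γ x = 0 := by
  have : (LinearEquiv.ofBijective (DirectSum.coeLinearMap M.piece) hM.bijective).symm x =
      DirectSum.lof K Γ (fun γ => M.piece γ) δ ⟨x, hx⟩ := by
    rw [LinearEquiv.symm_apply_eq]
    simp
  simp [GMod.IsGraded.proj, this, DirectSum.component.of, h]

theorem GMod.IsGraded.iSup_piece (hM : M.IsGraded) : ⨆ γ, M.piece γ = ⊤ := by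
  classical
  have h := hM.internal
  exact DirectSum.IsInternal.submodule_iSup_eq_top (by convert h)

/-- Induction on an element of a graded module: it is a sum of homogeneous elements. -/
theorem GMod.IsGraded.induction (hM : M.IsGraded) {motive : M → Prop} (x : M)
    (mem : ∀ γ, ∀ y ∈ M.piece γ, motive y) (zero : motive 0)
    (add : ∀ y z, motive y → motive z → motive (y + z)) : motive x := by
  have hx : x ∈ ⨆ γ, M.piece γ := by rw [hM.iSup_piece]; trivial
  exact Submodule.iSup_induction (motive := motive) _ hx mem zero add

theorem GMod.IsGraded.exists_sum_proj (hM : M.IsGraded) (x : M) :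
    ∃ s : Finset Γ, (∀ γ ∉ s, hM.proj γ x = 0) ∧ ∑ γ ∈ s, hM.proj γ x = x := by
  classical
  induction x using hM.induction with
  | mem γ y hy =>
    refine ⟨{γ}, fun δ hδ => hM.proj_of_mem_ne hy ?_, ?_⟩
    · rintro rfl; simp at hδ
    · simp [hM.proj_of_mem hy]
  | zero => exact ⟨∅, by simp, by simp⟩
  | add y z hy hz =>
    obtain ⟨s, hs, hs'⟩ := hy
    obtain ⟨t, ht, ht'⟩ := hz
    refine ⟨s ∪ t, fun γ hγ => ?_, ?_⟩
    · rw [Finset.mem_union, not_or] at hγ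
      rw [map_add, hs γ hγ.1, ht γ hγ.2, add_zero]
    · simp_rw [map_add, Finset.sum_add_distrib]
      congr 1
      · rw [← Finset.sum_subset Finset.subset_union_left (fun γ _ h => hs γ h), hs']
      · rw [← Finset.sum_subset Finset.subset_union_right (fun γ _ h => ht γ h), ht']

theorem GMod.IsGraded.mem_piece_iff (hM : M.IsGraded) {γ : Γ} {x : M} :
    x ∈ M.piece γ ↔ hM.proj γ x = x :=
  ⟨hM.proj_of_mem, fun h => h ▸ hM.proj_mem γ x⟩

/-- A module whose pieces span it and are separated by linear maps `P γ` is graded. -/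
theorem GMod.IsGraded.of_separating {N : Type*} [AddCommGroup N] [Module K N]
    (P : Γ → M →ₗ[K] N)
    (h1 : ∀ γ, ∀ x ∈ M.piece γ, P γ x = 0 → x = 0)
    (h2 : ∀ γ δ, δ ≠ γ → ∀ x ∈ M.piece δ, P γ x = 0)
    (h3 : ∀ x, x ∈ ⨆ γ, M.piece γ)
    (h4 : ∀ (a γ : Γ) (s : MvPolynomial ι K) (x : M),
      s ∈ weightedHomogeneousSubmodule K w a → x ∈ M.piece γ → s • x ∈ M.piece (a + γ)) :
    M.IsGraded := by
  classical
  refine ⟨?_, h4⟩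
  have : DirectSum.IsInternal M.piece := by
    rw [DirectSum.isInternal_submodule_iff_iSupIndep_and_iSup_eq_top]
    refine ⟨fun γ => ?_, ?_⟩
    · rw [Submodule.disjoint_def]
      intro x hx hx'
      refine h1 γ x hx ?_
      have hle : (⨆ δ, ⨆ (_ : δ ≠ γ), M.piece δ) ≤ LinearMap.ker (P γ) :=
        iSup₂_le fun δ hδ x hx => h2 γ δ hδ x hx
      exact hle hx'
    · exact eq_top_iff.2 fun x _ => h3 x
  convert this

theorem GHom.map_proj (f : GHom A B) (hA : A.IsGraded) (hB : B.IsGraded) (γ : Γ) (x : A) :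
    f.toLin (hA.proj γ x) = hB.proj γ (f.toLin x) := by
  induction x using hA.induction with
  | mem δ y hy =>
    by_cases h : δ = γ
    · subst h
      rw [hA.proj_of_mem hy, hB.proj_of_mem (f.map_piece _ _ hy)]
    · rw [hA.proj_of_mem_ne hy h, hB.proj_of_mem_ne (f.map_piece _ _ hy) h, map_zero]
  | zero => simp
  | add y z hy hz => simp [hy, hz]

/-- A submodule of a graded module is homogeneous iff it contains the homogeneous components of
its elements. -/
theorem GMod.IsGraded.isHomogeneous_iff (hM : M.IsGraded) (W : Submodule (MvPolynomial ι K) M) :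
    M.IsHomogeneous W ↔ ∀ x ∈ W, ∀ γ, hM.proj γ x ∈ W := by
  constructor
  · intro h x hx γ
    have hx' : x ∈ ⨆ δ, W.restrictScalars K ⊓ M.piece δ := h hx
    induction hx' using Submodule.iSup_induction' with
    | mem δ y hy =>
      by_cases hδ : δ = γ
      · subst hδ
        rw [hM.proj_of_mem hy.2]
        exact hy.1
      · rw [hM.proj_of_mem_ne hy.2 hδ]
        exact zero_mem _
    | zero => simp
    | add y z _ _ hy hz =>
      have hle : (⨆ δ, W.restrictScalars K ⊓ M.piece δ) ≤ W.restrictScalars K :=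
        iSup_le fun δ => inf_le_left
      rw [map_add]
      exact add_mem (hy (hle ‹_›)) (hz (hle ‹_›))
  · intro h x hx
    obtain ⟨s, -, hs⟩ := hM.exists_sum_proj x
    rw [← hs]
    exact Submodule.sum_mem _ fun γ _ => Submodule.mem_iSup_of_mem γ ⟨h x hx γ, hM.proj_mem γ x⟩

theorem GMod.IsGraded.isHomogeneous_inf (hM : M.IsGraded) {W W' : Submodule (MvPolynomial ι K) M}
    (h : M.IsHomogeneous W) (h' : M.IsHomogeneous W') : M.IsHomogeneous (W ⊓ W') := by
  rw [hM.isHomogeneous_iff] at *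
  exact fun x hx γ => ⟨h x hx.1 γ, h' x hx.2 γ⟩

theorem GMod.IsGraded.isHomogeneous_sup (hM : M.IsGraded) {W W' : Submodule (MvPolynomial ι K) M}
    (h : M.IsHomogeneous W) (h' : M.IsHomogeneous W') : M.IsHomogeneous (W ⊔ W') := by
  rw [hM.isHomogeneous_iff] at *
  intro x hx γ
  obtain ⟨y, hy, z, hz, rfl⟩ := Submodule.mem_sup.1 hx
  rw [map_add]
  exact Submodule.add_mem_sup (h y hy γ) (h' z hz γ)

theorem GHom.isHomogeneous_map (f : GHom A B) (hA : A.IsGraded) (hB : B.IsGraded)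
    {W : Submodule (MvPolynomial ι K) A} (h : A.IsHomogeneous W) :
    B.IsHomogeneous (W.map f.toLin) := by
  rw [hA.isHomogeneous_iff] at h
  rw [hB.isHomogeneous_iff]
  rintro _ ⟨x, hx, rfl⟩ γ
  exact ⟨_, h x hx γ, f.map_proj hA hB γ x⟩

theorem GHom.isHomogeneous_comap (f : GHom A B) (hA : A.IsGraded) (hB : B.IsGraded)
    {W : Submodule (MvPolynomial ι K) B} (h : B.IsHomogeneous W) :
    A.IsHomogeneous (W.comap f.toLin) := by
  rw [hB.isHomogeneous_iff] at h
  rw [hA.isHomogeneous_iff]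
  intro x hx γ
  rw [Submodule.mem_comap, f.map_proj hA hB]
  exact h _ hx γ

theorem GMod.IsGraded.isHomogeneous_top (hM : M.IsGraded) : M.IsHomogeneous ⊤ := by
  rw [hM.isHomogeneous_iff]; intros; trivial

theorem GMod.IsGraded.isHomogeneous_bot (hM : M.IsGraded) : M.IsHomogeneous ⊥ := by
  rw [hM.isHomogeneous_iff]
  intro x hx γ
  rw [(Submodule.mem_bot _).1 hx, map_zero]
  exact zero_mem _

theorem GHom.isHomogeneous_ker (f : GHom A B) (hA : A.IsGraded) (hB : B.IsGraded) :
    A.IsHomogeneous (LinearMap.ker f.toLin) :=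
  f.isHomogeneous_comap hA hB hB.isHomogeneous_bot

theorem GHom.isHomogeneous_range (f : GHom A B) (hA : A.IsGraded) (hB : B.IsGraded) :
    B.IsHomogeneous (LinearMap.range f.toLin) := by
  rw [LinearMap.range_eq_map]
  exact f.isHomogeneous_map hA hB hA.isHomogeneous_top

/-- The class in a subquotient. -/
def GMod.sqMk (M : GMod K w) (Z W : Submodule (MvPolynomial ι K) M) :
    Z →ₗ[MvPolynomial ι K] M.subquotient Z W :=
  (W.submoduleOf Z).mkQ

theorem GMod.sqMk_surjective (Z W : Submodule (MvPolynomial ι K) M) :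
    Function.Surjective (M.sqMk Z W) :=
  Submodule.mkQ_surjective _

theorem GMod.sqMk_eq_zero {Z W : Submodule (MvPolynomial ι K) M} {x : Z} :
    M.sqMk Z W x = 0 ↔ (x : M) ∈ W :=
  Submodule.Quotient.mk_eq_zero _

theorem GMod.sqMk_mem_piece {Z W : Submodule (MvPolynomial ι K) M} {x : Z} {γ : Γ}
    (h : (x : M) ∈ M.piece γ) : M.sqMk Z W x ∈ (M.subquotient Z W).piece γ :=
  ⟨x, h, rfl⟩

theorem GMod.mem_piece_subquotient {Z W : Submodule (MvPolynomial ι K) M} {γ : Γ}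
    {y : M.subquotient Z W} (h : y ∈ (M.subquotient Z W).piece γ) :
    ∃ x : Z, (x : M) ∈ M.piece γ ∧ M.sqMk Z W x = y := by
  obtain ⟨x, hx, rfl⟩ := h
  exact ⟨x, hx, rfl⟩

/-- A subquotient of a graded module by homogeneous submodules is graded. -/
theorem GMod.IsGraded.subquotient (hM : M.IsGraded) {Z W : Submodule (MvPolynomial ι K) M}
    (hZ : M.IsHomogeneous Z) (hW : M.IsHomogeneous W) : (M.subquotient Z W).IsGraded := by
  rw [hM.isHomogeneous_iff] at hZ hW
  let PZ : ∀ γ, Z →ₗ[K] Z := fun γ => (hM.proj γ).restrict (p := Z.restrictScalars K)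
    (q := Z.restrictScalars K) (fun x hx => hZ x hx γ)
  let P : ∀ γ, M.subquotient Z W →ₗ[K] M.subquotient Z W := fun γ =>
    Submodule.liftQ ((W.submoduleOf Z).restrictScalars K)
      (((M.sqMk Z W).restrictScalars K) ∘ₗ PZ γ) (fun x hx =>
        GMod.sqMk_eq_zero.2 (hW _ hx γ)) ∘ₗ
      (Submodule.Quotient.restrictScalarsEquiv K (W.submoduleOf Z)).symm.toLinearMap
  have hP : ∀ γ (x : Z), P γ (M.sqMk Z W x) = M.sqMk Z W (PZ γ x) := fun γ x => rfl
  refine GMod.IsGraded.of_separating P ?_ ?_ ?_ ?_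
  · intro γ y hy h0
    obtain ⟨x, hx, rfl⟩ := GMod.mem_piece_subquotient hy
    have : PZ γ x = x := Subtype.ext (hM.proj_of_mem hx)
    rwa [hP, this] at h0
  · intro γ δ hne y hy
    obtain ⟨x, hx, rfl⟩ := GMod.mem_piece_subquotient hy
    have : PZ γ x = 0 := Subtype.ext (hM.proj_of_mem_ne hx hne)
    rw [hP, this, map_zero]
  · intro y
    obtain ⟨x, rfl⟩ := GMod.sqMk_surjective Z W y
    obtain ⟨s, -, hs⟩ := hM.exists_sum_proj (x : M)
    have : x = ∑ γ ∈ s, PZ γ x := Subtype.ext (by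
      rw [AddSubmonoidClass.coe_finsetSum]
      exact hs.symm)
    rw [this, map_sum]
    exact Submodule.sum_mem _ fun γ _ => Submodule.mem_iSup_of_mem γ
      (GMod.sqMk_mem_piece (hM.proj_mem γ _))
  · intro a γ s y hs hy
    obtain ⟨x, hx, rfl⟩ := GMod.mem_piece_subquotient hy
    rw [← map_smul]
    exact GMod.sqMk_mem_piece (hM.smul_mem a γ s x hs hx)

theorem isGraded_homology (f : GHom A B) (g : GHom B C) (hA : A.IsGraded) (hB : B.IsGraded)
    (hC : C.IsGraded) : (homology f.toLin g.toLin).IsGraded :=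
  hB.subquotient (g.isHomogeneous_ker hB hC) (f.isHomogeneous_range hA hB)

/-! ### Graded maps and isomorphisms -/

/-- The identity of a graded module. -/
def GHom.id (A : GMod K w) : GHom A A := ⟨LinearMap.id, fun _ _ h => h⟩

/-- Composition of graded maps. -/
def GHom.comp (g : GHom B C) (f : GHom A B) : GHom A C :=
  ⟨g.toLin ∘ₗ f.toLin, fun γ x hx => g.map_piece γ _ (f.map_piece γ x hx)⟩

instance : Zero (GHom A B) := ⟨⟨0, fun _ _ _ => zero_mem _⟩⟩

instance : Sub (GHom A B) := ⟨fun f g => ⟨f.toLin - g.toLin,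
  fun γ x hx => sub_mem (f.map_piece γ x hx) (g.map_piece γ x hx)⟩⟩

/-- A sign times a graded map. -/
instance : SMul ℤˣ (GHom A B) := ⟨fun e f => ⟨(e : ℤ) • f.toLin,
  fun γ x hx => zsmul_mem (f.map_piece γ x hx) _⟩⟩

/-- A bijective graded map between graded modules is an isomorphism of graded modules. -/
def GIso.ofBijective (hA : A.IsGraded) (hB : B.IsGraded) (f : GHom A B)
    (hf : Function.Bijective f.toLin) : GIso A B where
  toEquiv := LinearEquiv.ofBijective f.toLin hf
  mem_piece_iff γ x := by
    refine ⟨fun h => ?_, f.map_piece γ x⟩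
    have h' : f.toLin x ∈ B.piece γ := h
    rw [hB.mem_piece_iff, ← f.map_proj hA hB] at h'
    rw [hA.mem_piece_iff]
    exact hf.1 h'

/-- The inverse of a graded isomorphism. -/
def GIso.symm (e : GIso A B) : GIso B A where
  toEquiv := e.toEquiv.symm
  mem_piece_iff γ x := by
    rw [← e.mem_piece_iff, LinearEquiv.apply_symm_apply]

/-- Composition of graded isomorphisms. -/
def GIso.trans (e : GIso A B) (e' : GIso B C) : GIso A C where
  toEquiv := e.toEquiv.trans e'.toEquiv
  mem_piece_iff γ x := by
    rw [LinearEquiv.trans_apply, e'.mem_piece_iff, e.mem_piece_iff]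

/-- The graded map underlying a graded isomorphism. -/
def GIso.hom (e : GIso A B) : GHom A B :=
  ⟨e.toEquiv.toLinearMap, fun γ x => (e.mem_piece_iff γ x).2⟩

/-- The map of subquotients induced by a graded map. -/
def GHom.subquotientMap (f : GHom A B) {Z W : Submodule (MvPolynomial ι K) A}
    {Z' W' : Submodule (MvPolynomial ι K) B} (hZ : ∀ x ∈ Z, f.toLin x ∈ Z')
    (hW : ∀ x ∈ Z, x ∈ W → f.toLin x ∈ W') : GHom (A.subquotient Z W) (B.subquotient Z' W') where
  toLin := Submodule.mapQ _ _ (f.toLin.restrict hZ) (fun x hx => hW x x.2 hx)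
  map_piece := by
    rintro γ _ ⟨x, hx, rfl⟩
    exact ⟨f.toLin.restrict hZ x, f.map_piece γ _ hx, rfl⟩

/-- A surjective degree preserving map `Z → Q` with kernel `Z ∩ W` identifies the graded module
`Z / (Z ∩ W)` with `Q`. -/
def subquotientIso {Q : GMod K w} (hM : M.IsGraded) {Z W : Submodule (MvPolynomial ι K) M}
    (hZ : M.IsHomogeneous Z) (hW : M.IsHomogeneous W) (hQ : Q.IsGraded)
    (f : Z →ₗ[MvPolynomial ι K] Q) (hker : ∀ z, f z = 0 ↔ (z : M) ∈ W)
    (hsurj : Function.Surjective f) (hpiece : ∀ γ, ∀ z : Z, (z : M) ∈ M.piece γ → f z ∈ Q.piece γ) :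
    GIso (M.subquotient Z W) Q :=
  GIso.ofBijective (hM.subquotient hZ hW) hQ
    { toLin := Submodule.liftQ _ f (fun x hx => (hker x).2 hx)
      map_piece := by
        rintro γ _ ⟨x, hx, rfl⟩
        exact hpiece γ x hx }
    (by
      constructor
      · refine (injective_iff_map_eq_zero _).2 fun y hy => ?_
        obtain ⟨x, rfl⟩ := GMod.sqMk_surjective Z W y
        exact GMod.sqMk_eq_zero.2 ((hker x).1 hy)
      · intro q
        obtain ⟨x, rfl⟩ := hsurj q
        exact ⟨M.sqMk Z W x, rfl⟩)

theorem isGraded_shiftS (a : Γ) : (shiftS K w a).IsGraded := by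
  classical
  refine GMod.IsGraded.of_separating (M := shiftS K w a) (N := MvPolynomial ι K)
    (fun γ => weightedHomogeneousComponent w (γ - a)) ?_ ?_ ?_ ?_
  · intro γ x hx h
    exact ((IsWeightedHomogeneous.weightedHomogeneousComponent_same hx).symm.trans h)
  · intro γ δ h x hx
    exact IsWeightedHomogeneous.weightedHomogeneousComponent_ne (γ - a) hx
      (fun h' => h (sub_left_injective h'.symm))
  · intro (x : MvPolynomial ι K)
    change x ∈ ⨆ γ, weightedHomogeneousSubmodule K w (γ - a)
    rw [← sum_weightedHomogeneousComponent w x, finsum_eq_sum _ (weightedHomogeneousComponent_finsupp x)]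
    refine Submodule.sum_mem _ fun γ _ => Submodule.mem_iSup_of_mem (γ + a) ?_
    rw [add_sub_cancel_right]
    exact weightedHomogeneousComponent_mem w x γ
  · intro b γ s (x : MvPolynomial ι K) hs hx
    have := IsWeightedHomogeneous.mul hs hx
    change IsWeightedHomogeneous w (s * x) (b + γ - a)
    rwa [add_sub_assoc]

end Graded

/-! ### The spectral sequence of a filtered complex -/

variable (K w) in
/-- A filtered complex of graded modules, as one graded module `T` with a differential `D`;
`Fil p k` is the step `p` of the decreasing filtration of the part of cohomological degree `k`,
which is `Deg k`. The filtration of every `Deg k` is finite. -/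
structure FiltCx where
  T : GMod K w
  D : GHom T T
  Deg : ℤ → Submodule (MvPolynomial ι K) T
  Fil : ℤ → ℤ → Submodule (MvPolynomial ι K) T
  graded : T.IsGraded
  D_comp : ∀ x, D.toLin (D.toLin x) = 0
  homog : ∀ p k, T.IsHomogeneous (Fil p k)
  anti : ∀ k, Antitone (fun p => Fil p k)
  D_mem : ∀ p k, ∀ x ∈ Fil p k, D.toLin x ∈ Fil p (k + 1)
  low : ∀ k, ∃ a, ∀ p ≤ a, Fil p k = Deg k
  high : ∀ k, ∃ b, ∀ p, b ≤ p → Fil p k = ⊥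

namespace FiltCx

variable (C : FiltCx K w)

theorem homog_deg (k : ℤ) : C.T.IsHomogeneous (C.Deg k) := by
  obtain ⟨a, ha⟩ := C.low k
  rw [← ha a le_rfl]
  exact C.homog a k

theorem fil_le_deg (p k : ℤ) : C.Fil p k ≤ C.Deg k := by
  obtain ⟨a, ha⟩ := C.low k
  rw [← ha (min a p) (min_le_left _ _)]
  exact C.anti k (min_le_right _ _)

theorem D_mem_deg {k : ℤ} {x : C.T} (hx : x ∈ C.Deg k) : C.D.toLin x ∈ C.Deg (k + 1) := by
  obtain ⟨a, ha⟩ := C.low k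
  rw [← ha a le_rfl] at hx
  exact C.fil_le_deg _ _ (C.D_mem _ _ x hx)

/-- The elements of `Fil p k` whose differential lies `r` steps deeper in the filtration. -/
def Z (r p k : ℤ) : Submodule (MvPolynomial ι K) C.T :=
  C.Fil p k ⊓ (C.Fil (p + r) (k + 1)).comap C.D.toLin

/-- What is killed on the page `r`; only its intersection with `Z r p k` matters. -/
def W (r p k : ℤ) : Submodule (MvPolynomial ι K) C.T :=
  C.Fil (p + 1) k ⊔ (C.Fil (p - r + 1) (k - 1)).map C.D.toLin

variable {C} in
theorem mem_Z {r p k : ℤ} {x : C.T} :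
    x ∈ C.Z r p k ↔ x ∈ C.Fil p k ∧ C.D.toLin x ∈ C.Fil (p + r) (k + 1) :=
  Iff.rfl

theorem homog_Z (r p k : ℤ) : C.T.IsHomogeneous (C.Z r p k) :=
  C.graded.isHomogeneous_inf (C.homog _ _)
    (C.D.isHomogeneous_comap C.graded C.graded (C.homog _ _))

theorem homog_W (r p k : ℤ) : C.T.IsHomogeneous (C.W r p k) :=
  C.graded.isHomogeneous_sup (C.homog _ _)
    (C.D.isHomogeneous_map C.graded C.graded (C.homog _ _))

/-- The term `E_r^{p,q}`. -/
abbrev page (r : ℤ) (p q : ℤ) : GMod K w := C.T.subquotient (C.Z r p (p + q)) (C.W r p (p + q))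

theorem graded_page (r p q : ℤ) : (C.page r p q).IsGraded :=
  C.graded.subquotient (C.homog_Z _ _ _) (C.homog_W _ _ _)

theorem D_mem_Z {r p k p' k' : ℤ} (hp : p' = p + r) (hk : k' = k + 1) (x : C.T)
    (hx : x ∈ C.Z r p k) : C.D.toLin x ∈ C.Z r p' k' := by
  subst hp hk
  refine mem_Z.2 ⟨hx.2, ?_⟩
  rw [C.D_comp]
  exact zero_mem _

theorem D_mem_W {r p k p' k' : ℤ} (hp : p' = p + r) (hk : k' = k + 1) (x : C.T)
    (hx : x ∈ C.W r p k) : C.D.toLin x ∈ C.W r p' k' := by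
  subst hp hk
  obtain ⟨a, ha, _, ⟨b, -, rfl⟩, rfl⟩ := Submodule.mem_sup.1 hx
  rw [map_add, C.D_comp, add_zero]
  refine Submodule.mem_sup_right ⟨a, ?_, rfl⟩
  rwa [add_sub_cancel_right, add_sub_cancel_right]

open scoped Classical in
/-- The differential of the page `r`, induced by `D` whenever that makes sense. -/
def pageD (r p q p' q' : ℤ) : GHom (C.page r p q) (C.page r p' q') :=
  if h : (∀ x ∈ C.Z r p (p + q), C.D.toLin x ∈ C.Z r p' (p' + q')) ∧
      ∀ x ∈ C.Z r p (p + q), x ∈ C.W r p (p + q) → C.D.toLin x ∈ C.W r p' (p' + q') then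
    C.D.subquotientMap h.1 h.2
  else 0

theorem pageD_mk {r p q p' q' : ℤ} (hp : p' = p + r) (hq : p' + q' = p + q + 1)
    (x : C.Z r p (p + q)) :
    (C.pageD r p q p' q').toLin (C.T.sqMk _ _ x) =
      C.T.sqMk _ _ ⟨C.D.toLin x, C.D_mem_Z hp hq x x.2⟩ := by
  have h : (∀ x ∈ C.Z r p (p + q), C.D.toLin x ∈ C.Z r p' (p' + q')) ∧
      ∀ x ∈ C.Z r p (p + q), x ∈ C.W r p (p + q) → C.D.toLin x ∈ C.W r p' (p' + q') :=
    ⟨C.D_mem_Z hp hq, fun x _ => C.D_mem_W hp hq x⟩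
  unfold pageD
  rw [dif_pos h]
  rfl

theorem pageD_comp {r p q p' q' p'' q'' : ℤ} (hp : p' = p + r) (hq : p' + q' = p + q + 1)
    (hp' : p'' = p' + r) (hq' : p'' + q'' = p' + q' + 1) (x : C.page r p q) :
    (C.pageD r p' q' p'' q'').toLin ((C.pageD r p q p' q').toLin x) = 0 := by
  obtain ⟨x, rfl⟩ := GMod.sqMk_surjective _ _ x
  rw [C.pageD_mk hp hq, C.pageD_mk hp' hq']
  refine GMod.sqMk_eq_zero.2 ?_
  change C.D.toLin (C.D.toLin x) ∈ _
  rw [C.D_comp]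
  exact zero_mem _

theorem Z_succ_le (r p k : ℤ) : C.Z (r + 1) p k ≤ C.Z r p k :=
  fun x hx => ⟨hx.1, C.anti (k + 1) (by omega) hx.2⟩

/-- The page `r + 1` is the homology of the page `r`: an element of `Z (r + 1) p k` is sent to the
class of its class on the page `r`, on which the differential vanishes. The indices are related by
equations so that `p - r + r` and the like need no rewriting. -/
def nextIso {r p q p₀ q₀ p₁ q₁ : ℤ} (hp : p = p₀ + r) (hq : p + q = p₀ + q₀ + 1)
    (hp' : p₁ = p + r) (hq' : p₁ + q₁ = p + q + 1) :
    GIso (C.page (r + 1) p q)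
      (homology (C.pageD r p₀ q₀ p q).toLin (C.pageD r p q p₁ q₁).toLin) := by
  have hker : ∀ x : C.Z (r + 1) p (p + q),
      C.T.sqMk (C.Z r p (p + q)) (C.W r p (p + q)) ⟨x, C.Z_succ_le _ _ _ x.2⟩ ∈
        LinearMap.ker (C.pageD r p q p₁ q₁).toLin := by
    intro x
    rw [LinearMap.mem_ker, C.pageD_mk hp' hq']
    refine GMod.sqMk_eq_zero.2 (Submodule.mem_sup_left ?_)
    have := (mem_Z.1 x.2).2
    change C.D.toLin x ∈ C.Fil (p₁ + 1) (p₁ + q₁)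
    rw [hq', hp', add_assoc]
    exact this
  refine subquotientIso C.graded (C.homog_Z _ _ _) (C.homog_W _ _ _)
    (isGraded_homology _ _ (C.graded_page _ _ _) (C.graded_page _ _ _) (C.graded_page _ _ _))
    ((GMod.sqMk _ _ _) ∘ₗ ((C.T.sqMk (C.Z r p (p + q)) (C.W r p (p + q))) ∘ₗ
      (Submodule.inclusion (C.Z_succ_le r p (p + q)))).codRestrict _ hker) ?_ ?_ ?_
  · intro x
    refine GMod.sqMk_eq_zero.trans ?_
    have hx := x.2
    constructor
    · rintro ⟨y, hy⟩
      obtain ⟨y, rfl⟩ := GMod.sqMk_surjective _ _ y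
      rw [C.pageD_mk hp hq] at hy
      have h0 := GMod.sqMk_eq_zero.1 (sub_eq_zero.2 hy.symm : C.T.sqMk _ _ _ - C.T.sqMk _ _ _ = 0)
      have h1 : (x : C.T) - C.D.toLin y ∈ C.W r p (p + q) := h0
      obtain ⟨a, ha, _, ⟨b, hb, rfl⟩, hab⟩ := Submodule.mem_sup.1 h1
      refine Submodule.mem_sup.2 ⟨a, ha, C.D.toLin (b + y), ⟨b + y, add_mem ?_ ?_, rfl⟩, ?_⟩
      · exact C.anti _ (by omega) hb
      · have := y.2.1
        rw [show p + q - 1 = p₀ + q₀ by omega]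
        exact C.anti _ (by omega) this
      · rw [map_add, ← add_assoc, hab, sub_add_cancel]
    · intro h
      obtain ⟨a, ha, _, ⟨y, hy, rfl⟩, hay⟩ := Submodule.mem_sup.1 h
      have hya : C.D.toLin y = x - a := by rw [← hay, add_sub_cancel_left]
      have hyZ : y ∈ C.Z r p₀ (p₀ + q₀) := by
        rw [show p + q - 1 = p₀ + q₀ by omega, show p - (r + 1) + 1 = p₀ by omega] at hy
        refine mem_Z.2 ⟨hy, ?_⟩
        rw [hya, ← hq, ← hp]
        exact sub_mem hx.1 (C.anti _ (by omega) ha)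
      -- `x - D y` is the part `a` of `x`, which lies one step deeper.
      refine ⟨C.T.sqMk _ _ ⟨y, hyZ⟩, ?_⟩
      rw [C.pageD_mk hp hq]
      refine (sub_eq_zero.1 ?_ : _ = C.T.sqMk _ _ _)
      rw [← map_sub]
      refine GMod.sqMk_eq_zero.2 (Submodule.mem_sup_left ?_)
      change C.D.toLin y - (x : C.T) ∈ _
      rw [hya, sub_sub_cancel_left]
      exact neg_mem ha
  · intro c
    obtain ⟨⟨z, hz⟩, rfl⟩ := GMod.sqMk_surjective _ _ c
    obtain ⟨z, rfl⟩ := GMod.sqMk_surjective _ _ z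
    have hz' := hz
    rw [LinearMap.mem_ker, C.pageD_mk hp' hq'] at hz'
    obtain ⟨a, ha, _, ⟨b, hb, rfl⟩, hab⟩ := Submodule.mem_sup.1 (GMod.sqMk_eq_zero.1 hz')
    rw [show p₁ - r + 1 = p + 1 by omega, show p₁ + q₁ - 1 = p + q by omega] at hb
    rw [hq', hp'] at ha
    change a + C.D.toLin b = C.D.toLin z at hab
    -- Subtracting `b`, which vanishes on the page, makes the differential land one step deeper.
    have hzb : (z : C.T) - b ∈ C.Z (r + 1) p (p + q) := by
      refine mem_Z.2 ⟨sub_mem z.2.1 (C.anti _ (by omega) hb), ?_⟩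
      rw [map_sub, ← hab, add_sub_cancel_right, ← add_assoc]
      exact ha
    refine ⟨⟨z - b, hzb⟩, ?_⟩
    refine congrArg (GMod.sqMk (C.page r p q) _ _) (Subtype.ext ?_)
    refine (sub_eq_zero.1 ?_ : C.T.sqMk _ _ _ = _)
    rw [← map_sub]
    refine GMod.sqMk_eq_zero.2 (Submodule.mem_sup_left ?_)
    change (z : C.T) - b - z ∈ _
    rw [sub_sub_cancel_left]
    exact neg_mem hb
  · intro γ z hz
    exact GMod.sqMk_mem_piece (GMod.sqMk_mem_piece hz)

/-- The spectral sequence of a filtered complex. -/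
def specSeq : SpecSeq K w where
  E r p q := C.page r p q
  d r p q p' q' := C.pageD r p q p' q'
  graded r _ p q := C.graded_page r p q
  d_comp r _ p q x := C.pageD_comp (by omega) (by omega) (by omega) (by omega) x
  next r _ p q := C.nextIso (r := r) (by omega) (by omega) (by omega) (by omega)

/-- The cohomology of the complex. -/
abbrev coh (k : ℤ) : GMod K w :=
  C.T.subquotient (LinearMap.ker C.D.toLin ⊓ C.Deg k) ((C.Deg (k - 1)).map C.D.toLin)

theorem homog_cycles (k : ℤ) : C.T.IsHomogeneous (LinearMap.ker C.D.toLin ⊓ C.Deg k) :=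
  C.graded.isHomogeneous_inf (C.D.isHomogeneous_ker C.graded C.graded) (C.homog_deg k)

theorem homog_boundaries (k : ℤ) : C.T.IsHomogeneous ((C.Deg (k - 1)).map C.D.toLin) :=
  C.D.isHomogeneous_map C.graded C.graded (C.homog_deg _)

theorem graded_coh (k : ℤ) : (C.coh k).IsGraded :=
  C.graded.subquotient (C.homog_cycles k) (C.homog_boundaries k)

/-- The filtration induced on the cohomology. -/
def cohFil (k p : ℤ) : Submodule (MvPolynomial ι K) (C.coh k) :=
  ((C.Fil p k).comap (LinearMap.ker C.D.toLin ⊓ C.Deg k).subtype).map (C.T.sqMk _ _)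

theorem homog_cohFil (k p : ℤ) : (C.coh k).IsHomogeneous (C.cohFil k p) := by
  have hF := (C.graded.isHomogeneous_iff _).1 (C.homog p k)
  have hZ := (C.graded.isHomogeneous_iff _).1 (C.homog_cycles k)
  rintro _ ⟨x, hx, rfl⟩
  obtain ⟨s, -, hs⟩ := C.graded.exists_sum_proj (x : C.T)
  have : x = ∑ γ ∈ s, (⟨C.graded.proj γ x, hZ x x.2 γ⟩ :
      (LinearMap.ker C.D.toLin ⊓ C.Deg k : Submodule _ _)) := Subtype.ext (by
    rw [AddSubmonoidClass.coe_finsetSum]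
    exact hs.symm)
  rw [this, map_sum]
  refine Submodule.sum_mem _ fun γ _ => Submodule.mem_iSup_of_mem γ ⟨⟨_, hF x hx γ, rfl⟩, ?_⟩
  exact GMod.sqMk_mem_piece (C.graded.proj_mem γ _)

theorem mem_cohFil {k p : ℤ} {x : (LinearMap.ker C.D.toLin ⊓ C.Deg k : Submodule _ _)} :
    C.T.sqMk _ _ x ∈ C.cohFil k p ↔
      (x : C.T) ∈ C.Fil p k ⊔ (C.Deg (k - 1)).map C.D.toLin := by
  constructor
  · rintro ⟨y, hy, hxy⟩
    have h := GMod.sqMk_eq_zero.1 (sub_eq_zero.2 hxy.symm : C.T.sqMk _ _ _ - C.T.sqMk _ _ _ = 0)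
    change (x : C.T) - y ∈ _ at h
    rw [← add_sub_cancel (y : C.T) x]
    exact Submodule.add_mem_sup hy h
  · intro h
    obtain ⟨a, ha, b, hb, hab⟩ := Submodule.mem_sup.1 h
    have haZ : a ∈ (LinearMap.ker C.D.toLin ⊓ C.Deg k : Submodule _ _) := by
      refine ⟨?_, C.fil_le_deg _ _ ha⟩
      obtain ⟨c, -, rfl⟩ := hb
      have : C.D.toLin x = 0 := x.2.1
      rw [← hab, map_add, C.D_comp, add_zero] at this
      exact this
    refine ⟨⟨a, haZ⟩, ha, ?_⟩
    refine (sub_eq_zero.1 ?_ : C.T.sqMk _ _ _ = _)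
    rw [← map_sub]
    refine GMod.sqMk_eq_zero.2 ?_
    change a - (x : C.T) ∈ _
    rw [← hab, sub_add_cancel_left]
    exact neg_mem hb

/-- For large `r` the page `r` is the graded module associated with the filtration of the
cohomology. -/
def limitIso {r p q : ℤ} (h1 : C.Fil (p + r) (p + q + 1) = ⊥)
    (h2 : C.Fil (p - r + 1) (p + q - 1) = C.Deg (p + q - 1)) :
    GIso (C.page r p q)
      ((C.coh (p + q)).subquotient (C.cohFil (p + q) p) (C.cohFil (p + q) (p + 1))) := by
  have hZ : ∀ x : C.Z r p (p + q), (x : C.T) ∈ LinearMap.ker C.D.toLin ⊓ C.Deg (p + q) := by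
    intro x
    have := x.2.2
    rw [h1] at this
    exact ⟨this, C.fil_le_deg _ _ x.2.1⟩
  have hF : ∀ x : C.Z r p (p + q), C.T.sqMk _ _ ⟨x, hZ x⟩ ∈ C.cohFil (p + q) p :=
    fun x => ⟨⟨x, hZ x⟩, x.2.1, rfl⟩
  refine subquotientIso C.graded (C.homog_Z _ _ _) (C.homog_W _ _ _)
    ((C.graded_coh _).subquotient (C.homog_cohFil _ _) (C.homog_cohFil _ _))
    ((GMod.sqMk _ _ _) ∘ₗ ((C.T.sqMk _ _) ∘ₗ
      ((C.Z r p (p + q)).subtype.codRestrict _ hZ)).codRestrict _ hF) ?_ ?_ ?_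
  · intro x
    refine GMod.sqMk_eq_zero.trans ?_
    refine C.mem_cohFil.trans ?_
    rw [W, h2]
    rfl
  · intro c
    obtain ⟨⟨_, ⟨x, hx, rfl⟩⟩, rfl⟩ := GMod.sqMk_surjective _ _ c
    refine ⟨⟨x, mem_Z.2 ⟨hx, ?_⟩⟩, rfl⟩
    rw [LinearMap.mem_ker.1 x.2.1]
    exact zero_mem _
  · intro γ z hz
    exact GMod.sqMk_mem_piece (GMod.sqMk_mem_piece hz)

theorem convergesTo : C.specSeq.ConvergesTo C.coh := by
  refine ⟨C.cohFil, fun k p p' h => ?_, C.homog_cohFil, fun k => ?_, fun k => ?_, fun p q => ?_⟩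
  · exact Submodule.map_mono (Submodule.comap_mono (C.anti k h))
  · obtain ⟨a, ha⟩ := C.low k
    refine ⟨a, eq_top_iff.2 fun y _ => ?_⟩
    obtain ⟨x, rfl⟩ := GMod.sqMk_surjective _ _ y
    refine ⟨x, ?_, rfl⟩
    change (x : C.T) ∈ C.Fil a k
    rw [ha a le_rfl]
    exact x.2.2
  · obtain ⟨b, hb⟩ := C.high k
    refine ⟨b, eq_bot_iff.2 ?_⟩
    rintro _ ⟨x, hx, rfl⟩
    have hx' : (x : C.T) ∈ C.Fil b k := hx
    rw [hb b le_rfl] at hx'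
    rw [Submodule.mem_bot]
    refine GMod.sqMk_eq_zero.2 ?_
    rw [(Submodule.mem_bot _).1 hx']
    exact zero_mem _
  · obtain ⟨a, ha⟩ := C.low (p + q - 1)
    obtain ⟨b, hb⟩ := C.high (p + q + 1)
    refine ⟨max 2 (max (b - p) (p - a + 1)).toNat, le_max_left _ _, fun r hr => ?_⟩
    have hr1 : b ≤ p + r := by omega
    have hr2 : p - r + 1 ≤ a := by omega
    refine ⟨?_, ?_, ⟨C.limitIso (hb _ hr1) (ha _ hr2)⟩⟩
    · ext1 x
      obtain ⟨x, rfl⟩ := GMod.sqMk_surjective _ _ x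
      refine (C.pageD_mk (r := r) (by omega) (by omega) x).trans (GMod.sqMk_eq_zero.2 ?_)
      have := (mem_Z.1 x.2).2
      rw [hb _ hr1, Submodule.mem_bot] at this
      change C.D.toLin x ∈ _
      rw [this]
      exact zero_mem _
    · ext1 x
      obtain ⟨x, rfl⟩ := GMod.sqMk_surjective _ _ x
      refine (C.pageD_mk (r := r) (by omega) (by omega) x).trans (GMod.sqMk_eq_zero.2 ?_)
      refine Submodule.mem_sup_right ⟨x, ?_, rfl⟩
      have hle := C.fil_le_deg (p - r) (p - r + (q + r - 1))
      have hx : (x : C.T) ∈ C.Deg (p - r + (q + r - 1)) := hle x.2.1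
      have he : p - (r : ℤ) + (q + r - 1) = p + q - 1 := by omega
      rw [ha _ hr2]
      exact he ▸ hx

end FiltCx

/-- Convergence only depends on the abutment up to isomorphism. -/
theorem SpecSeq.ConvergesTo.congr {E : SpecSeq K w} {A B : ℤ → GMod K w} (h : E.ConvergesTo A)
    (hA : ∀ k, (A k).IsGraded) (e : ∀ k, GIso (A k) (B k)) (hB : ∀ k, (B k).IsGraded) :
    E.ConvergesTo B := by
  obtain ⟨Fil, anti, hom, top, bot, lim⟩ := h
  have hom' : ∀ k p, (B k).IsHomogeneous ((Fil k p).map (e k).hom.toLin) :=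
    fun k p => (e k).hom.isHomogeneous_map (hA k) (hB k) (hom k p)
  refine ⟨fun k p => (Fil k p).map (e k).hom.toLin, fun k p p' h => Submodule.map_mono (anti k h),
    hom', fun k => ?_, fun k => ?_, fun p q => ?_⟩
  · obtain ⟨a, ha⟩ := top k
    refine ⟨a, ?_⟩
    beta_reduce
    rw [ha, Submodule.map_top]
    exact LinearMap.range_eq_top.2 (e k).toEquiv.surjective
  · obtain ⟨b, hb⟩ := bot k
    exact ⟨b, by beta_reduce; rw [hb, Submodule.map_bot]⟩
  · obtain ⟨r₀, h2, hr⟩ := lim p q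
    refine ⟨r₀, h2, fun r hrr => ?_⟩
    obtain ⟨h3, h4, ⟨i⟩⟩ := hr r hrr
    refine ⟨h3, h4, ⟨i.trans ?_⟩⟩
    set k := p + q
    have hmem : ∀ p' (x : A k), (e k).hom.toLin x ∈ (Fil k p').map (e k).hom.toLin ↔
        x ∈ Fil k p' := by
      intro p' x
      refine ⟨?_, fun h => ⟨x, h, rfl⟩⟩
      rintro ⟨y, hy, hxy⟩
      rwa [← (e k).toEquiv.injective hxy]
    refine subquotientIso (hA k) (hom k p) (hom k (p + 1))
      ((hB k).subquotient (hom' k p) (hom' k (p + 1)))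
      ((GMod.sqMk _ _ _) ∘ₗ (e k).hom.toLin.restrict (fun x hx => (hmem p x).2 hx)) ?_ ?_ ?_
    · intro x
      exact GMod.sqMk_eq_zero.trans (hmem _ _)
    · intro c
      obtain ⟨⟨_, ⟨x, hx, rfl⟩⟩, rfl⟩ := GMod.sqMk_surjective _ _ c
      exact ⟨⟨x, hx⟩, rfl⟩
    · intro γ z hz
      exact GMod.sqMk_mem_piece ((e k).hom.map_piece γ _ hz)

/-! ### Double complexes -/

variable (K w) in
/-- A double complex of graded modules with anticommuting differentials `h` (in the first index)
and `v` (in the second index). The differentials are given between any two positions, but only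
those that raise an index by one matter. Every diagonal `p + q = k` has finitely many terms. -/
structure DoubleCx where
  X : ℤ → ℤ → GMod K w
  h : ∀ p p' q, GHom (X p q) (X p' q)
  v : ∀ p q q', GHom (X p q) (X p q')
  hh : ∀ p p' p'' q, p + 1 = p' → p' + 1 = p'' → ∀ x,
    (h p' p'' q).toLin ((h p p' q).toLin x) = 0
  vv : ∀ p q q' q'', q + 1 = q' → q' + 1 = q'' → ∀ x,
    (v p q' q'').toLin ((v p q q').toLin x) = 0
  anti : ∀ p p' q q', p + 1 = p' → q + 1 = q' → ∀ x,
    (v p' q q').toLin ((h p p' q).toLin x) + (h p p' q').toLin ((v p q q').toLin x) = 0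
  graded : ∀ p q, (X p q).IsGraded
  bdd : ∀ k, ∃ a b, ∀ p q, p + q = k → p < a ∨ b < p → Subsingleton (X p q)

namespace DoubleCx

variable (A : DoubleCx K w)

/-- The double complex with the two directions exchanged. -/
def swap : DoubleCx K w where
  X p q := A.X q p
  h p p' q := A.v q p p'
  v p q q' := A.h q q' p
  hh p p' p'' q := A.vv q p p' p''
  vv p q q' q'' := A.hh q q' q'' p
  anti p p' q q' hp hq x := by
    rw [add_comm]
    exact A.anti q q' p p' hq hp x
  graded p q := A.graded q p
  bdd k := by
    obtain ⟨a, b, hab⟩ := A.bdd k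
    exact ⟨k - b, k - a, fun p q hpq hp => hab q p (by omega) (by omega)⟩

/-- The direct sum of all terms of the double complex. -/
def tot : GMod K w where
  carrier := Π₀ i : ℤ × ℤ, A.X i.1 i.2
  piece γ :=
    { carrier := {x | ∀ i, x i ∈ (A.X i.1 i.2).piece γ}
      add_mem' := fun hx hy i => add_mem (hx i) (hy i)
      zero_mem' := fun _ => zero_mem _
      smul_mem' := fun c _ hx i => Submodule.smul_mem _ c (hx i) }

/-- The inclusion of a term. -/
def incl (p q : ℤ) : GHom (A.X p q) A.tot where
  toLin := DFinsupp.lsingle (M := fun i : ℤ × ℤ => A.X i.1 i.2) (p, q)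
  map_piece γ x hx i := by
    by_cases hi : (p, q) = i
    · subst hi
      have h : DFinsupp.single (β := fun i : ℤ × ℤ => A.X i.1 i.2) (p, q) x (p, q) = x :=
        DFinsupp.single_eq_same
      exact h.symm ▸ hx
    · have h : DFinsupp.single (β := fun i : ℤ × ℤ => A.X i.1 i.2) (p, q) x i = 0 :=
        DFinsupp.single_eq_of_ne (Ne.symm hi)
      exact h.symm ▸ zero_mem _

/-- The projection to a term. -/
def coord (p q : ℤ) : GHom A.tot (A.X p q) where
  toLin := DFinsupp.lapply (M := fun i : ℤ × ℤ => A.X i.1 i.2) (p, q)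
  map_piece _ _ hx := hx (p, q)

variable {A}

@[simp] theorem coord_incl (p q : ℤ) (x : A.X p q) :
    (A.coord p q).toLin ((A.incl p q).toLin x) = x :=
  DFinsupp.single_eq_same

theorem coord_incl_ne {p q p' q' : ℤ} (h : ¬ (p' = p ∧ q' = q)) (x : A.X p q) :
    (A.coord p' q').toLin ((A.incl p q).toLin x) = 0 :=
  DFinsupp.single_eq_of_ne (fun e => h (Prod.ext_iff.1 e))

theorem tot_ext {x y : A.tot}
    (h : ∀ p q, (A.coord p q).toLin x = (A.coord p q).toLin y) : x = y :=
  DFinsupp.ext fun i => h i.1 i.2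

theorem tot_induction {motive : A.tot → Prop} (x : A.tot) (zero : motive 0)
    (incl : ∀ p q x, motive ((A.incl p q).toLin x))
    (add : ∀ x y, motive x → motive y → motive (x + y)) : motive x := by
  exact DFinsupp.induction (p := motive) x zero
    fun i b f _ _ hf => add _ _ (incl i.1 i.2 b) hf

variable (A) in
theorem graded_tot : A.tot.IsGraded := by
  let P : Γ → A.tot →ₗ[K] A.tot := fun γ =>
    (DFinsupp.mapRange.linearMap (fun i : ℤ × ℤ => (A.graded i.1 i.2).proj γ) :
      (Π₀ i : ℤ × ℤ, A.X i.1 i.2) →ₗ[K] (Π₀ i : ℤ × ℤ, A.X i.1 i.2))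
  have hP : ∀ γ x p q, (A.coord p q).toLin (P γ x) =
      (A.graded p q).proj γ ((A.coord p q).toLin x) := fun γ x p q => rfl
  refine GMod.IsGraded.of_separating P ?_ ?_ ?_ ?_
  · intro γ x hx h0
    refine Eq.trans (tot_ext fun p q => ?_) h0
    rw [hP, (A.graded p q).proj_of_mem ((A.coord p q).map_piece _ _ hx)]
  · intro γ δ hne x hx
    refine tot_ext fun p q => ?_
    rw [hP, (A.graded p q).proj_of_mem_ne ((A.coord p q).map_piece _ _ hx) hne, map_zero]
  · intro x
    induction x using tot_induction with
    | zero => exact zero_mem _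
    | incl p q x =>
      induction x using (A.graded p q).induction with
      | mem γ y hy => exact Submodule.mem_iSup_of_mem γ ((A.incl p q).map_piece γ y hy)
      | zero => rw [map_zero]; exact zero_mem _
      | add y z hy hz => rw [map_add]; exact add_mem hy hz
    | add x y hx hy => exact add_mem hx hy
  · intro a γ s x hs hx i
    exact (A.graded i.1 i.2).smul_mem a γ s _ hs (hx i)

variable (A) in
/-- The total differential as a linear map. -/
def DLin : A.tot →ₗ[MvPolynomial ι K] A.tot :=
  (DFinsupp.lsum ℕ fun i : ℤ × ℤ =>
    (A.incl (i.1 + 1) i.2).toLin ∘ₗ (A.h i.1 (i.1 + 1) i.2).toLin +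
      (A.incl i.1 (i.2 + 1)).toLin ∘ₗ (A.v i.1 i.2 (i.2 + 1)).toLin :
    (Π₀ i : ℤ × ℤ, A.X i.1 i.2) →ₗ[MvPolynomial ι K] A.tot)

theorem DLin_incl {p q p' q' : ℤ} (hp : p + 1 = p') (hq : q + 1 = q') (x : A.X p q) :
    A.DLin ((A.incl p q).toLin x) = (A.incl p' q).toLin ((A.h p p' q).toLin x) +
      (A.incl p q').toLin ((A.v p q q').toLin x) := by
  subst hp hq
  exact DFinsupp.lsum_single _ _ _ _

theorem coord_DLin {p q p₀ q₀ : ℤ} (hp : p₀ + 1 = p) (hq : q₀ + 1 = q) (x : A.tot) :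
    (A.coord p q).toLin (A.DLin x) = (A.h p₀ p q).toLin ((A.coord p₀ q).toLin x) +
      (A.v p q₀ q).toLin ((A.coord p q₀).toLin x) := by
  induction x using tot_induction with
  | zero => simp
  | incl a b x =>
    rw [DLin_incl rfl rfl, map_add]
    congr 1
    · by_cases h : p₀ = a ∧ q = b
      · obtain ⟨rfl, rfl⟩ := h
        subst hp
        rw [coord_incl, coord_incl]
      · rw [coord_incl_ne h, map_zero, coord_incl_ne]
        omega
    · by_cases h : p = a ∧ q₀ = b
      · obtain ⟨rfl, rfl⟩ := h
        subst hq
        rw [coord_incl, coord_incl]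
      · rw [coord_incl_ne h, map_zero, coord_incl_ne]
        omega
  | add x y hx hy =>
    simp only [map_add, hx, hy]
    abel

variable (A) in
/-- The total differential. -/
def D : GHom A.tot A.tot where
  toLin := A.DLin
  map_piece γ x hx i := by
    have h := coord_DLin (A := A) (sub_add_cancel i.1 1) (sub_add_cancel i.2 1) x
    change (A.coord i.1 i.2).toLin (A.DLin x) ∈ _
    rw [h]
    exact add_mem ((A.h _ _ _).map_piece γ _ ((A.coord _ _).map_piece _ _ hx))
      ((A.v _ _ _).map_piece γ _ ((A.coord _ _).map_piece _ _ hx))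

theorem D_incl {p q p' q' : ℤ} (hp : p + 1 = p') (hq : q + 1 = q') (x : A.X p q) :
    A.D.toLin ((A.incl p q).toLin x) = (A.incl p' q).toLin ((A.h p p' q).toLin x) +
      (A.incl p q').toLin ((A.v p q q').toLin x) :=
  DLin_incl hp hq x

theorem coord_D {p q p₀ q₀ : ℤ} (hp : p₀ + 1 = p) (hq : q₀ + 1 = q) (x : A.tot) :
    (A.coord p q).toLin (A.D.toLin x) = (A.h p₀ p q).toLin ((A.coord p₀ q).toLin x) +
      (A.v p q₀ q).toLin ((A.coord p q₀).toLin x) :=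
  coord_DLin hp hq x

theorem D_D (x : A.tot) : A.D.toLin (A.D.toLin x) = 0 := by
  induction x using tot_induction with
  | zero => simp
  | incl p q x =>
    rw [D_incl rfl rfl, map_add, D_incl rfl rfl, D_incl rfl rfl, A.hh _ _ _ _ rfl rfl,
      A.vv _ _ _ _ rfl rfl, map_zero, map_zero, zero_add, add_zero, ← map_add,
      A.anti _ _ _ _ rfl rfl, map_zero]
  | add x y hx hy => rw [map_add, map_add, hx, hy, add_zero]

variable (A) in
/-- The elements of the total complex of degree `k`. -/
def deg (k : ℤ) : Submodule (MvPolynomial ι K) A.tot where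
  carrier := {x | ∀ p q, p + q ≠ k → (A.coord p q).toLin x = 0}
  add_mem' hx hy p q h := by rw [map_add, hx p q h, hy p q h, add_zero]
  zero_mem' p q h := map_zero _
  smul_mem' c x hx p q h := by rw [map_smul, hx p q h, smul_zero]

variable (A) in
/-- The elements of degree `k` with components in the columns `≥ p₀`. -/
def fil (p₀ k : ℤ) : Submodule (MvPolynomial ι K) A.tot where
  carrier := {x | ∀ p q, ¬ (p₀ ≤ p ∧ p + q = k) → (A.coord p q).toLin x = 0}
  add_mem' hx hy p q h := by rw [map_add, hx p q h, hy p q h, add_zero]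
  zero_mem' p q h := map_zero _
  smul_mem' c x hx p q h := by rw [map_smul, hx p q h, smul_zero]

theorem incl_mem_deg {p q k : ℤ} (h : p + q = k) (x : A.X p q) :
    (A.incl p q).toLin x ∈ A.deg k := by
  intro p' q' h'
  exact coord_incl_ne (by omega) x

theorem incl_mem_fil {p q p₀ k : ℤ} (hp : p₀ ≤ p) (h : p + q = k) (x : A.X p q) :
    (A.incl p q).toLin x ∈ A.fil p₀ k := by
  intro p' q' h'
  exact coord_incl_ne (by omega) x

variable (A) in
/-- The total complex, filtered by columns. -/
abbrev filt : FiltCx K w where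
  T := A.tot
  D := A.D
  Deg := A.deg
  Fil := A.fil
  graded := A.graded_tot
  D_comp := D_D
  homog p k := by
    rw [A.graded_tot.isHomogeneous_iff]
    intro x hx γ p' q' h
    rw [(A.coord p' q').map_proj A.graded_tot (A.graded p' q'), hx p' q' h, map_zero]
  anti k p p' h x hx a b hab := hx a b (by omega)
  D_mem p k x hx a b hab := by
    rw [coord_D (sub_add_cancel a 1) (sub_add_cancel b 1), hx _ _ (by omega), hx _ _ (by omega),
      map_zero, map_zero, add_zero]
  low k := by
    obtain ⟨a, b, hab⟩ := A.bdd k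
    refine ⟨a, fun p hp => le_antisymm (fun x hx i j h => hx i j (by omega)) fun x hx i j h => ?_⟩
    by_cases hk : i + j = k
    · have := hab i j hk (by omega)
      exact Subsingleton.elim _ _
    · exact hx i j hk
  high k := by
    obtain ⟨a, b, hab⟩ := A.bdd k
    refine ⟨b + 1, fun p hp => eq_bot_iff.2 fun x hx => ?_⟩
    rw [Submodule.mem_bot]
    refine tot_ext fun i j => ?_
    rw [map_zero]
    by_cases hk : i + j = k
    · by_cases hb : b < i
      · have := hab i j hk (Or.inr hb)
        exact Subsingleton.elim _ _
      · exact hx i j (by omega)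
    · exact hx i j (by omega)

theorem coord_D_eq {p q p₀ q₀ k : ℤ} {x : A.tot} (hx : A.D.toLin x ∈ A.fil p₀ k)
    (hp : p < p₀) (hq : q₀ + 1 = q) : (A.h (p - 1) p q).toLin ((A.coord (p - 1) q).toLin x) +
      (A.v p q₀ q).toLin ((A.coord p q₀).toLin x) = 0 := by
  rw [← coord_D (sub_add_cancel p 1) hq]
  exact hx p q (by omega)

/-- The second page of the spectral sequence of the filtration by columns, when the vertical
cohomology in the row `q` is given as `N p` by means of maps `κ p` from the vertical cycles. -/
def e2Iso (p q : ℤ) (N : ℤ → GMod K w) (δ : ∀ p p', GHom (N p) (N p')) (hN : ∀ p, (N p).IsGraded)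
    (κ : ∀ p, LinearMap.ker (A.v p q (q + 1)).toLin →ₗ[MvPolynomial ι K] N p)
    (κ_surj : ∀ p, Function.Surjective (κ p))
    (κ_ker : ∀ p a, κ p a = 0 ↔ (a : A.X p q) ∈ LinearMap.range (A.v p (q - 1) q).toLin)
    (κ_piece : ∀ p γ, ∀ a : LinearMap.ker (A.v p q (q + 1)).toLin,
      (a : A.X p q) ∈ (A.X p q).piece γ → κ p a ∈ (N p).piece γ)
    (κ_δ : ∀ p p', p + 1 = p' → ∀ (a : LinearMap.ker (A.v p q (q + 1)).toLin)
      (a' : LinearMap.ker (A.v p' q (q + 1)).toLin), (a' : A.X p' q) = (A.h p p' q).toLin a →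
      κ p' a' = (δ p p').toLin (κ p a)) :
    GIso (A.filt.page 2 p q) (homology (δ (p - 1) p).toLin (δ p (p + 1)).toLin) := by
  have hZ : ∀ x ∈ A.filt.Z 2 p (p + q), x ∈ A.fil p (p + q) ∧
    A.D.toLin x ∈ A.fil (p + 2) (p + q + 1) := fun x hx => hx
  have hv : ∀ x : A.filt.Z 2 p (p + q),
      (A.coord p q).toLin x ∈ LinearMap.ker (A.v p q (q + 1)).toLin := by
    intro x
    have h := coord_D_eq (hZ x x.2).2 (show p < p + 2 by omega) (rfl : q + 1 = q + 1)
    rwa [(hZ x x.2).1 _ _ (by omega), map_zero, zero_add] at h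
  have hvh : ∀ p p', p + 1 = p' → ∀ a : LinearMap.ker (A.v p q (q + 1)).toLin,
      (A.h p p' q).toLin a ∈ LinearMap.ker (A.v p' q (q + 1)).toLin := by
    intro p p' hp a
    have h := A.anti p p' q (q + 1) hp rfl a
    rwa [LinearMap.mem_ker.1 a.2, map_zero, add_zero] at h
  have hδκ : ∀ p p', p + 1 = p' → ∀ a : LinearMap.ker (A.v p q (q + 1)).toLin,
      ((δ p p').toLin (κ p a) = 0 ↔
        (A.h p p' q).toLin a ∈ LinearMap.range (A.v p' (q - 1) q).toLin) := by
    intro p p' hp a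
    rw [← κ_δ p p' hp a ⟨_, hvh p p' hp a⟩ rfl, κ_ker]
  have hδ : ∀ x : A.filt.Z 2 p (p + q),
      κ p ⟨(A.coord p q).toLin x, hv x⟩ ∈ LinearMap.ker (δ p (p + 1)).toLin := by
    intro x
    rw [LinearMap.mem_ker, hδκ p (p + 1) rfl]
    have h := coord_D_eq (hZ x x.2).2 (show p + 1 < p + 2 by omega) (sub_add_cancel q 1)
    rw [add_sub_cancel_right] at h
    refine ⟨- (A.coord (p + 1) (q - 1)).toLin x, ?_⟩
    rw [map_neg]
    exact (eq_neg_of_add_eq_zero_left h).symm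
  refine subquotientIso A.graded_tot (A.filt.homog_Z _ _ _) (A.filt.homog_W _ _ _)
    (isGraded_homology _ _ (hN _) (hN _) (hN _))
    ((GMod.sqMk _ _ _) ∘ₗ ((κ p) ∘ₗ ((A.coord p q).toLin ∘ₗ
      (A.filt.Z 2 p (p + q)).subtype).codRestrict _ hv).codRestrict _ hδ) ?_ ?_ ?_
  · intro x
    refine GMod.sqMk_eq_zero.trans ?_
    change κ p ⟨(A.coord p q).toLin x, hv x⟩ ∈ LinearMap.range (δ (p - 1) p).toLin ↔
      (x : A.tot) ∈ A.fil (p + 1) (p + q) ⊔ (A.fil (p - 2 + 1) (p + q - 1)).map A.D.toLin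
    constructor
    · rintro ⟨c, hc⟩
      obtain ⟨c, rfl⟩ := κ_surj _ c
      rw [← κ_δ (p - 1) p (by omega) c ⟨_, hvh (p - 1) p (by omega) c⟩ rfl] at hc
      have h0 := (κ_ker _ _).1 (sub_eq_zero.2 hc.symm |> (map_sub (κ p) _ _).trans)
      obtain ⟨e, he⟩ := h0
      change (A.v p (q - 1) q).toLin e = (A.coord p q).toLin x - (A.h (p - 1) p q).toLin c at he
      -- The total differential of `c + e` cancels the component of `x` in the column `p`.
      have hbF : (A.incl (p - 1) q).toLin (c : A.X (p - 1) q) + (A.incl p (q - 1)).toLin e ∈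
          A.fil (p - 2 + 1) (p + q - 1) :=
        add_mem (incl_mem_fil (by omega) (by omega) _) (incl_mem_fil (by omega) (by omega) _)
      refine Submodule.mem_sup.2 ⟨_, ?_, _, ⟨_, hbF, rfl⟩, sub_add_cancel _ _⟩
      intro p' q' h
      by_cases hk : p' + q' = p + q
      · have hp' : p' ≤ p := by omega
        rw [map_sub, map_add, D_incl (sub_add_cancel p 1) rfl, LinearMap.mem_ker.1 c.2, map_zero,
          add_zero, D_incl rfl (sub_add_cancel q 1), map_add, map_add]
        rw [coord_incl_ne (p := p + 1) (by omega), zero_add]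
        by_cases hpp : p' = p
        · subst hpp
          obtain rfl : q' = q := by omega
          rw [coord_incl, coord_incl, he]
          abel
        · rw [coord_incl_ne (by omega), coord_incl_ne (by omega), (hZ x x.2).1 _ _ (by omega)]
          simp
      · rw [map_sub, (hZ x x.2).1 _ _ (by omega),
          (A.filt.D_mem _ _ _ hbF : _ ∈ A.fil _ _) _ _ (by omega), sub_zero]
    · intro hx
      obtain ⟨a, ha, _, ⟨b, hb, rfl⟩, hab⟩ := Submodule.mem_sup.1 hx
      have hvc : (A.coord (p - 1) q).toLin b ∈ LinearMap.ker (A.v (p - 1) q (q + 1)).toLin := by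
        have h := coord_D (A := A) (sub_add_cancel (p - 1) 1) (rfl : q + 1 = q + 1) b
        rw [hb (p - 1 - 1) _ (by omega), map_zero, zero_add] at h
        rw [LinearMap.mem_ker, ← h, eq_sub_of_add_eq' hab, map_sub, (hZ x x.2).1 _ _ (by omega),
          ha _ _ (by omega), sub_zero]
      refine ⟨κ (p - 1) ⟨_, hvc⟩, ?_⟩
      rw [← κ_δ (p - 1) p (by omega) ⟨_, hvc⟩ ⟨_, hvh (p - 1) p (by omega) ⟨_, hvc⟩⟩ rfl,
        ← sub_eq_zero, ← map_sub, κ_ker]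
      change (A.h (p - 1) p q).toLin ((A.coord (p - 1) q).toLin b) - (A.coord p q).toLin x ∈ _
      have h := coord_D (A := A) (sub_add_cancel p 1) (sub_add_cancel q 1) b
      rw [← hab, map_add, ha _ _ (by omega), zero_add, h]
      refine ⟨- (A.coord p (q - 1)).toLin b, ?_⟩
      rw [map_neg]
      abel
  · intro c
    obtain ⟨⟨c, hc⟩, rfl⟩ := GMod.sqMk_surjective _ _ c
    obtain ⟨a, rfl⟩ := κ_surj p c
    rw [LinearMap.mem_ker, hδκ p (p + 1) rfl] at hc
    obtain ⟨b, hb⟩ := hc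
    have hvb : (A.v (p + 1) (q - 1) q).toLin b = (A.h p (p + 1) q).toLin a := hb
    -- The correction by `b` pushes the total differential of `a` into the columns `≥ p + 2`.
    have hx : (A.incl p q).toLin (a : A.X p q) - (A.incl (p + 1) (q - 1)).toLin b ∈
        A.filt.Z 2 p (p + q) := by
      refine FiltCx.mem_Z.2 ⟨sub_mem (incl_mem_fil le_rfl rfl _)
        (incl_mem_fil (by omega) (by omega) _), ?_⟩
      change A.D.toLin _ ∈ A.fil (p + 2) (p + q + 1)
      rw [map_sub, D_incl rfl rfl, D_incl rfl (sub_add_cancel q 1), LinearMap.mem_ker.1 a.2, hvb,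
        map_zero, add_zero, sub_add_cancel_right]
      exact neg_mem (incl_mem_fil (by omega) (by omega) _)
    refine ⟨⟨_, hx⟩, ?_⟩
    refine congrArg (GMod.sqMk (N p) _ _) (Subtype.ext (congrArg (κ p) (Subtype.ext ?_)))
    change (A.coord p q).toLin ((A.incl p q).toLin (a : A.X p q) -
      (A.incl (p + 1) (q - 1)).toLin b) = a
    rw [map_sub, coord_incl, coord_incl_ne (by omega), sub_zero]
  · intro γ z hz
    exact GMod.sqMk_mem_piece (κ_piece p γ _ ((A.coord p q).map_piece γ _ hz))

/-- In a double complex with rows exact to the left of the column `n`, a cycle that lives in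
columns `< n` is a boundary of an element living one column further to the left. -/
theorem exists_D_eq {n : ℤ}
    (hex : ∀ p q, p < n → ∀ a, (A.h p (p + 1) q).toLin a = 0 →
      a ∈ LinearMap.range (A.h (p - 1) p q).toLin) {k s : ℤ} (hs : s < n) {x : A.tot}
    (hx : x ∈ A.deg k) (hD : A.D.toLin x = 0) (hxs : ∀ p q, s < p → (A.coord p q).toLin x = 0) :
    ∃ y ∈ A.deg (k - 1), (∀ p q, s - 1 < p → (A.coord p q).toLin y = 0) ∧ A.D.toLin y = x := by
  obtain ⟨a, b, hab⟩ := A.bdd k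
  -- Induction on the number of columns between the bound `a` and the column `s`.
  obtain ⟨j, hj⟩ : ∃ j : ℕ, s - a < j := ⟨(s - a + 1).toNat, by omega⟩
  induction j generalizing s x with
  | zero =>
    refine ⟨0, zero_mem _, fun p q _ => map_zero _, ?_⟩
    rw [map_zero]
    refine tot_ext fun p q => ?_
    rw [map_zero]
    by_cases hk : p + q = k
    · by_cases hp : s < p
      · exact (hxs p q hp).symm
      · have := hab p q hk (by push_cast at hj; omega)
        exact Subsingleton.elim _ _
    · exact (hx p q hk).symm
  | succ j ih =>
    have h := coord_D (A := A) (rfl : s + 1 = s + 1) (sub_add_cancel (k - s) 1) x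
    rw [hD, map_zero, hxs (s + 1) _ (by omega), map_zero, add_zero] at h
    obtain ⟨c, hc⟩ := hex s (k - s) hs _ h.symm
    have hcd : (A.incl (s - 1) (k - s)).toLin c ∈ A.deg (k - 1) := incl_mem_deg (by omega) c
    have hDc : A.D.toLin ((A.incl (s - 1) (k - s)).toLin c) ∈ A.deg k := by
      have := A.filt.D_mem_deg hcd
      rwa [sub_add_cancel] at this
    have hDc' := D_incl (A := A) (sub_add_cancel s 1) (rfl : k - s + 1 = k - s + 1) c
    -- Subtracting `D c` clears the column `s`.
    obtain ⟨y, hy, hys, hDy⟩ := ih (s := s - 1)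
      (x := x - A.D.toLin ((A.incl (s - 1) (k - s)).toLin c)) (by omega)
      (sub_mem hx hDc) (by rw [map_sub, hD, D_D, sub_zero]) (by
        intro p q hp
        by_cases hk : p + q = k
        · rw [map_sub, hDc', hc, map_add]
          rw [coord_incl_ne (p := s - 1) (by omega), add_zero]
          by_cases hps : p = s
          · subst hps
            obtain rfl : q = k - p := by omega
            rw [coord_incl, sub_self]
          · rw [coord_incl_ne (by omega), hxs p q (by omega), sub_zero]
        · exact sub_mem hx hDc p q hk) (by push_cast at hj; omega)
    refine ⟨y + (A.incl (s - 1) (k - s)).toLin c, add_mem hy hcd, fun p q hp => ?_, ?_⟩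
    · rw [map_add, hys p q (by omega), coord_incl_ne (by omega), add_zero]
    · rw [map_add, hDy, sub_add_cancel]

end DoubleCx

namespace DoubleCx

variable {A : DoubleCx K w}

/-- If the rows of a double complex are exact except at the right end, in the column `n`, then
the cohomology of the total complex is computed by any graded complex that receives a surjection
`ε` from the column `n` whose kernel is the image of the horizontal differential. The hypotheses
`hZ` and `hW` express this for one term `N` of that complex, with cycles `Z` and boundaries `W`. -/
theorem exists_projIso {n q k : ℤ} (hk : n + q = k) (hX : ∀ p q, n < p → Subsingleton (A.X p q))
    (hex : ∀ p q, p < n → ∀ a, (A.h p (p + 1) q).toLin a = 0 →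
      a ∈ LinearMap.range (A.h (p - 1) p q).toLin)
    {N : GMod K w} (hN : N.IsGraded) {Z W : Submodule (MvPolynomial ι K) N}
    (homZ : N.IsHomogeneous Z) (homW : N.IsHomogeneous W)
    (ε : GHom (A.X n q) N) (ε_surj : Function.Surjective ε.toLin)
    (hZ : ∀ a, ε.toLin a ∈ Z ↔
      (A.v n q (q + 1)).toLin a ∈ LinearMap.range (A.h (n - 1) n (q + 1)).toLin)
    (hW : ∀ a, ε.toLin a ∈ W ↔ ∃ b c,
      (A.v n (q - 1) q).toLin b + (A.h (n - 1) n q).toLin c = a) :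
    ∃ (e : GIso (A.filt.coh k) (N.subquotient Z W))
      (hεZ : ∀ x : (LinearMap.ker A.D.toLin ⊓ A.deg k : Submodule _ _),
        ε.toLin ((A.coord n q).toLin x) ∈ Z),
      ∀ x, e.toEquiv (A.tot.sqMk _ _ x) = N.sqMk Z W ⟨_, hεZ x⟩ := by
  have hεZ : ∀ x : (LinearMap.ker A.D.toLin ⊓ A.deg k : Submodule _ _),
      ε.toLin ((A.coord n q).toLin x) ∈ Z := by
    intro x
    rw [hZ]
    have h := coord_D (A := A) (sub_add_cancel n 1) (rfl : q + 1 = q + 1) x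
    rw [LinearMap.mem_ker.1 x.2.1, map_zero] at h
    refine ⟨- (A.coord (n - 1) (q + 1)).toLin x, ?_⟩
    rw [map_neg]
    exact neg_eq_of_add_eq_zero_right h.symm
  refine ⟨subquotientIso A.graded_tot (A.filt.homog_cycles k) (A.filt.homog_boundaries k)
    (hN.subquotient homZ homW) ((N.sqMk Z W) ∘ₗ (ε.toLin ∘ₗ (A.coord n q).toLin ∘ₗ
      (LinearMap.ker A.D.toLin ⊓ A.deg k : Submodule _ _).subtype).codRestrict _ hεZ) ?_ ?_ ?_,
    hεZ, fun x => rfl⟩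
  · intro x
    refine GMod.sqMk_eq_zero.trans ((hW ((A.coord n q).toLin x)).trans ?_)
    constructor
    · rintro ⟨b, c, hbc⟩
      have hbd : (A.incl n (q - 1)).toLin b + (A.incl (n - 1) q).toLin c ∈ A.deg (k - 1) :=
        add_mem (incl_mem_deg (by omega) b) (incl_mem_deg (by omega) c)
      have hDb : A.D.toLin ((A.incl n (q - 1)).toLin b + (A.incl (n - 1) q).toLin c) ∈
          A.deg k := by
        have := A.filt.D_mem_deg hbd
        rwa [sub_add_cancel] at this
      obtain ⟨y, hy, -, hDy⟩ := exists_D_eq hex (s := n - 1) (by omega)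
        (x := x - A.D.toLin ((A.incl n (q - 1)).toLin b + (A.incl (n - 1) q).toLin c))
        (sub_mem x.2.2 hDb) (by rw [map_sub, LinearMap.mem_ker.1 x.2.1, D_D, sub_zero]) (by
          intro p q' hp
          by_cases hpn : n < p
          · have := hX p q' hpn
            exact Subsingleton.elim _ _
          obtain rfl : p = n := by omega
          by_cases hq : q' = q
          · subst hq
            have e1 : (A.coord (p - 1) q').toLin
                ((A.incl p (q' - 1)).toLin b + (A.incl (p - 1) q').toLin c) = c := by
              rw [map_add, coord_incl, coord_incl_ne (by omega), zero_add]
            have e2 : (A.coord p (q' - 1)).toLin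
                ((A.incl p (q' - 1)).toLin b + (A.incl (p - 1) q').toLin c) = b := by
              rw [map_add, coord_incl, coord_incl_ne (by omega), add_zero]
            rw [map_sub, coord_D (sub_add_cancel p 1) (sub_add_cancel q' 1), e1, e2, ← hbc,
              add_comm, sub_self]
          · exact sub_mem x.2.2 hDb p q' (by omega))
      exact ⟨_, add_mem hy hbd, by rw [map_add, hDy, sub_add_cancel]⟩
    · rintro ⟨y, -, hy⟩
      refine ⟨(A.coord n (q - 1)).toLin y, (A.coord (n - 1) q).toLin y, ?_⟩
      rw [add_comm, ← coord_D (sub_add_cancel n 1) (sub_add_cancel q 1), hy]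
  · intro c
    obtain ⟨⟨c, hc⟩, rfl⟩ := GMod.sqMk_surjective _ _ c
    obtain ⟨a, rfl⟩ := ε_surj c
    obtain ⟨b, hb⟩ := (hZ a).1 hc
    have hxd : (A.incl n q).toLin a - (A.incl (n - 1) (q + 1)).toLin b ∈ A.deg k :=
      sub_mem (incl_mem_deg hk a) (incl_mem_deg (by omega) b)
    have hn : ∀ z, (A.h n (n + 1) q).toLin z = 0 := fun z => by
      have := hX (n + 1) q (by omega)
      exact Subsingleton.elim _ _
    have hD : A.D.toLin ((A.incl n q).toLin a - (A.incl (n - 1) (q + 1)).toLin b) =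
        - (A.incl (n - 1) (q + 1 + 1)).toLin ((A.v (n - 1) (q + 1) (q + 1 + 1)).toLin b) := by
      rw [map_sub, D_incl rfl rfl, D_incl (sub_add_cancel n 1) rfl, hn, map_zero, zero_add, hb]
      abel
    have hDd : A.D.toLin ((A.incl n q).toLin a - (A.incl (n - 1) (q + 1)).toLin b) ∈
        A.deg (k + 1) := A.filt.D_mem_deg hxd
    -- The differential of `a - b` lives in columns `< n`, so it is removed by some `y` in columns
    -- `< n - 1`.
    obtain ⟨y, hy, hyn, hDy⟩ := exists_D_eq hex (s := n - 1) (by omega) hDd (D_D _) (by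
      intro p q' hp
      rw [hD, map_neg, coord_incl_ne (by omega), neg_zero])
    rw [add_sub_cancel_right] at hy
    refine ⟨⟨(A.incl n q).toLin a - (A.incl (n - 1) (q + 1)).toLin b - y, ?_, sub_mem hxd hy⟩, ?_⟩
    · change A.D.toLin _ = 0
      rw [map_sub, hDy, sub_self]
    · refine congrArg (N.sqMk Z W) (Subtype.ext (congrArg ε.toLin ?_))
      change (A.coord n q).toLin
        ((A.incl n q).toLin a - (A.incl (n - 1) (q + 1)).toLin b - y) = a
      rw [map_sub, map_sub, coord_incl, coord_incl_ne (by omega), hyn _ _ (by omega), sub_zero,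
        sub_zero]
  · intro γ z hz
    exact GMod.sqMk_mem_piece (ε.map_piece γ _ ((A.coord n q).map_piece γ _ hz))

variable (A) in
/-- The total complex does not change when the two directions are exchanged. -/
def swapLin : A.swap.tot →ₗ[MvPolynomial ι K] A.tot :=
  (DFinsupp.lsum ℕ fun i : ℤ × ℤ => (A.incl i.2 i.1).toLin :
    (Π₀ i : ℤ × ℤ, A.swap.X i.1 i.2) →ₗ[MvPolynomial ι K] A.tot)

theorem coord_swapLin (p q : ℤ) (x : A.swap.tot) :
    (A.coord p q).toLin (A.swapLin x) = (A.swap.coord q p).toLin x := by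
  induction x using tot_induction with
  | zero => rw [map_zero, map_zero, map_zero]; rfl
  | incl a b x =>
    have h : A.swapLin ((A.swap.incl a b).toLin x) = (A.incl b a).toLin x :=
      DFinsupp.lsum_single _ _ _ _
    rw [h]
    by_cases hab : p = b ∧ q = a
    · obtain ⟨rfl, rfl⟩ := hab
      exact (coord_incl (A := A) p q x).trans (coord_incl (A := A.swap) q p x).symm
    · exact (coord_incl_ne (A := A) hab x).trans
        (coord_incl_ne (A := A.swap) (by omega) x).symm
  | add x y hx hy => rw [map_add, map_add, map_add, hx, hy]; rfl

theorem swapLin_swapLin (x : A.tot) : A.swapLin (A.swap.swapLin x) = x :=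
  tot_ext fun p q => by
    rw [coord_swapLin]
    exact coord_swapLin (A := A.swap) q p x

theorem D_swapLin (x : A.swap.tot) : A.D.toLin (A.swapLin x) = A.swapLin (A.swap.D.toLin x) := by
  refine tot_ext fun p q => ?_
  rw [coord_D (sub_add_cancel p 1) (sub_add_cancel q 1), coord_swapLin, coord_swapLin,
    coord_swapLin, coord_D (sub_add_cancel q 1) (sub_add_cancel p 1), add_comm]
  rfl

theorem swapLin_mem_deg {k : ℤ} {x : A.swap.tot} (hx : x ∈ A.swap.deg k) :
    A.swapLin x ∈ A.deg k := by
  intro p q h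
  rw [coord_swapLin]
  exact hx q p (by omega)

theorem swapLin_mem_cycles {k : ℤ} {x : A.swap.tot}
    (hx : x ∈ LinearMap.ker A.swap.D.toLin ⊓ A.swap.deg k) :
    A.swapLin x ∈ LinearMap.ker A.D.toLin ⊓ A.deg k := by
  refine ⟨?_, swapLin_mem_deg hx.2⟩
  change A.D.toLin (A.swapLin x) = 0
  rw [D_swapLin, LinearMap.mem_ker.1 hx.1, map_zero]

variable (A) in
theorem exists_swapIso (k : ℤ) : ∃ e : GIso (A.swap.filt.coh k) (A.filt.coh k),
    ∀ x : (LinearMap.ker A.swap.D.toLin ⊓ A.swap.deg k : Submodule _ _),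
      e.toEquiv (A.swap.tot.sqMk _ _ x) =
        A.tot.sqMk _ _ ⟨A.swapLin x, swapLin_mem_cycles x.2⟩ := by
  refine ⟨subquotientIso A.swap.graded_tot (A.swap.filt.homog_cycles k)
    (A.swap.filt.homog_boundaries k) (A.filt.graded_coh k)
    ((A.tot.sqMk _ _) ∘ₗ (A.swapLin ∘ₗ
      (LinearMap.ker A.swap.D.toLin ⊓ A.swap.deg k : Submodule _ _).subtype).codRestrict
      (LinearMap.ker A.D.toLin ⊓ A.deg k) (fun x => swapLin_mem_cycles x.2)) ?_ ?_ ?_,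
    fun x => rfl⟩
  · intro x
    refine GMod.sqMk_eq_zero.trans ?_
    constructor
    · rintro ⟨y, hy, hyx⟩
      refine ⟨A.swap.swapLin y, swapLin_mem_deg (A := A.swap) hy, ?_⟩
      refine (D_swapLin (A := A.swap) y).trans ?_
      exact (congrArg A.swap.swapLin hyx).trans (swapLin_swapLin (A := A.swap) x.1)
    · rintro ⟨y, hy, hyx⟩
      refine ⟨A.swapLin y, swapLin_mem_deg hy, ?_⟩
      exact (D_swapLin y).trans (congrArg A.swapLin hyx)
  · intro c
    obtain ⟨z, rfl⟩ := GMod.sqMk_surjective _ _ c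
    refine ⟨⟨A.swap.swapLin z.1, swapLin_mem_cycles (A := A.swap) z.2⟩, ?_⟩
    exact congrArg (A.tot.sqMk _ _) (Subtype.ext (swapLin_swapLin z.1))
  · intro γ z hz
    refine GMod.sqMk_mem_piece fun i => ?_
    have h := (A.swap.coord i.2 i.1).map_piece γ _ hz
    rw [← coord_swapLin] at h
    exact h

end DoubleCx

/-! ### The Čech complex of a graded module -/

section CechGraded

variable {r : ℕ} (t : Fin r → ι)

/-- The elements of `cechMonoid` are monomials in the chosen variables. -/
theorem exists_monomial_of_mem_cechMonoid {I : Finset (Fin r)} {s : MvPolynomial ι K}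
    (hs : s ∈ cechMonoid K t I) :
    ∃ e : ι →₀ ℕ, s = monomial e 1 ∧ ∀ i, e i ≠ 0 → ∃ k ∈ I, t k = i := by
  classical
  induction hs using Submonoid.closure_induction with
  | mem x hx =>
    obtain ⟨k, hk, rfl⟩ := hx
    refine ⟨Finsupp.single (t k) 1, rfl, fun i hi => ⟨k, hk, ?_⟩⟩
    by_contra h
    exact hi (Finsupp.single_eq_of_ne (Ne.symm h))
  | one => exact ⟨0, rfl, fun i hi => absurd rfl hi⟩
  | mul x y _ _ hx hy =>
    obtain ⟨e, rfl, he⟩ := hx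
    obtain ⟨e', rfl, he'⟩ := hy
    refine ⟨e + e', by rw [monomial_mul, one_mul], fun i hi => ?_⟩
    by_cases h : e i = 0
    · exact he' i (by simpa [h] using hi)
    · exact he i h

variable (w) in
theorem exists_degree_of_mem_cechMonoid {I : Finset (Fin r)} {s : MvPolynomial ι K}
    (hs : s ∈ cechMonoid K t I) : ∃ δ, s ∈ weightedHomogeneousSubmodule K w δ := by
  obtain ⟨e, rfl, -⟩ := exists_monomial_of_mem_cechMonoid t hs
  exact ⟨_, isWeightedHomogeneous_monomial w e 1 rfl⟩

/-- The localization of a graded module at the variables indexed by `I`, as a graded module. -/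
def locMod (N : GMod K w) (I : Finset (Fin r)) : GMod K w where
  carrier := CechLoc K t N I
  piece γ := Submodule.span K
    {z : CechLoc K t N I | ∃ (δ : Γ) (s : cechMonoid K t I) (y : N),
      (s : MvPolynomial ι K) ∈ weightedHomogeneousSubmodule K w δ ∧ y ∈ N.piece (γ + δ) ∧
        z = LocalizedModule.mk y s}

variable {t}

theorem locMod_mk_mem_piece {N : GMod K w} {I : Finset (Fin r)} {γ δ ε : Γ} {y : N}
    {s : cechMonoid K t I} (hs : (s : MvPolynomial ι K) ∈ weightedHomogeneousSubmodule K w δ)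
    (hy : y ∈ N.piece ε) (h : ε = γ + δ) :
    (LocalizedModule.mk y s : locMod t N I) ∈ (locMod t N I).piece γ :=
  Submodule.subset_span (M := CechLoc K t N I) ⟨δ, s, y, hs, h ▸ hy, rfl⟩

/-- Homogeneous elements of a localization are single fractions of homogeneous elements. -/
theorem mem_locMod_piece {N : GMod K w} (hN : N.IsGraded) {I : Finset (Fin r)} {γ : Γ}
    {z : locMod t N I} (hz : z ∈ (locMod t N I).piece γ) :
    ∃ (δ : Γ) (s : cechMonoid K t I) (y : N),
      (s : MvPolynomial ι K) ∈ weightedHomogeneousSubmodule K w δ ∧ y ∈ N.piece (γ + δ) ∧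
        z = LocalizedModule.mk y s := by
  induction hz using Submodule.span_induction with
  | mem z hz => exact hz
  | zero =>
    exact ⟨0, 1, 0, isWeightedHomogeneous_one K w, zero_mem _, (LocalizedModule.zero_mk _).symm⟩
  | add z z' _ _ hz hz' =>
    obtain ⟨δ, s, y, hs, hy, rfl⟩ := hz
    obtain ⟨δ', s', y', hs', hy', rfl⟩ := hz'
    refine ⟨δ + δ', s * s', s' • y + s • y', IsWeightedHomogeneous.mul hs hs', add_mem ?_ ?_,
      LocalizedModule.mk_add_mk⟩
    · have := hN.smul_mem _ _ _ _ hs' hy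
      rwa [show γ + (δ + δ') = δ' + (γ + δ) by abel]
    · have := hN.smul_mem _ _ _ _ hs hy'
      rwa [show γ + (δ + δ') = δ + (γ + δ') by abel]
  | smul c z _ hz =>
    obtain ⟨δ, s, y, hs, hy, rfl⟩ := hz
    refine ⟨δ, s, c • y, hs, Submodule.smul_mem _ _ hy, ?_⟩
    exact LocalizedModule.smul'_mk c y s

theorem loc_mk_add {N : Type u} [AddCommGroup N] [Module (MvPolynomial ι K) N]
    {I : Finset (Fin r)} (y z : N) (s : cechMonoid K t I) :
    (LocalizedModule.mk (y + z) s : CechLoc K t N I) =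
      LocalizedModule.mk y s + LocalizedModule.mk z s := by
  rw [LocalizedModule.mk_add_mk, ← smul_add, LocalizedModule.mk_cancel_common_left]

theorem loc_mk_sum {N : Type u} [AddCommGroup N] [Module (MvPolynomial ι K) N] {α : Type*}
    {I : Finset (Fin r)} (F : Finset α) (n : α → N) (s : cechMonoid K t I) :
    (LocalizedModule.mk (∑ a ∈ F, n a) s : CechLoc K t N I) =
      ∑ a ∈ F, LocalizedModule.mk (n a) s := by
  classical
  induction F using Finset.induction_on with
  | empty => exact LocalizedModule.zero_mk s
  | insert a F ha ih => rw [Finset.sum_insert ha, Finset.sum_insert ha, loc_mk_add, ih]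

theorem loc_mk_eq_zero_iff {N : Type u} [AddCommGroup N] [Module (MvPolynomial ι K) N]
    {I : Finset (Fin r)} {y : N} {s : cechMonoid K t I} :
    (LocalizedModule.mk y s : CechLoc K t N I) = 0 ↔
      ∃ c : cechMonoid K t I, (c : MvPolynomial ι K) • y = 0 := by
  rw [← LocalizedModule.zero_mk s, LocalizedModule.mk_eq]
  constructor
  · rintro ⟨c, hc⟩
    refine ⟨c * s, ?_⟩
    rw [smul_zero, smul_zero] at hc
    rw [Submonoid.coe_mul, mul_smul]
    exact hc
  · rintro ⟨c, hc⟩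
    refine ⟨c, ?_⟩
    rw [smul_zero, smul_zero, smul_comm]
    exact (congrArg (s • ·) hc).trans (smul_zero _)

variable (t) in
theorem isGraded_locMod {N : GMod K w} (hN : N.IsGraded) (I : Finset (Fin r)) :
    (locMod t N I).IsGraded := by
  classical
  have hsmul : ∀ (a γ : Γ) (s : MvPolynomial ι K) (x : locMod t N I),
      s ∈ weightedHomogeneousSubmodule K w a → x ∈ (locMod t N I).piece γ →
        s • x ∈ (locMod t N I).piece (a + γ) := by
    intro a γ s x hs hx
    obtain ⟨δ, d, y, hd, hy, rfl⟩ := mem_locMod_piece hN hx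
    have h : s • (LocalizedModule.mk y d : CechLoc K t N I) = LocalizedModule.mk (s • y) d :=
      LocalizedModule.smul'_mk _ _ _
    exact h ▸ locMod_mk_mem_piece hd (hN.smul_mem _ _ _ _ hs hy) (add_assoc _ _ _).symm
  refine ⟨?_, hsmul⟩
  have : DirectSum.IsInternal (locMod t N I).piece := by
    rw [DirectSum.isInternal_submodule_iff_iSupIndep_and_iSup_eq_top]
    constructor
    · rw [iSupIndep_iff_finsetSum_eq_zero_imp_eq_zero]
      intro F z hz hsum γ hγ
      choose! δ d y hd hy hzy using fun γ (hγ : γ ∈ F) => mem_locMod_piece hN (hz γ hγ)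
      -- bring all fractions to a common denominator
      let D : cechMonoid K t I := ∏ γ ∈ F, d γ
      let n : Γ → N := fun γ => ((∏ β ∈ F.erase γ, d β : cechMonoid K t I) : MvPolynomial ι K) • y γ
      have hzn : ∀ γ ∈ F, z γ = (LocalizedModule.mk (n γ) D : CechLoc K t N I) := by
        intro γ hγ
        refine (hzy γ hγ).trans ?_
        have hD : D = (∏ β ∈ F.erase γ, d β) * d γ := (Finset.prod_erase_mul _ _ hγ).symm
        rw [hD]
        exact (LocalizedModule.mk_cancel_common_left _ _ _).symm
      have hn : ∀ γ ∈ F, n γ ∈ N.piece (γ + ∑ β ∈ F, δ β) := by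
        intro γ hγ
        have h1 : ((∏ β ∈ F.erase γ, d β : cechMonoid K t I) : MvPolynomial ι K) ∈
            weightedHomogeneousSubmodule K w (∑ β ∈ F.erase γ, δ β) := by
          rw [Submonoid.coe_finsetProd]
          exact IsWeightedHomogeneous.prod _ _ _
            fun β hβ => hd β (Finset.mem_of_mem_erase hβ)
        have h2 := hN.smul_mem _ _ _ _ h1 (hy γ hγ)
        rwa [add_left_comm, Finset.sum_erase_add _ _ hγ] at h2
      have hsum' : (LocalizedModule.mk (∑ γ ∈ F, n γ) D : CechLoc K t N I) = 0 := by
        rw [loc_mk_sum]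
        exact (Finset.sum_congr rfl fun γ hγ => (hzn γ hγ).symm).trans hsum
      obtain ⟨c, hc⟩ := loc_mk_eq_zero_iff.1 hsum'
      obtain ⟨ε, hε⟩ := exists_degree_of_mem_cechMonoid w t c.2
      have h0 : (c : MvPolynomial ι K) • n γ = 0 := by
        have h1 := congrArg (hN.proj (ε + (γ + ∑ β ∈ F, δ β))) hc
        rw [map_zero, Finset.smul_sum, map_sum, Finset.sum_eq_single γ] at h1
        · rwa [hN.proj_of_mem (hN.smul_mem _ _ _ _ hε (hn γ hγ))] at h1
        · intro β hβ hne
          refine hN.proj_of_mem_ne (hN.smul_mem _ _ _ _ hε (hn β hβ)) fun h => hne ?_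
          exact add_right_cancel (add_left_cancel h)
        · exact fun h => absurd hγ h
      exact (hzn γ hγ).trans (loc_mk_eq_zero_iff.2 ⟨c, h0⟩)
    · rw [eq_top_iff]
      rintro (z : CechLoc K t N I) -
      induction z using LocalizedModule.induction_on with
      | h y s =>
        obtain ⟨δ, hδ⟩ := exists_degree_of_mem_cechMonoid w t s.2
        induction y using hN.induction with
        | mem γ y hy =>
          exact Submodule.mem_iSup_of_mem (γ - δ)
            (locMod_mk_mem_piece hδ hy (sub_add_cancel γ δ).symm)
        | zero => rw [LocalizedModule.zero_mk]; exact zero_mem _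
        | add y z hy hz => rw [loc_mk_add]; exact add_mem hy hz
  convert this

variable (t) in
theorem isGraded_cechMod {N : GMod K w} (hN : N.IsGraded) (p : ℤ) : (cechMod t N p).IsGraded := by
  classical
  refine GMod.IsGraded.of_separating (M := cechMod t N p) (N := CechObj K t N p)
    (fun γ => LinearMap.pi fun I => (isGraded_locMod t hN I.1).proj γ ∘ₗ LinearMap.proj I)
    ?_ ?_ ?_ ?_
  · intro γ x hx h0
    funext I
    exact ((isGraded_locMod t hN I.1).proj_of_mem (hx I trivial)).symm.trans (congrFun h0 I)
  · intro γ δ hne x hx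
    funext I
    exact (isGraded_locMod t hN I.1).proj_of_mem_ne (hx I trivial) hne
  · intro (x : CechObj K t N p)
    have hx : x = ∑ I, Pi.single I (x I) := (Finset.univ_sum_single x).symm
    rw [hx]
    refine Submodule.sum_mem _ fun I _ => ?_
    generalize x I = z
    change locMod t N I.1 at z
    induction z using (isGraded_locMod t hN I.1).induction with
    | mem γ y hy =>
      refine Submodule.mem_iSup_of_mem γ fun J _ => ?_
      by_cases h : J = I
      · subst h
        exact Set.mem_of_eq_of_mem (Pi.single_eq_same (M := fun I : {I : Finset (Fin r) //
          (I.card : ℤ) = p} => CechLoc K t N I.1) _ _) hy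
      · exact Set.mem_of_eq_of_mem (Pi.single_eq_of_ne (M := fun I : {I : Finset (Fin r) //
          (I.card : ℤ) = p} => CechLoc K t N I.1) h _) (zero_mem _)
    | zero =>
      exact Set.mem_of_eq_of_mem (Pi.single_zero (M := fun I : {I : Finset (Fin r) //
          (I.card : ℤ) = p} => CechLoc K t N I.1) _) (zero_mem _)
    | add y z hy hz =>
      exact Set.mem_of_eq_of_mem (Pi.single_add (f := fun I : {I : Finset (Fin r) //
        (I.card : ℤ) = p} => CechLoc K t N I.1) I y z) (add_mem hy hz)
  · intro a γ s x hs hx I _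
    exact (isGraded_locMod t hN I.1).smul_mem a γ s (x I) hs (hx I trivial)

/-! ### The Čech complex is a complex of graded modules -/

variable (t) {N : Type u} [AddCommGroup N] [Module (MvPolynomial ι K) N]

/-- The component of a Čech cochain at an arbitrary set `I`, restricted to `J`; it is `0` when this
makes no sense. -/
def cechExt {p : ℤ} (x : CechObj K t N p) (J I : Finset (Fin r)) : CechLoc K t N J :=
  if h : (I.card : ℤ) = p ∧ I ⊆ J then cechRes t N h.2 (x ⟨I, h.1⟩) else 0

theorem cechExt_of {p : ℤ} (x : CechObj K t N p) {J I : Finset (Fin r)} (h : (I.card : ℤ) = p)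
    (hI : I ⊆ J) : cechExt t x J I = cechRes t N hI (x ⟨I, h⟩) :=
  dif_pos ⟨h, hI⟩

theorem cechRes_cechRes {I J L : Finset (Fin r)} (h : I ⊆ J) (h' : J ⊆ L) (z : CechLoc K t N I) :
    cechRes t N h' (cechRes t N h z) = cechRes t N (h.trans h') z := by
  induction z using LocalizedModule.induction_on with
  | h y s => rw [cechRes_mk, cechRes_mk, cechRes_mk]

theorem cechRes_cechExt {p : ℤ} (x : CechObj K t N p) {L J I : Finset (Fin r)} (hI : I ⊆ J)
    (hJ : J ⊆ L) : cechRes t N hJ (cechExt t x J I) = cechExt t x L I := by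
  by_cases h : (I.card : ℤ) = p
  · rw [cechExt_of t x h hI, cechExt_of t x h (hI.trans hJ), cechRes_cechRes]
  · rw [cechExt, dif_neg (fun h' => h h'.1), cechExt, dif_neg (fun h' => h h'.1), map_zero]

/-- The sign of `k` in the Čech differential at `J`. -/
def cechSign (J : Finset (Fin r)) (k : Fin r) : ℤ := (-1) ^ (J.filter (· < k)).card

theorem cechSign_mul_self (J : Finset (Fin r)) (k : Fin r) : cechSign J k * cechSign J k = 1 := by
  rw [cechSign, ← mul_pow]; simp

theorem cechSign_erase_of_lt {J : Finset (Fin r)} {k l : Fin r} (hk : k ∈ J) (h : k < l) :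
    cechSign (J.erase k) l = - cechSign J l := by
  have h1 : (J.erase k).filter (· < l) = (J.filter (· < l)).erase k := by
    ext; simp only [Finset.mem_filter, Finset.mem_erase]; tauto
  have h2 := Finset.card_erase_add_one (Finset.mem_filter.2 ⟨hk, h⟩ : k ∈ J.filter (· < l))
  rw [cechSign, cechSign, h1, ← h2, pow_succ]
  ring

theorem cechSign_erase_of_not_lt {J : Finset (Fin r)} {k l : Fin r} (h : ¬ k < l) :
    cechSign (J.erase k) l = cechSign J l := by
  have h1 : (J.erase k).filter (· < l) = J.filter (· < l) := by
    ext x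
    simp only [Finset.mem_filter, Finset.mem_erase]
    exact ⟨fun hx => ⟨hx.1.2, hx.2⟩, fun hx => ⟨⟨fun e => h (e ▸ hx.2), hx.1⟩, hx.2⟩⟩
  rw [cechSign, cechSign, h1]

/-- The two signs belonging to the removal of `k` and `l` in either order are opposite. -/
theorem cechSign_swap {J : Finset (Fin r)} {k l : Fin r} (hk : k ∈ J) (hl : l ∈ J) (h : k ≠ l) :
    cechSign J k * cechSign (J.erase k) l = - (cechSign J l * cechSign (J.erase l) k) := by
  rcases lt_or_gt_of_ne h with h | h
  · rw [cechSign_erase_of_lt hk h, cechSign_erase_of_not_lt (not_lt_of_gt h)]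
    ring
  · rw [cechSign_erase_of_lt hl h, cechSign_erase_of_not_lt (not_lt_of_gt h)]
    ring

theorem cechD_eq_sum {p q : ℤ} (h : p + 1 = q) (x : CechObj K t N p)
    (J : {J : Finset (Fin r) // (J.card : ℤ) = q}) :
    cechD t N p q x J = ∑ k ∈ J.1, cechSign J.1 k • cechExt t x J.1 (J.1.erase k) := by
  refine (cechD_apply t N h x J).trans (Eq.trans (Finset.sum_congr rfl fun k _ => ?_)
    (Finset.sum_coe_sort J.1 fun k => cechSign J.1 k • cechExt t x J.1 (J.1.erase k)))
  rw [cechExt_of t x (card_erase_eq h J k) (Finset.erase_subset _ _)]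
  rfl

theorem cechD_cechD {p p' q : ℤ} (h : p + 1 = p') (h' : p' + 1 = q) (x : CechObj K t N p) :
    cechD t N p' q (cechD t N p p' x) = 0 := by
  funext J
  have hstep : ∀ k ∈ J.1, cechSign J.1 k • cechExt t (cechD t N p p' x) J.1 (J.1.erase k) =
      ∑ l ∈ J.1.erase k, (cechSign J.1 k * cechSign (J.1.erase k) l) •
        cechExt t x J.1 ((J.1.erase k).erase l) := by
    intro k hk
    rw [cechExt_of t _ (card_erase_eq h' J ⟨k, hk⟩) (Finset.erase_subset _ _), cechD_eq_sum t h,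
      map_sum, ← Finset.sum_zsmul]
    refine Finset.sum_congr rfl fun l hl => ?_
    rw [map_zsmul, cechRes_cechExt t x (Finset.erase_subset _ _), mul_smul]
  rw [cechD_eq_sum t h', Finset.sum_congr rfl hstep, Finset.sum_sigma']
  -- The summands for `(k, l)` and `(l, k)` cancel.
  refine Finset.sum_involution (fun a _ => ⟨a.2, a.1⟩) ?_ ?_ ?_ ?_
  · rintro ⟨k, l⟩ ha
    simp only [Finset.mem_sigma, Finset.mem_erase] at ha
    rw [cechSign_swap ha.1 ha.2.2 (Ne.symm ha.2.1), Finset.erase_right_comm, neg_smul,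
      neg_add_cancel]
  · rintro ⟨k, l⟩ ha - heq
    simp only [Finset.mem_sigma, Finset.mem_erase] at ha
    exact ha.2.1 (congrArg Sigma.fst heq)
  · rintro ⟨k, l⟩ ha
    simp only [Finset.mem_sigma, Finset.mem_erase] at ha ⊢
    exact ⟨ha.2.2, Ne.symm ha.2.1, ha.1⟩
  · rintro ⟨k, l⟩ ha
    rfl

theorem cechRes_mem_piece {N : GMod K w} (hN : N.IsGraded) {I J : Finset (Fin r)} (h : I ⊆ J)
    {γ : Γ} {z : locMod t N I} (hz : z ∈ (locMod t N I).piece γ) :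
    (cechRes t N h z : locMod t N J) ∈ (locMod t N J).piece γ := by
  obtain ⟨δ, s, y, hs, hy, rfl⟩ := mem_locMod_piece hN hz
  rw [cechRes_mk]
  exact locMod_mk_mem_piece (by exact hs) hy rfl

theorem cechSign_smul_mem_piece {N : GMod K w} {J : Finset (Fin r)} (k : Fin r) {γ : Γ}
    {z : CechLoc K t N J} (hz : (z : locMod t N J) ∈ (locMod t N J).piece γ) :
    ((cechSign J k • z : CechLoc K t N J) : locMod t N J) ∈ (locMod t N J).piece γ := by
  rcases neg_one_pow_eq_or ℤ (J.filter (· < k)).card with h | h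
  · rw [cechSign, h, one_smul]
    exact hz
  · rw [cechSign, h, neg_smul, one_smul]
    exact neg_mem hz

/-- The Čech differential as a map of graded modules. -/
def cechDHom {N : GMod K w} (hN : N.IsGraded) (p q : ℤ) :
    GHom (cechMod t N p) (cechMod t N q) where
  toLin := cechD t N p q
  map_piece γ x hx := by
    by_cases h : p + 1 = q
    · intro J _
      refine Set.mem_of_eq_of_mem (cechD_eq_sum t h x J) ?_
      refine Submodule.sum_mem ((locMod t N J.1).piece γ) fun k hk => ?_
      refine cechSign_smul_mem_piece t k ?_
      have hext := cechExt_of t x (card_erase_eq h J ⟨k, hk⟩) (Finset.erase_subset k J.1)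
      exact Set.mem_of_eq_of_mem hext (cechRes_mem_piece t hN _
        (hx ⟨J.1.erase k, card_erase_eq h J ⟨k, hk⟩⟩ trivial))
    · have h0 : cechD t N p q x = 0 := by rw [cechD, dif_neg h]; rfl
      exact h0 ▸ zero_mem _

theorem isGraded_locCoh {N : GMod K w} (hN : N.IsGraded) (i : ℤ) : (locCoh t i N).IsGraded :=
  isGraded_homology (cechDHom t hN (i - 1) i) (cechDHom t hN i (i + 1))
    (isGraded_cechMod t hN _) (isGraded_cechMod t hN _) (isGraded_cechMod t hN _)

theorem subsingleton_cechObj_of_neg {p : ℤ} (hp : p < 0) : Subsingleton (CechObj K t N p) :=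
  ⟨fun x y => funext fun I => absurd I.2 (by omega)⟩

theorem subsingleton_cechObj_of_gt {p : ℤ} (hp : (r : ℤ) < p) : Subsingleton (CechObj K t N p) :=
  ⟨fun x y => funext fun I => absurd I.2 (by
    have := Finset.card_le_univ I.1
    rw [Fintype.card_fin] at this
    omega)⟩

theorem subsingleton_cechObj [Subsingleton N] (p : ℤ) : Subsingleton (CechObj K t N p) := by
  refine ⟨fun x y => funext fun I => ?_⟩
  induction x I using LocalizedModule.induction_on with
  | h a s =>
    induction y I using LocalizedModule.induction_on with
    | h b s' =>
      rw [Subsingleton.elim a 0, Subsingleton.elim b 0, LocalizedModule.zero_mk,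
        LocalizedModule.zero_mk]

/-! ### Exactness of localization -/

variable {N' N'' : Type u} [AddCommGroup N'] [Module (MvPolynomial ι K) N']
  [AddCommGroup N''] [Module (MvPolynomial ι K) N'']

theorem cechObjMap_comp_apply (f : N →ₗ[MvPolynomial ι K] N') (g : N' →ₗ[MvPolynomial ι K] N'')
    (p : ℤ) (x : CechObj K t N p) :
    cechObjMap t g p (cechObjMap t f p x) = cechObjMap t (g ∘ₗ f) p x := by
  funext I
  change cechLocMap t g I.1 (cechLocMap t f I.1 (x I)) = cechLocMap t (g ∘ₗ f) I.1 (x I)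
  induction x I using LocalizedModule.induction_on with
  | h y s => rw [cechLocMap_mk, cechLocMap_mk, cechLocMap_mk]; rfl

theorem cechObjMap_zero (p : ℤ) (x : CechObj K t N p) :
    cechObjMap t (0 : N →ₗ[MvPolynomial ι K] N') p x = 0 := by
  funext I
  change cechLocMap t (0 : N →ₗ[MvPolynomial ι K] N') I.1 (x I) = 0
  induction x I using LocalizedModule.induction_on with
  | h y s => rw [cechLocMap_mk]; exact LocalizedModule.zero_mk _

theorem cechObjMap_id (p : ℤ) (x : CechObj K t N p) :
    cechObjMap t (LinearMap.id : N →ₗ[MvPolynomial ι K] N) p x = x := by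
  funext I
  change cechLocMap t (LinearMap.id : N →ₗ[MvPolynomial ι K] N) I.1 (x I) = x I
  induction x I using LocalizedModule.induction_on with
  | h y s => rw [cechLocMap_mk]; rfl

theorem cechObjMap_exact {f : N →ₗ[MvPolynomial ι K] N'} {g : N' →ₗ[MvPolynomial ι K] N''}
    (h : LinearMap.ker g ≤ LinearMap.range f) (p : ℤ) {x : CechObj K t N' p}
    (hx : cechObjMap t g p x = 0) : x ∈ LinearMap.range (cechObjMap t f p) := by
  have hI : ∀ I, ∃ y, cechLocMap t f I.1 y = x I := by
    intro I
    have hxI : cechLocMap t g I.1 (x I) = 0 := congrFun hx I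
    generalize x I = z at hxI
    induction z using LocalizedModule.induction_on with
    | h b s =>
      rw [cechLocMap_mk, loc_mk_eq_zero_iff] at hxI
      obtain ⟨c, hc⟩ := hxI
      obtain ⟨a, ha⟩ := h (show (c : MvPolynomial ι K) • b ∈ LinearMap.ker g by
        rw [LinearMap.mem_ker, map_smul, hc])
      refine ⟨LocalizedModule.mk a (c * s), ?_⟩
      rw [cechLocMap_mk, ha]
      exact LocalizedModule.mk_cancel_common_left c s b
  choose y hy using hI
  exact ⟨y, funext hy⟩

theorem cechObjMap_surjective {f : N →ₗ[MvPolynomial ι K] N'} (h : Function.Surjective f) (p : ℤ) :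
    Function.Surjective (cechObjMap t f p) := fun x =>
  cechObjMap_exact t (f := f) (g := (0 : N' →ₗ[MvPolynomial ι K] N'))
    (fun _ _ => LinearMap.range_eq_top.2 h ▸ trivial) p (cechObjMap_zero t p x)

theorem cechObjMap_injective {f : N →ₗ[MvPolynomial ι K] N'} (h : Function.Injective f) (p : ℤ) :
    Function.Injective (cechObjMap t f p) := by
  refine (injective_iff_map_eq_zero _).2 fun x hx => ?_
  obtain ⟨y, rfl⟩ := cechObjMap_exact t (f := (0 : N →ₗ[MvPolynomial ι K] N)) (g := f)
    (by rw [LinearMap.ker_eq_bot.2 h]; exact bot_le) p hx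
  exact cechObjMap_zero t p y

section Homology

variable {A B C : GMod K w} (f : GHom A B) (g : GHom B C)

/-- The cycles of the Čech terms are the Čech terms of the cycles. -/
def cechCycles (p : ℤ) : CechObj K t (LinearMap.ker g.toLin) p ≃ₗ[MvPolynomial ι K]
    LinearMap.ker (cechObjMap t g.toLin p) :=
  LinearEquiv.ofBijective ((cechObjMap t (LinearMap.ker g.toLin).subtype p).codRestrict _ (by
    intro x
    rw [LinearMap.mem_ker, cechObjMap_comp_apply, LinearMap.comp_ker_subtype, cechObjMap_zero]))
    (by
      constructor
      · intro x y hxy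
        exact cechObjMap_injective t (Submodule.injective_subtype _) p (congrArg Subtype.val hxy)
      · rintro ⟨x, hx⟩
        obtain ⟨y, hy⟩ := cechObjMap_exact t (f := (LinearMap.ker g.toLin).subtype)
          (by rw [Submodule.range_subtype]) p (LinearMap.mem_ker.1 hx)
        exact ⟨y, Subtype.ext hy⟩)

theorem coe_cechCycles (p : ℤ) (z : CechObj K t (LinearMap.ker g.toLin) p) :
    (cechCycles t g p z : CechObj K t B p) = cechObjMap t (LinearMap.ker g.toLin).subtype p z := rfl

/-- The class in the Čech term of the homology of a cycle of the Čech terms. -/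
def cechClass (p : ℤ) : LinearMap.ker (cechObjMap t g.toLin p) →ₗ[MvPolynomial ι K]
    cechMod t (homology f.toLin g.toLin) p :=
  cechObjMap t (B.sqMk (LinearMap.ker g.toLin) (LinearMap.range f.toLin)) p ∘ₗ
    (cechCycles t g p).symm.toLinearMap

theorem cechClass_cechCycles (p : ℤ) (z : CechObj K t (LinearMap.ker g.toLin) p) :
    cechClass t f g p (cechCycles t g p z) =
      cechObjMap t (B.sqMk (LinearMap.ker g.toLin) (LinearMap.range f.toLin)) p z := by
  exact congrArg (cechObjMap t (B.sqMk (LinearMap.ker g.toLin) (LinearMap.range f.toLin)) p)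
    ((cechCycles t g p).symm_apply_apply z)

theorem cechClass_surjective (p : ℤ) : Function.Surjective (cechClass t f g p) := by
  intro c
  obtain ⟨z, rfl⟩ := cechObjMap_surjective t (GMod.sqMk_surjective _ _) p c
  exact ⟨_, cechClass_cechCycles t f g p z⟩

theorem cechClass_eq_zero (hfg : ∀ x, g.toLin (f.toLin x) = 0) (p : ℤ)
    (a : LinearMap.ker (cechObjMap t g.toLin p)) :
    cechClass t f g p a = 0 ↔ (a : CechObj K t B p) ∈ LinearMap.range (cechObjMap t f.toLin p) := by
  obtain ⟨z, rfl⟩ := (cechCycles t g p).surjective a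
  rw [cechClass_cechCycles, coe_cechCycles]
  let f' : A →ₗ[MvPolynomial ι K] LinearMap.ker g.toLin := f.toLin.codRestrict _ hfg
  have hf' : (LinearMap.ker g.toLin).subtype ∘ₗ f' = f.toLin := rfl
  constructor
  · intro h
    obtain ⟨y, rfl⟩ := cechObjMap_exact t (f := f') (by
      rintro x hx
      obtain ⟨y, hy⟩ := GMod.sqMk_eq_zero.1 (LinearMap.mem_ker.1 hx)
      exact ⟨y, Subtype.ext hy⟩) p h
    exact ⟨y, by rw [cechObjMap_comp_apply, hf']⟩
  · rintro ⟨y, hy⟩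
    have : z = cechObjMap t f' p y := by
      apply cechObjMap_injective t (Submodule.injective_subtype _) p
      rw [cechObjMap_comp_apply, hf', hy]
    rw [this, cechObjMap_comp_apply]
    have h0 : B.sqMk (LinearMap.ker g.toLin) (LinearMap.range f.toLin) ∘ₗ f' = 0 :=
      LinearMap.ext fun x => GMod.sqMk_eq_zero.2 ⟨x, rfl⟩
    rw [h0]
    exact cechObjMap_zero t p y

theorem cechClass_mem_piece (hB : B.IsGraded) (p : ℤ) {γ : Γ}
    (a : LinearMap.ker (cechObjMap t g.toLin p))
    (ha : (a : CechObj K t B p) ∈ (cechMod t B p).piece γ) :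
    cechClass t f g p a ∈ (cechMod t (homology f.toLin g.toLin) p).piece γ := by
  obtain ⟨z, rfl⟩ := (cechCycles t g p).surjective a
  rw [cechClass_cechCycles]
  intro I _
  obtain ⟨δ, s, b, hs, hb, hz⟩ := mem_locMod_piece hB (ha I trivial)
  have h0 : cechLocMap t g.toLin I.1 (LocalizedModule.mk b s) = 0 := by
    have := congrFun (LinearMap.mem_ker.1 (cechCycles t g p z).2) I
    exact (congrArg _ hz.symm).trans this
  rw [cechLocMap_mk, loc_mk_eq_zero_iff] at h0
  obtain ⟨c, hc⟩ := h0
  obtain ⟨ε, hε⟩ := exists_degree_of_mem_cechMonoid w t c.2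
  have hcb : (c : MvPolynomial ι K) • b ∈ LinearMap.ker g.toLin := by
    rw [LinearMap.mem_ker, map_smul, hc]
  -- A homogeneous fraction that is a cycle is a fraction with a homogeneous cycle as numerator.
  have hzI : z I = LocalizedModule.mk (⟨_, hcb⟩ : LinearMap.ker g.toLin) (c * s) := by
    have hinj : Function.Injective (cechLocMap t (LinearMap.ker g.toLin).subtype I.1) :=
      IsLocalizedModule.map_injective _ _ _ _ (Submodule.injective_subtype _)
    apply hinj
    rw [cechLocMap_mk]
    exact hz.trans (LocalizedModule.mk_cancel_common_left c s b).symm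
  change cechLocMap t _ I.1 (z I) ∈ (locMod t (homology f.toLin g.toLin) I.1).piece γ
  rw [hzI]
  refine Set.mem_of_eq_of_mem (cechLocMap_mk t _ I.1 _ _) ?_
  refine locMod_mk_mem_piece (IsWeightedHomogeneous.mul hε hs)
    (GMod.sqMk_mem_piece (hB.smul_mem _ _ _ _ hε hb)) ?_
  abel

theorem cechClass_cechD (p p' : ℤ) (a : LinearMap.ker (cechObjMap t g.toLin p))
    (a' : LinearMap.ker (cechObjMap t g.toLin p'))
    (h : (a' : CechObj K t B p') = cechD t B p p' a) :
    cechClass t f g p' a' =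
      cechD t (homology f.toLin g.toLin) p p' (cechClass t f g p a) := by
  obtain ⟨z, rfl⟩ := (cechCycles t g p).surjective a
  obtain rfl : a' = cechCycles t g p' (cechD t _ p p' z) := by
    refine Subtype.ext ?_
    rw [h, coe_cechCycles, coe_cechCycles, cechObjMap_comm]
  rw [cechClass_cechCycles, cechClass_cechCycles]
  exact cechObjMap_comm t _ p p' z

end Homology

end CechGraded

/-! ### Laurent polynomials -/

section LaurentPolynomials

variable (K ι) in
/-- The ring of Laurent polynomials in the variables `ι`. -/
def Laurent : Type u := AddMonoidAlgebra K (ι →₀ ℤ)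

instance : CommRing (Laurent K ι) := inferInstanceAs (CommRing (AddMonoidAlgebra K (ι →₀ ℤ)))

instance : Algebra K (Laurent K ι) := inferInstanceAs (Algebra K (AddMonoidAlgebra K (ι →₀ ℤ)))

namespace Laurent

/-- The coefficient of a Laurent polynomial at the exponent `a`. -/
def coef (a : ι →₀ ℤ) : Laurent K ι →ₗ[K] K where
  toFun z := AddMonoidAlgebra.coeff z a
  map_add' _ _ := rfl
  map_smul' _ _ := rfl

/-- The monomial with exponent `a`. -/
def mono (a : ι →₀ ℤ) : Laurent K ι := (AddMonoidAlgebra.single a 1 : AddMonoidAlgebra K (ι →₀ ℤ))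

theorem ext {x y : Laurent K ι} (h : ∀ a, coef a x = coef a y) : x = y :=
  AddMonoidAlgebra.coeff_injective (Finsupp.ext h)

theorem finite_support (z : Laurent K ι) : {a | coef a z ≠ 0}.Finite :=
  (AddMonoidAlgebra.coeff z).hasFiniteSupport.subset fun _ h => h

theorem exists_coef_eq (g : (ι →₀ ℤ) → K) (hg : {a | g a ≠ 0}.Finite) :
    ∃ z : Laurent K ι, ∀ a, coef a z = g a :=
  ⟨AddMonoidAlgebra.ofCoeff (Finsupp.onFinset hg.toFinset g (by simp)), fun _ => rfl⟩

theorem coef_mono [DecidableEq (ι →₀ ℤ)] (a b : ι →₀ ℤ) :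
    coef b (mono a : Laurent K ι) = if a = b then 1 else 0 :=
  Finsupp.single_apply

@[simp] theorem coef_mono_same (a : ι →₀ ℤ) : coef a (mono a : Laurent K ι) = 1 := by
  classical
  rw [coef_mono, if_pos rfl]

theorem coef_mono_ne {a b : ι →₀ ℤ} (h : a ≠ b) : coef b (mono a : Laurent K ι) = 0 := by
  classical
  rw [coef_mono, if_neg h]

theorem coef_mono_mul (a b : ι →₀ ℤ) (z : Laurent K ι) :
    coef b (mono a * z) = coef (b - a) z := by
  have h : coef b (mono a * z) = 1 * AddMonoidAlgebra.coeff z (-a + b) :=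
    AddMonoidAlgebra.coeff_single_mul_apply z 1 a b
  rw [h, one_mul, neg_add_eq_sub]
  rfl

theorem mono_zero : (mono 0 : Laurent K ι) = 1 := rfl

theorem mono_add (a b : ι →₀ ℤ) : (mono (a + b) : Laurent K ι) = mono a * mono b := by
  refine ext fun c => ?_
  classical
  rw [coef_mono_mul, coef_mono, coef_mono]
  exact if_congr eq_sub_iff_add_eq'.symm rfl rfl

theorem mono_neg_mul (a : ι →₀ ℤ) : (mono (-a) * mono a : Laurent K ι) = 1 := by
  rw [← mono_add, neg_add_cancel, mono_zero]

theorem mono_sum {α : Type*} (s : Finset α) (f : α → ι →₀ ℤ) :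
    (mono (∑ i ∈ s, f i) : Laurent K ι) = ∏ i ∈ s, mono (f i) := by
  classical
  induction s using Finset.induction_on with
  | empty => rfl
  | insert a s ha ih => rw [Finset.sum_insert ha, Finset.prod_insert ha, mono_add, ih]

theorem mono_nsmul (n : ℕ) (a : ι →₀ ℤ) : (mono (n • a) : Laurent K ι) = mono a ^ n := by
  rw [← Finset.card_range n, ← Finset.sum_const, mono_sum, Finset.prod_const]

theorem induction {motive : Laurent K ι → Prop} (z : Laurent K ι) (zero : motive 0)
    (mono : ∀ a (c : K), coef a z ≠ 0 → motive (c • mono a))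
    (add : ∀ x y, motive x → motive y → motive (x + y)) : motive z := by
  have hz : z = ∑ a ∈ (finite_support z).toFinset, coef a z • Laurent.mono a := by
    refine ext fun b => ?_
    rw [map_sum, Finset.sum_eq_single b]
    · rw [map_smul, coef_mono_same, smul_eq_mul, mul_one]
    · intro a _ hab
      rw [map_smul, coef_mono_ne hab, smul_zero]
    · intro hb
      have : coef b z = 0 := by simpa using hb
      rw [this, zero_smul, map_zero]
  rw [hz]
  refine Finset.sum_induction _ motive add zero fun a ha => mono a _ (by simpa using ha)

end Laurent

open Laurent

/-- The exponent of a monomial, as the exponent of a Laurent monomial. -/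
def expo : (ι →₀ ℕ) →+ (ι →₀ ℤ) := Finsupp.mapRange.addMonoidHom (Nat.castAddMonoidHom ℤ)

@[simp] theorem expo_apply (e : ι →₀ ℕ) (i : ι) : expo e i = e i := rfl

theorem expo_injective : Function.Injective (expo : (ι →₀ ℕ) → (ι →₀ ℤ)) := fun _ _ h =>
  Finsupp.ext fun i => Nat.cast_injective (DFunLike.congr_fun h i)

theorem exists_expo_eq {a : ι →₀ ℤ} (h : ∀ i, 0 ≤ a i) : ∃ e, expo e = a :=
  ⟨a.mapRange Int.toNat rfl, Finsupp.ext fun i => Int.toNat_of_nonneg (h i)⟩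

theorem weight_expo (e : ι →₀ ℕ) : Finsupp.weight w (expo e) = Finsupp.weight w e := by
  rw [Finsupp.weight_apply, Finsupp.weight_apply]
  refine (Finsupp.sum_mapRange_index (f := Nat.castAddMonoidHom ℤ) (hf := map_zero _)
    (h := fun i (c : ℤ) => c • w i) (by simp)).trans ?_
  simp

variable (K ι) in
/-- The inclusion of polynomials into Laurent polynomials. -/
def toLaurent : MvPolynomial ι K →ₐ[K] Laurent K ι :=
  aeval fun i => mono (Finsupp.single i 1)

theorem toLaurent_monomial (e : ι →₀ ℕ) (c : K) :
    toLaurent K ι (monomial e c) = c • mono (expo e) := by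
  have he : expo e = ∑ i ∈ e.support, e i • (Finsupp.single i 1 : ι →₀ ℤ) := by
    refine Finsupp.ext fun i => ?_
    classical
    simp [Finsupp.finsetSum_apply, Finsupp.single_apply]
  rw [toLaurent, aeval_monomial, he, mono_sum, Algebra.smul_def]
  simp_rw [mono_nsmul]
  rfl

theorem coef_toLaurent (e : ι →₀ ℕ) (p : MvPolynomial ι K) :
    coef (expo e) (toLaurent K ι p) = coeff e p := by
  classical
  induction p using MvPolynomial.induction_on' with
  | monomial e' c =>
    rw [toLaurent_monomial, map_smul, coef_mono, coeff_monomial, smul_eq_mul, mul_ite, mul_one,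
      mul_zero]
    exact if_congr expo_injective.eq_iff rfl rfl
  | add p q hp hq => rw [map_add, map_add, hp, hq, coeff_add]

theorem coef_toLaurent_eq_zero {a : ι →₀ ℤ} {i : ι} (ha : a i < 0) (p : MvPolynomial ι K) :
    coef a (toLaurent K ι p) = 0 := by
  induction p using MvPolynomial.induction_on' with
  | monomial e c =>
    rw [toLaurent_monomial, map_smul, coef_mono_ne, smul_zero]
    rintro rfl
    rw [expo_apply] at ha
    omega
  | add p q hp hq => rw [map_add, map_add, hp, hq, add_zero]

theorem toLaurent_injective : Function.Injective (toLaurent K ι) := fun p q h =>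
  MvPolynomial.ext _ _ fun e => by rw [← coef_toLaurent, h, coef_toLaurent]

instance : Algebra (MvPolynomial ι K) (Laurent K ι) := (toLaurent K ι).toRingHom.toAlgebra

theorem smul_laurent (p : MvPolynomial ι K) (z : Laurent K ι) : p • z = toLaurent K ι p * z := rfl

instance : IsScalarTower K (MvPolynomial ι K) (Laurent K ι) :=
  ⟨fun c p z => by
    rw [smul_laurent, smul_laurent, map_smul, smul_mul_assoc]⟩

theorem monomial_smul_laurent (e : ι →₀ ℕ) (z : Laurent K ι) :
    (monomial e (1 : K)) • z = mono (expo e) * z := by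
  rw [smul_laurent, toLaurent_monomial, one_smul]

/-! ### Localizations of free modules inside Laurent polynomials -/

variable {r : ℕ} (t : Fin r → ι) {N : Type u} [AddCommGroup N] [Module (MvPolynomial ι K) N]

section Lift

variable {V : Type*} [AddCommGroup V] [Module (MvPolynomial ι K) V] [Module (Laurent K ι) V]
  [IsScalarTower (MvPolynomial ι K) (Laurent K ι) V]

variable (V) in
theorem isUnit_smul_of_mem_cechMonoid {I : Finset (Fin r)} (s : cechMonoid K t I) :
    IsUnit (algebraMap (MvPolynomial ι K) (Module.End (MvPolynomial ι K) V) s) := by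
  obtain ⟨e, he, -⟩ := exists_monomial_of_mem_cechMonoid t s.2
  rw [Module.End.isUnit_iff]
  have h : ∀ x : V, (s : MvPolynomial ι K) • x = (mono (expo e) : Laurent K ι) • x := by
    intro x
    rw [← one_smul (Laurent K ι) x, ← smul_assoc, he, monomial_smul_laurent, mul_one, one_smul]
  constructor
  · intro x y hxy
    have hxy' : (s : MvPolynomial ι K) • x = (s : MvPolynomial ι K) • y := hxy
    rw [h, h] at hxy'
    have := congrArg ((mono (-expo e) : Laurent K ι) • ·) hxy'
    simpa only [smul_smul, mono_neg_mul, one_smul] using this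
  · intro x
    have h1 : (mono (expo e) : Laurent K ι) • (mono (-expo e) : Laurent K ι) • x = x := by
      rw [← mul_smul, mul_comm, mono_neg_mul, one_smul]
    exact ⟨(mono (-expo e) : Laurent K ι) • x, (h _).trans h1⟩

/-- The extension of a linear map into a module over the Laurent polynomials to a localization. -/
def lauLift (g : N →ₗ[MvPolynomial ι K] V) (I : Finset (Fin r)) :
    CechLoc K t N I →ₗ[MvPolynomial ι K] V :=
  LocalizedModule.lift (cechMonoid K t I) g (isUnit_smul_of_mem_cechMonoid t V)

theorem lauLift_mk (g : N →ₗ[MvPolynomial ι K] V) (I : Finset (Fin r)) (y : N)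
    (s : cechMonoid K t I) {e : ι →₀ ℕ} (he : (s : MvPolynomial ι K) = monomial e 1) :
    lauLift t g I (LocalizedModule.mk y s) = (mono (-expo e) : Laurent K ι) • g y := by
  rw [lauLift, LocalizedModule.lift_mk, Module.End.algebraMap_isUnit_inv_apply_eq_iff, he,
    ← smul_assoc, monomial_smul_laurent, mul_comm, mono_neg_mul, one_smul]

theorem lauLift_cechRes (g : N →ₗ[MvPolynomial ι K] V) {I J : Finset (Fin r)} (h : I ⊆ J)
    (z : CechLoc K t N I) : lauLift t g J (cechRes t N h z) = lauLift t g I z := by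
  induction z using LocalizedModule.induction_on with
  | h y s =>
    obtain ⟨e, he, -⟩ := exists_monomial_of_mem_cechMonoid t s.2
    rw [cechRes_mk, lauLift_mk t g I y s he, lauLift_mk t g J y _ he]

theorem lauLift_cechLocMap {N' : Type u} [AddCommGroup N'] [Module (MvPolynomial ι K) N']
    (f : N' →ₗ[MvPolynomial ι K] N) (g : N →ₗ[MvPolynomial ι K] V) (I : Finset (Fin r))
    (z : CechLoc K t N' I) : lauLift t g I (cechLocMap t f I z) = lauLift t (g ∘ₗ f) I z := by
  induction z using LocalizedModule.induction_on with
  | h y s =>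
    obtain ⟨e, he, -⟩ := exists_monomial_of_mem_cechMonoid t s.2
    rw [cechLocMap_mk, lauLift_mk t g I _ s he, lauLift_mk t _ I y _ he]
    rfl

end Lift

/-- The extension of a functional `c : N → S` to a localization, with values in the Laurent
polynomials. -/
def lauOf (c : N →ₗ[MvPolynomial ι K] MvPolynomial ι K) (I : Finset (Fin r)) :
    CechLoc K t N I →ₗ[MvPolynomial ι K] Laurent K ι :=
  lauLift t (Algebra.linearMap (MvPolynomial ι K) (Laurent K ι) ∘ₗ c) I

theorem lauOf_mk (c : N →ₗ[MvPolynomial ι K] MvPolynomial ι K) (I : Finset (Fin r)) (y : N)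
    (s : cechMonoid K t I) {e : ι →₀ ℕ} (he : (s : MvPolynomial ι K) = monomial e 1) :
    lauOf t c I (LocalizedModule.mk y s) = mono (-expo e) * toLaurent K ι (c y) :=
  lauLift_mk t _ I y s he

theorem lauOf_cechRes (c : N →ₗ[MvPolynomial ι K] MvPolynomial ι K) {I J : Finset (Fin r)}
    (h : I ⊆ J) (z : CechLoc K t N I) : lauOf t c J (cechRes t N h z) = lauOf t c I z :=
  lauLift_cechRes t _ h z

/-- Only inverted variables occur with negative exponents. -/
theorem coef_lauOf_eq_zero (c : N →ₗ[MvPolynomial ι K] MvPolynomial ι K) {I : Finset (Fin r)}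
    (z : CechLoc K t N I) {a : ι →₀ ℤ} {i : ι} (hi : ∀ k ∈ I, t k ≠ i) (ha : a i < 0) :
    coef a (lauOf t c I z) = 0 := by
  induction z using LocalizedModule.induction_on with
  | h y s =>
    obtain ⟨e, he, he'⟩ := exists_monomial_of_mem_cechMonoid t s.2
    rw [lauOf_mk t c I y s he, coef_mono_mul]
    refine coef_toLaurent_eq_zero (i := i) ?_ _
    have h0 : e i = 0 := by
      by_contra h
      obtain ⟨k, hk, hki⟩ := he' i h
      exact hi k hk hki
    simpa [h0] using ha

section Basis

variable {k : ℕ} (b : Module.Basis (Fin k) (MvPolynomial ι K) N)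

theorem eq_zero_of_lauOf {I : Finset (Fin r)} {z : CechLoc K t N I}
    (h : ∀ j, lauOf t (b.coord j) I z = 0) : z = 0 := by
  induction z using LocalizedModule.induction_on with
  | h y s =>
    obtain ⟨e, he, -⟩ := exists_monomial_of_mem_cechMonoid t s.2
    have hy : y = 0 := by
      refine b.ext_elem fun j => ?_
      have hj := h j
      rw [lauOf_mk t _ I y s he] at hj
      have h1 := congrArg (mono (expo e) * ·) hj
      simp only [← mul_assoc, mul_zero] at h1
      rw [mul_comm (mono (expo e)), mono_neg_mul, one_mul] at h1
      have h2 := toLaurent_injective (h1.trans (map_zero _).symm)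
      rw [map_zero]
      exact h2
    rw [hy, LocalizedModule.zero_mk]

theorem lauOf_ext {I : Finset (Fin r)} {z z' : CechLoc K t N I}
    (h : ∀ j, lauOf t (b.coord j) I z = lauOf t (b.coord j) I z') : z = z' := by
  rw [← sub_eq_zero]
  refine eq_zero_of_lauOf t b fun j => ?_
  rw [map_sub, h, sub_self]

theorem monomial_mem_cechMonoid {I : Finset (Fin r)} {e : ι →₀ ℕ}
    (he : ∀ i, e i ≠ 0 → ∃ k ∈ I, t k = i) : monomial e (1 : K) ∈ cechMonoid K t I := by
  rw [monomial_eq, C_1, one_mul]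
  refine Submonoid.prod_mem _ fun i hi => Submonoid.pow_mem _ ?_ _
  obtain ⟨k, hk, rfl⟩ := he i (Finsupp.mem_support_iff.1 hi)
  exact Submonoid.subset_closure ⟨k, hk, rfl⟩

/-- The multiple of an element by a Laurent monomial in the localization. -/
def lauMono (I : Finset (Fin r)) (y : N) (a : ι →₀ ℤ) (ha : ∀ i, a i < 0 → ∃ k ∈ I, t k = i) :
    CechLoc K t N I :=
  LocalizedModule.mk (monomial (a.mapRange Int.toNat rfl) (1 : K) • y)
    ⟨monomial ((-a).mapRange Int.toNat rfl) 1, monomial_mem_cechMonoid t (fun i hi => ha i (by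
      have : ((-a) i).toNat ≠ 0 := hi
      rw [Finsupp.neg_apply] at this
      omega))⟩

theorem expo_sub_expo (a : ι →₀ ℤ) :
    expo (a.mapRange Int.toNat rfl) - expo ((-a).mapRange Int.toNat rfl) = a := by
  refine Finsupp.ext fun i => ?_
  change ((a i).toNat : ℤ) - ((-(a i)).toNat : ℤ) = a i
  omega

theorem lauOf_lauMono (I : Finset (Fin r)) (y : N) (a : ι →₀ ℤ)
    (ha : ∀ i, a i < 0 → ∃ k ∈ I, t k = i) (c : N →ₗ[MvPolynomial ι K] MvPolynomial ι K) :
    lauOf t c I (lauMono t I y a ha) = mono a * toLaurent K ι (c y) := by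
  rw [lauMono, lauOf_mk t c I _ _ rfl, map_smul, smul_eq_mul, map_mul, toLaurent_monomial, one_smul,
    ← mul_assoc, ← mono_add, neg_add_eq_sub, expo_sub_expo]

/-- The sums of multiples of the basis elements by Laurent monomials. -/
def monoSums (I : Finset (Fin r)) : AddSubmonoid (CechLoc K t N I) :=
  AddSubmonoid.closure {z | ∃ (c : K) (j : Fin k) (a : ι →₀ ℤ)
    (ha : ∀ i, a i < 0 → ∃ k ∈ I, t k = i),
    z = (C c : MvPolynomial ι K) • lauMono t I (b j) a ha}

theorem exists_mem_monoSums {I : Finset (Fin r)} (g : Fin k → Laurent K ι)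
    (hg : ∀ j a, coef a (g j) ≠ 0 → ∀ i, a i < 0 → ∃ k ∈ I, t k = i) :
    ∃ z ∈ monoSums t b I, ∀ j, lauOf t (b.coord j) I z = g j := by
  have hj : ∀ j, ∃ z ∈ monoSums t b I, ∀ j', lauOf t (b.coord j') I z =
      if j' = j then g j else 0 := by
    intro j
    have key : ∀ x : Laurent K ι, (∀ a, coef a x ≠ 0 → ∀ i, a i < 0 → ∃ k ∈ I, t k = i) →
        ∃ z ∈ monoSums t b I, ∀ j', lauOf t (b.coord j') I z = if j' = j then x else 0 := by
      intro x hx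
      refine Laurent.induction (motive := fun x' => ∃ z ∈ monoSums t b I, ∀ j',
        lauOf t (b.coord j') I z = if j' = j then x' else 0) x ?_ ?_ ?_
      · exact ⟨0, zero_mem _, fun j' => by simp⟩
      · intro a c ha
        refine ⟨(C c : MvPolynomial ι K) • lauMono t I (b j) a (hx a ha),
          AddSubmonoid.subset_closure ⟨c, j, a, hx a ha, rfl⟩, fun j' => ?_⟩
        rw [map_smul, lauOf_lauMono, smul_laurent, Module.Basis.coord_apply,
          Module.Basis.repr_self]
        by_cases h : j' = j
        · subst h
          have hC : toLaurent K ι (C c) = algebraMap K _ c := (toLaurent K ι).commutes c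
          rw [if_pos rfl, Finsupp.single_eq_same, map_one, mul_one, hC, Algebra.smul_def]
        · rw [if_neg h, Finsupp.single_eq_of_ne h, map_zero, mul_zero, mul_zero]
      · intro x y hx hy
        obtain ⟨z, hzm, hz⟩ := hx
        obtain ⟨z', hzm', hz'⟩ := hy
        refine ⟨z + z', add_mem hzm hzm', fun j' => ?_⟩
        rw [map_add, hz, hz']
        split_ifs <;> simp
    exact key (g j) (hg j)
  choose z hzm hz using hj
  refine ⟨∑ j, z j, sum_mem fun j _ => hzm j, fun j => ?_⟩
  rw [map_sum]
  simp_rw [hz]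
  simp

/-- A family of Laurent polynomials in which only inverted variables occur with negative
exponents comes from an element of the localization. -/
theorem exists_lauOf_eq {I : Finset (Fin r)} (g : Fin k → Laurent K ι)
    (hg : ∀ j a, coef a (g j) ≠ 0 → ∀ i, a i < 0 → ∃ k ∈ I, t k = i) :
    ∃ z : CechLoc K t N I, ∀ j, lauOf t (b.coord j) I z = g j :=
  (exists_mem_monoSums t b g hg).imp fun _ h => h.2

theorem mem_monoSums {I : Finset (Fin r)} (z : CechLoc K t N I) : z ∈ monoSums t b I := by
  obtain ⟨z', hz', h⟩ := exists_mem_monoSums t b (I := I) (fun j => lauOf t (b.coord j) I z)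
    fun j a ha i hi => by
      by_contra! hcon
      exact ha (coef_lauOf_eq_zero t _ z (i := i) hcon hi)
  rwa [← lauOf_ext t b h]

end Basis

end LaurentPolynomials

/-! ### The Čech complex of a free module -/

section FreeCech

open Laurent

variable {r : ℕ} (t : Fin r → ι) {N : Type u} [AddCommGroup N] [Module (MvPolynomial ι K) N]

/-- The coefficient at `a` of the component at `I` of a Čech cochain, in the coordinate given by
the functional `c`; it is `0` when `I` does not have `p` elements. -/
def cechCoef (c : N →ₗ[MvPolynomial ι K] MvPolynomial ι K) (a : ι →₀ ℤ) {p : ℤ}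
    (x : CechObj K t N p) (I : Finset (Fin r)) : K :=
  if h : (I.card : ℤ) = p then coef a (lauOf t c I (x ⟨I, h⟩)) else 0

theorem cechCoef_of (c : N →ₗ[MvPolynomial ι K] MvPolynomial ι K) (a : ι →₀ ℤ) {p : ℤ}
    (x : CechObj K t N p) {I : Finset (Fin r)} (h : (I.card : ℤ) = p) :
    cechCoef t c a x I = coef a (lauOf t c I (x ⟨I, h⟩)) := dif_pos h

theorem cechCoef_cechD (c : N →ₗ[MvPolynomial ι K] MvPolynomial ι K) (a : ι →₀ ℤ) {p q : ℤ}
    (h : p + 1 = q) (x : CechObj K t N p) {J : Finset (Fin r)} (hJ : (J.card : ℤ) = q) :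
    cechCoef t c a (cechD t N p q x) J =
      ∑ k ∈ J, cechSign J k • cechCoef t c a x (J.erase k) := by
  rw [cechCoef_of t c a _ hJ, cechD_eq_sum t h, map_sum, map_sum]
  refine Finset.sum_congr rfl fun k hk => ?_
  have hc := card_erase_eq h ⟨J, hJ⟩ ⟨k, hk⟩
  rw [map_zsmul, map_zsmul, cechCoef_of t c a x hc, cechExt_of t x hc (Finset.erase_subset _ _),
    lauOf_cechRes]

theorem cechCoef_eq_zero (c : N →ₗ[MvPolynomial ι K] MvPolynomial ι K) {a : ι →₀ ℤ} {p : ℤ}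
    (x : CechObj K t N p) {I : Finset (Fin r)} {i : ι} (hi : ∀ k ∈ I, t k ≠ i) (ha : a i < 0) :
    cechCoef t c a x I = 0 := by
  by_cases h : (I.card : ℤ) = p
  · rw [cechCoef_of t c a x h, coef_lauOf_eq_zero t c _ hi ha]
  · exact dif_neg h

theorem finite_cechCoef (c : N →ₗ[MvPolynomial ι K] MvPolynomial ι K) {p : ℤ}
    (x : CechObj K t N p) (I : Finset (Fin r)) : {a | cechCoef t c a x I ≠ 0}.Finite := by
  by_cases h : (I.card : ℤ) = p
  · simp_rw [cechCoef_of t c _ x h]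
    exact Laurent.finite_support _
  · have : {a | cechCoef t c a x I ≠ 0} = ∅ := Set.eq_empty_of_forall_notMem fun a ha =>
      ha (dif_neg h)
    rw [this]
    exact Set.finite_empty

variable {k : ℕ} (b : Module.Basis (Fin k) (MvPolynomial ι K) N)

theorem cechCoef_ext {p : ℤ} {x y : CechObj K t N p}
    (h : ∀ I : Finset (Fin r), (I.card : ℤ) = p → ∀ j a,
      cechCoef t (b.coord j) a x I = cechCoef t (b.coord j) a y I) : x = y := by
  funext I
  refine lauOf_ext t b fun j => Laurent.ext fun a => ?_
  have := h I.1 I.2 j a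
  rwa [cechCoef_of t _ a x I.2, cechCoef_of t _ a y I.2] at this

/-- For each exponent `a` and each index `k` with `0 ≤ a (t k)`, adding `k` to the index sets is
a contracting homotopy on the part of exponent `a` of the Čech complex. So a cocycle without
terms in which all the variables `X (t k)` have negative exponents is a coboundary. -/
theorem mem_range_cechD {p' p p'' : ℤ} (hp : p' + 1 = p) (hp' : p + 1 = p'')
    (x : CechObj K t N p) (hx : cechD t N p p'' x = 0)
    (hneg : ∀ I : Finset (Fin r), (I.card : ℤ) = p → ∀ j a, (∀ l, a (t l) < 0) →
      cechCoef t (b.coord j) a x I = 0) :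
    ∃ y : CechObj K t N p', cechD t N p' p y = x := by
  classical
  -- `κ a` is an index `k` with `0 ≤ a (t k)`, if there is one.
  let κ : (ι →₀ ℤ) → Option (Fin r) := fun a =>
    if h : ∃ l, 0 ≤ a (t l) then some h.choose else none
  have hκ : ∀ a l, κ a = some l → 0 ≤ a (t l) := by
    intro a l h
    by_cases h' : ∃ l, 0 ≤ a (t l)
    · have : some h'.choose = some l := (dif_pos h').symm.trans h
      rw [← Option.some_injective _ this]
      exact h'.choose_spec
    · have : none = some l := (dif_neg h').symm.trans h
      simp at this
  have hκ' : ∀ a, κ a = none → ∀ l, a (t l) < 0 := by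
    intro a h l
    by_contra hl
    have : some _ = none := (dif_pos (⟨l, not_lt.1 hl⟩ : ∃ l, 0 ≤ a (t l))).symm.trans h
    simp at this
  -- The coefficients of the contracting homotopy applied to `x`.
  let Y : Finset (Fin r) → Fin k → (ι →₀ ℤ) → K := fun I j a =>
    match κ a with
    | none => 0
    | some l => if l ∈ I then 0 else
        cechSign (insert l I) l • cechCoef t (b.coord j) a x (insert l I)
  have hY : ∀ I j a, Y I j a ≠ 0 → ∃ l, κ a = some l ∧ l ∉ I ∧
      cechCoef t (b.coord j) a x (insert l I) ≠ 0 := by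
    intro I j a h
    rcases hl : κ a with _ | l
    · exact absurd (by simp only [Y, hl]) h
    · have hYl : Y I j a = if l ∈ I then 0 else
        cechSign (insert l I) l • cechCoef t (b.coord j) a x (insert l I) := by simp only [Y, hl]
      by_cases hlI : l ∈ I
      · exact absurd (hYl.trans (if_pos hlI)) h
      · refine ⟨l, rfl, hlI, fun h0 => h ?_⟩
        rw [hYl, if_neg hlI, h0, smul_zero]
  have hYfin : ∀ I j, {a | Y I j a ≠ 0}.Finite := fun I j =>
    (Set.finite_iUnion fun l => finite_cechCoef t (b.coord j) x (insert l I)).subset fun a ha => by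
      obtain ⟨l, -, -, hl⟩ := hY I j a ha
      exact Set.mem_iUnion.2 ⟨l, hl⟩
  -- The coefficients `Y` define an element of the localization at `I`: `x` lives on `insert l I`, but
  -- the exponent of `X (t l)` is nonnegative.
  have hex : ∀ I : Finset (Fin r), ∃ z : CechLoc K t N I, ∀ j a,
      coef a (lauOf t (b.coord j) I z) = Y I j a := by
    intro I
    choose g hg using fun j => Laurent.exists_coef_eq (Y I j) (hYfin I j)
    obtain ⟨z, hz⟩ := exists_lauOf_eq (I := I) t b g (by
      intro j a ha i hi
      rw [hg] at ha
      obtain ⟨l, hl, -, hl'⟩ := hY I j a ha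
      by_contra! hcon
      refine hl' (cechCoef_eq_zero t _ x (i := i) ?_ hi)
      intro l' hl'' he
      rcases Finset.mem_insert.1 hl'' with rfl | h
      · exact absurd (hκ a _ hl) (by rw [he]; omega)
      · exact hcon l' h he)
    exact ⟨z, fun j a => by rw [hz, hg]⟩
  choose z hz using hex
  refine ⟨fun I => z I.1, cechCoef_ext t b fun J hJ j a => ?_⟩
  rw [cechCoef_cechD t _ a hp _ hJ]
  have hterm : ∀ l ∈ J, cechCoef t (b.coord j) a (fun I => z I.1 : CechObj K t N p') (J.erase l) =
      Y (J.erase l) j a := fun l hl =>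
    (cechCoef_of t _ a _ (card_erase_eq hp ⟨J, hJ⟩ ⟨l, hl⟩)).trans (hz _ j a)
  rw [Finset.sum_congr rfl fun l hl => by rw [hterm l hl]]
  rcases hl : κ a with _ | l
  · rw [hneg J hJ j a (hκ' a hl)]
    exact Finset.sum_eq_zero fun l _ => by simp only [Y, hl, smul_zero]
  have hYl : ∀ I, Y I j a = if l ∈ I then 0 else
      cechSign (insert l I) l • cechCoef t (b.coord j) a x (insert l I) := fun I => by
    simp only [Y, hl]
  by_cases hlJ : l ∈ J
  · rw [Finset.sum_eq_single_of_mem l hlJ]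
    · rw [hYl, if_neg (Finset.notMem_erase l J), Finset.insert_erase hlJ, smul_smul,
        cechSign_mul_self, one_smul]
    · intro l' _ hne
      rw [hYl, if_pos (Finset.mem_erase.2 ⟨hne.symm, hlJ⟩), smul_zero]
  · have hJ' : ((insert l J).card : ℤ) = p'' := by
      rw [Finset.card_insert_of_notMem hlJ]
      push_cast
      omega
    -- Here the cocycle condition at `insert l J` expresses `x J` through the other faces.
    have hcoc := cechCoef_cechD t (b.coord j) a hp' x hJ'
    have h0 : cechCoef t (b.coord j) a (cechD t N p p'' x) (insert l J) = 0 := by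
      rw [hx, cechCoef_of t _ a _ hJ']
      exact (congrArg _ (map_zero _)).trans (map_zero _)
    rw [h0, Finset.sum_insert hlJ, Finset.erase_insert hlJ] at hcoc
    have hX := congrArg (cechSign (insert l J) l • ·) hcoc
    simp only [smul_zero, smul_add, smul_smul, cechSign_mul_self, one_smul, Finset.smul_sum] at hX
    rw [eq_neg_of_add_eq_zero_left hX.symm, ← Finset.sum_neg_distrib]
    refine Finset.sum_congr rfl fun l' hl' => ?_
    have hne : l ≠ l' := fun h => hlJ (h ▸ hl')
    have hsw := cechSign_swap (Finset.mem_insert_self l J) (Finset.mem_insert_of_mem hl') hne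
    rw [Finset.erase_insert hlJ, Finset.erase_insert_of_ne hne] at hsw
    rw [Finset.erase_insert_of_ne hne, hYl, if_neg fun h => hlJ (Finset.mem_of_mem_erase h),
      smul_smul, ← neg_smul]
    congr 1
    have h1 := cechSign_mul_self (insert l J) l
    have h2 := cechSign_mul_self (insert l (J.erase l')) l
    generalize cechSign (insert l J) l = s1 at *
    generalize cechSign (insert l (J.erase l')) l = s2 at *
    generalize cechSign J l' = s3 at *
    generalize cechSign (insert l J) l' = s4 at *
    linear_combination (-(s3 * s2)) * h1 + s1 * s2 * hsw - s1 * s4 * h2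

/-- The Čech complex of a free module is exact below the top degree. -/
theorem exact_cechD {k : ℕ} (b : Module.Basis (Fin k) (MvPolynomial ι K) N)
    (ht : Function.Injective t) {p' p p'' : ℤ} (hp : p' + 1 = p)
    (hp' : p + 1 = p'') (hpr : p ≠ r) (x : CechObj K t N p) (hx : cechD t N p p'' x = 0) :
    ∃ y : CechObj K t N p', cechD t N p' p y = x := by
  refine mem_range_cechD t b hp hp' x hx fun I hI j a ha => ?_
  obtain ⟨l, hl⟩ : ∃ l, l ∉ I := by
    by_contra! h
    rw [Finset.eq_univ_of_forall h, Finset.card_univ, Fintype.card_fin] at hI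
    exact hpr hI.symm
  exact cechCoef_eq_zero t _ x (i := t l) (fun k hk h => hl (ht h ▸ hk)) (ha l)

end FreeCech

/-! ### Graded free modules of finite rank -/

section FiniteFree

variable {A B C N : GMod K w} {k : ℕ} {b : Module.Basis (Fin k) (MvPolynomial ι K) A} {g : Fin k → Γ}

theorem proj_smul_basis (hA : A.IsGraded) {y : A} {γ : Γ} (hy : y ∈ A.piece γ) (δ : Γ)
    (s : MvPolynomial ι K) :
    hA.proj δ (s • y) = weightedHomogeneousComponent w (δ - γ) s • y := by
  induction s using MvPolynomial.induction_on' with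
  | monomial e c =>
    have hs : IsWeightedHomogeneous w (monomial e c) (Finsupp.weight w e) :=
      isWeightedHomogeneous_monomial w e c rfl
    have hsy := hA.smul_mem _ _ _ _ hs hy
    by_cases h : Finsupp.weight w e + γ = δ
    · subst h
      rw [hA.proj_of_mem hsy, add_sub_cancel_right, hs.weightedHomogeneousComponent_same]
    · rw [hA.proj_of_mem_ne hsy h, hs.weightedHomogeneousComponent_ne (δ - γ)
        fun h' => h (eq_sub_iff_add_eq.1 h'.symm), zero_smul]
  | add s s' h h' => rw [add_smul, map_add, h, h', map_add, add_smul]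

/-- The coordinates of a homogeneous element are homogeneous. -/
theorem repr_mem (hA : A.IsGraded) (hb : ∀ j, b j ∈ A.piece (g j)) {δ : Γ} {x : A}
    (hx : x ∈ A.piece δ) (j : Fin k) :
    b.repr x j ∈ weightedHomogeneousSubmodule K w (δ - g j) := by
  have h : x = ∑ j, weightedHomogeneousComponent w (δ - g j) (b.repr x j) • b j := by
    conv_lhs => rw [← hA.proj_of_mem hx, ← b.sum_repr x, map_sum]
    exact Finset.sum_congr rfl fun j _ => proj_smul_basis hA (hb j) δ _
  have h' := congrArg (fun y => b.repr y j) h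
  simp only [map_sum, map_smul, Module.Basis.repr_self, Finsupp.coe_finsetSum, Finset.sum_apply,
    Finsupp.smul_apply] at h'
  rw [Finset.sum_eq_single_of_mem j (Finset.mem_univ j) (fun i _ hi => by
    rw [Finsupp.single_eq_of_ne hi.symm, smul_zero])] at h'
  rw [Finsupp.single_eq_same, smul_eq_mul, mul_one] at h'
  rw [h']
  exact weightedHomogeneousComponent_mem w _ _

/-- The linear map underlying an element of `Hom_S(A, N)`. -/
def homFun (u : homMod A N) : A →ₗ[MvPolynomial ι K] N := u

/-- A linear map out of a graded free module shifts degrees by `γ` if it does so on a basis. -/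
theorem mem_piece_homMod_iff (hA : A.IsGraded) (hb : ∀ j, b j ∈ A.piece (g j)) (hN : N.IsGraded)
    {γ : Γ} (φ : A →ₗ[MvPolynomial ι K] N) :
    (φ : homMod A N) ∈ (homMod A N).piece γ ↔ ∀ j, φ (b j) ∈ N.piece (g j + γ) := by
  refine ⟨fun h j => h _ _ (hb j), fun h δ x hx => ?_⟩
  rw [← b.sum_repr x, map_sum]
  refine Submodule.sum_mem _ fun j _ => ?_
  rw [map_smul]
  have := hN.smul_mem _ _ _ _ (repr_mem hA hb hx j) (h j)
  rwa [← add_assoc, sub_add_cancel] at this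

/-- The graded map with given homogeneous values on a basis. -/
def GHom.ofBasis (hA : A.IsGraded) (hb : ∀ j, b j ∈ A.piece (g j)) (hB : B.IsGraded)
    (y : Fin k → B) (hy : ∀ j, y j ∈ B.piece (g j)) : GHom A B where
  toLin := b.constr ℕ y
  map_piece γ x hx := by
    have h := (mem_piece_homMod_iff (γ := 0) hA hb hB (b.constr ℕ y)).2 fun j => by
      rw [b.constr_basis, add_zero]
      exact hy j
    have := h γ x hx
    rwa [add_zero] at this

theorem isGraded_homMod (hA : A.IsFiniteFree) (hN : N.IsGraded) : (homMod A N).IsGraded := by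
  obtain ⟨hA, k, b, hb⟩ := hA
  choose g hb using hb
  refine GMod.IsGraded.of_separating (M := homMod A N) (N := Fin k → N)
    (fun γ => LinearMap.pi fun j => hN.proj (g j + γ) ∘ₗ
      (LinearMap.applyₗ (R := MvPolynomial ι K) (M₂ := N) (b j)).restrictScalars K) ?_ ?_ ?_ ?_
  · intro γ (φ : A →ₗ[MvPolynomial ι K] N) hφ h
    refine b.ext fun j => ?_
    exact (hN.proj_of_mem (hφ _ _ (hb j))).symm.trans (congrFun h j)
  · intro γ δ hδ (φ : A →ₗ[MvPolynomial ι K] N) hφ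
    funext j
    exact hN.proj_of_mem_ne (hφ _ _ (hb j)) fun h => hδ (add_left_cancel h)
  · intro (φ : A →ₗ[MvPolynomial ι K] N)
    have key : ∀ j (y : N), (b.constr ℕ (Pi.single j y) : homMod A N) ∈
        ⨆ γ, (homMod A N).piece γ := by
      intro j y
      induction y using hN.induction with
      | mem γ y hy =>
        refine Submodule.mem_iSup_of_mem (M := homMod A N) (p := (homMod A N).piece) (γ - g j)
          ((mem_piece_homMod_iff hA hb hN (b.constr ℕ (Pi.single j y))).2 fun i => ?_)
        rw [b.constr_basis]
        by_cases h : i = j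
        · subst h
          rw [Pi.single_eq_same, add_sub_cancel]
          exact hy
        · rw [Pi.single_eq_of_ne h]
          exact zero_mem _
      | zero =>
        rw [Pi.single_zero, map_zero]
        exact zero_mem _
      | add y z hy hz =>
        rw [Pi.single_add, map_add]
        exact add_mem hy hz
    have hφ : φ = ∑ j, (b.constr ℕ (Pi.single j (φ (b j))) : A →ₗ[MvPolynomial ι K] N) := by
      refine b.ext fun i => ?_
      rw [LinearMap.sum_apply]
      simp_rw [b.constr_basis]
      rw [Finset.sum_eq_single_of_mem i (Finset.mem_univ i), Pi.single_eq_same]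
      exact fun j _ hj => Pi.single_eq_of_ne hj.symm _
    exact Set.mem_of_eq_of_mem hφ
      (Submodule.sum_mem (⨆ γ, (homMod A N).piece γ) fun j _ => key j (φ (b j)))
  · intro a γ s φ hs hφ δ x hx
    have := hN.smul_mem _ _ _ _ hs (hφ δ x hx)
    rwa [add_left_comm] at this

theorem GMod.IsFiniteFree.isGraded (hA : A.IsFiniteFree) : A.IsGraded := hA.1

/-- Graded free modules are projective. -/
theorem GMod.IsFiniteFree.exists_lift (hA : A.IsFiniteFree) (hB : B.IsGraded) (hC : C.IsGraded)
    (f : GHom A C) (h : GHom B C) (hf : ∀ x, ∃ y, h.toLin y = f.toLin x) :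
    ∃ l : GHom A B, ∀ x, h.toLin (l.toLin x) = f.toLin x := by
  obtain ⟨hA, k, b, hb⟩ := hA
  choose g hb using hb
  choose y hy using fun j => hf (b j)
  refine ⟨GHom.ofBasis hA hb hB (fun j => hB.proj (g j) (y j)) fun j => hB.proj_mem _ _,
    fun x => ?_⟩
  refine DFunLike.congr_fun (f := h.toLin ∘ₗ b.constr ℕ _) (g := f.toLin) (b.ext fun j => ?_) x
  rw [LinearMap.comp_apply, b.constr_basis, h.map_proj hB hC, hy]
  exact hC.proj_of_mem (f.map_piece _ _ (hb j))

end FiniteFree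

/-! ### Comparison of resolutions -/

namespace FreeRes

variable {M M' : GMod K w}

theorem d_d (F : FreeRes M) {i j l : ℤ} (hj : j + 1 = i) (hl : l + 1 = j) (x : F.X i) :
    (F.d j l).toLin ((F.d i j).toLin x) = 0 := by
  subst hj hl
  by_cases hl : 0 ≤ l
  · have h : (F.d (l + 1 + 1) (l + 1)).toLin x ∈ LinearMap.ker (F.d (l + 1) (l + 1 - 1)).toLin :=
      F.exact (l + 1) (by omega) ▸ LinearMap.mem_range_self _ _
    rw [add_sub_cancel_right] at h
    exact h
  · have := F.neg l (by omega)
    exact Subsingleton.elim _ _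

theorem exists_d_eq (F : FreeRes M) {i j l : ℤ} (hj : j + 1 = i) (hl : l + 1 = j) (h0 : j ≠ 0)
    (x : F.X j) (hx : (F.d j l).toLin x = 0) : ∃ y, (F.d i j).toLin y = x := by
  subst hj hl
  rcases lt_or_ge l (-1) with h | h
  · have := F.neg (l + 1) (by omega)
    exact ⟨0, Subsingleton.elim _ _⟩
  · have h1 : x ∈ LinearMap.ker (F.d (l + 1) (l + 1 - 1)).toLin := by
      rw [add_sub_cancel_right]
      exact hx
    rw [← F.exact (l + 1) (by omega)] at h1
    exact h1

theorem exists_d_eq_zero (F : FreeRes M) (x : F.X 0) (hx : F.aug.toLin x = 0) :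
    ∃ y, (F.d 1 0).toLin y = x := by
  have h1 : x ∈ LinearMap.ker F.aug.toLin := hx
  rw [← F.exact_zero] at h1
  exact h1

theorem aug_d (F : FreeRes M) (x : F.X 1) : F.aug.toLin ((F.d 1 0).toLin x) = 0 := by
  have : (F.d 1 0).toLin x ∈ LinearMap.ker F.aug.toLin := F.exact_zero ▸ LinearMap.mem_range_self _ _
  exact this

/-- Every map of graded modules lifts to resolutions. -/
theorem exists_lift (hM' : M'.IsGraded) (F : FreeRes M) (F' : FreeRes M') (f : GHom M M') :
    Nonempty (F.Lift F' f) := by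
  obtain ⟨φ0, h0⟩ := (F.finiteFree 0).exists_lift (F'.finiteFree 0).isGraded hM' (f.comp F.aug)
    F'.aug fun x => F'.surj _
  -- In degree `n` the condition says that cycles of degree `n` are mapped to boundaries.
  let T : ℕ → Type _ := fun n => {φ : GHom (F.X n) (F'.X n) //
    ∀ x : F.X (n + 1), ∃ y : F'.X (n + 1),
      (F'.d (n + 1) n).toLin y = φ.toLin ((F.d (n + 1) n).toLin x)}
  have step : ∀ n (φ : T n), ∃ φ' : T (n + 1), ∀ x : F.X (n + 1),
      φ.1.toLin ((F.d (n + 1) n).toLin x) = (F'.d (n + 1) n).toLin (φ'.1.toLin x) := by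
    intro n φ
    obtain ⟨l, hl⟩ := (F.finiteFree (n + 1)).exists_lift (F'.finiteFree (n + 1)).isGraded
      (F'.finiteFree n).isGraded (φ.1.comp (F.d (n + 1) n)) (F'.d (n + 1) n) φ.2
    refine ⟨⟨l, fun x => ?_⟩, fun x => (hl x).symm⟩
    refine F'.exists_d_eq (l := n) rfl rfl (by positivity) _ ?_
    refine (hl _).trans ?_
    change φ.1.toLin _ = _
    exact (congrArg _ (F.d_d (i := (n + 1 : ℕ) + 1) (j := (n + 1 : ℕ)) (l := n) rfl rfl x)).trans
      (map_zero _)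
  choose next hnext using step
  let φ : ∀ n, T n := fun n => Nat.rec ⟨φ0, fun x => by
    refine F'.exists_d_eq_zero _ ?_
    refine (h0 _).trans ?_
    change f.toLin (F.aug.toLin _) = 0
    exact (congrArg _ (F.aug_d x)).trans (map_zero _)⟩ (fun n φ => next n φ) n
  refine ⟨⟨fun i => match i with
    | Int.ofNat n => (φ n).1
    | Int.negSucc n => 0, ?_, fun x => (h0 x).symm⟩⟩
  rintro i j rfl x
  match j with
  | Int.ofNat n => exact hnext n (φ n) x
  | Int.negSucc n =>
    have := F'.neg (Int.negSucc n) (Int.negSucc_lt_zero n)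
    exact Subsingleton.elim _ _

/-- A lift of the identity is homotopic to the identity. -/
theorem exists_homotopy (F : FreeRes M) (φ : F.Lift F (GHom.id M)) {i j l : ℤ} (hj : j + 1 = i)
    (hl : l + 1 = j) : ∃ (h : GHom (F.X j) (F.X i)) (h' : GHom (F.X l) (F.X j)), ∀ x,
      (φ.φ j).toLin x = x + (F.d i j).toLin (h.toLin x) + h'.toLin ((F.d j l).toLin x) := by
  rcases lt_or_ge j 0 with h0 | h0
  · have := F.neg j h0
    exact ⟨0, 0, fun x => Subsingleton.elim _ _⟩
  induction j, h0 using Int.leInduction generalizing i l with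
  | base =>
    subst hj
    obtain ⟨h, hh⟩ := (F.finiteFree 0).exists_lift (F.finiteFree 1).isGraded
      (F.finiteFree 0).isGraded (φ.φ 0 - GHom.id _) (F.d 1 0) (fun x => F.exists_d_eq_zero _ (by
        change F.aug.toLin ((φ.φ 0).toLin x - x) = 0
        rw [map_sub, ← φ.comm_aug, sub_eq_zero]
        rfl))
    refine ⟨h, 0, fun x => ?_⟩
    have := hh x
    change (F.d 1 0).toLin (h.toLin x) = (φ.φ 0).toLin x - x at this
    change (φ.φ 0).toLin x = x + (F.d 1 0).toLin (h.toLin x) + 0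
    rw [this]
    abel
  | succ l hl0 ih =>
    obtain rfl := add_right_cancel hl
    subst hj
    obtain ⟨h, h', hh⟩ := ih rfl (sub_add_cancel _ 1)
    obtain ⟨h₁, hh₁⟩ := (F.finiteFree _).exists_lift
      (F.finiteFree (l + 1 + 1)).isGraded (F.finiteFree (l + 1)).isGraded
      (φ.φ _ - GHom.id _ - h.comp (F.d (l + 1) l)) (F.d (l + 1 + 1) (l + 1))
      (fun x => F.exists_d_eq (l := l) rfl rfl (by omega) _ (by
        change (F.d (l + 1) l).toLin ((φ.φ _).toLin x - x -
          h.toLin ((F.d (l + 1) l).toLin x)) = 0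
        have h1 := hh ((F.d (l + 1) l).toLin x)
        rw [F.d_d rfl (sub_add_cancel _ 1), map_zero, add_zero, φ.comm _ _ rfl] at h1
        rw [map_sub, map_sub, h1]
        abel))
    refine ⟨h₁, h, fun x => ?_⟩
    have := hh₁ x
    change (F.d (l + 1 + 1) (l + 1)).toLin (h₁.toLin x) = (φ.φ _).toLin x - x -
      h.toLin ((F.d (l + 1) l).toLin x) at this
    rw [this]
    abel

/-- Composition of chain maps that lift the identity. -/
def Lift.comp {F G H : FreeRes M} (ψ : G.Lift H (GHom.id M)) (φ : F.Lift G (GHom.id M)) :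
    F.Lift H (GHom.id M) where
  φ i := (ψ.φ i).comp (φ.φ i)
  comm i j h x := by
    change (ψ.φ j).toLin ((φ.φ j).toLin _) = _
    rw [φ.comm i j h, ψ.comm i j h]
    rfl
  comm_aug x := (φ.comm_aug x).trans (ψ.comm_aug _)

theorem isGraded_ext (F : FreeRes M) (j : ℤ) {N : GMod K w} (hN : N.IsGraded) :
    (F.ext j N).IsGraded :=
  isGraded_homology _ _ (isGraded_homMod (F.finiteFree _) hN) (isGraded_homMod (F.finiteFree _) hN)
    (isGraded_homMod (F.finiteFree _) hN)

/-- The map on `Ext` induced by a chain map. -/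
def Lift.extMap {F G : FreeRes M} (φ : F.Lift G (GHom.id M)) (j : ℤ) (N : GMod K w) :
    GHom (G.ext j N) (F.ext j N) :=
  (homModMap (φ.φ j) N).subquotientMap
    (fun u (hu : homFun u ∘ₗ (G.d (j + 1) j).toLin = 0) => LinearMap.ext fun x => by
      change homFun u ((φ.φ j).toLin ((F.d (j + 1) j).toLin x)) = 0
      rw [φ.comm _ _ rfl]
      exact DFunLike.congr_fun hu _)
    (by
      rintro _ - ⟨u, rfl⟩
      refine ⟨homFun u ∘ₗ (φ.φ (j - 1)).toLin, LinearMap.ext fun x => ?_⟩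
      exact congrArg (homFun u) (φ.comm j (j - 1) (by omega) x))

/-- A lift of the identity induces the identity on `Ext`. -/
theorem Lift.extMap_extMap {F G : FreeRes M} (φ : F.Lift G (GHom.id M))
    (ψ : G.Lift F (GHom.id M)) (j : ℤ) (N : GMod K w) (x : F.ext j N) :
    (φ.extMap j N).toLin ((ψ.extMap j N).toLin x) = x := by
  obtain ⟨u, rfl⟩ := GMod.sqMk_surjective _ _ x
  obtain ⟨u, hu⟩ := u
  obtain ⟨h, h', hh⟩ := F.exists_homotopy (ψ.comp φ) (i := j + 1) (j := j) (l := j - 1) rfl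
    (by omega)
  refine sub_eq_zero.1 ?_
  refine GMod.sqMk_eq_zero.2 ⟨homFun u ∘ₗ h'.toLin, LinearMap.ext fun x => ?_⟩
  change homFun u (h'.toLin ((F.d j (j - 1)).toLin x)) =
    homFun u (((ψ.comp φ).φ j).toLin x) - homFun u x
  have hu' : ∀ x, homFun u ((F.d (j + 1) j).toLin x) = 0 :=
    fun x => DFunLike.congr_fun (f := homFun u ∘ₗ (F.d (j + 1) j).toLin) (g := 0) hu x
  rw [hh, map_add, map_add, hu', add_zero, add_sub_cancel_left]

/-- `Ext` does not depend on the resolution. -/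
theorem exists_extIso (hM : M.IsGraded) (F G : FreeRes M) (j : ℤ) {N : GMod K w}
    (hN : N.IsGraded) : Nonempty (GIso (F.ext j N) (G.ext j N)) := by
  obtain ⟨φ⟩ := exists_lift hM F G (GHom.id M)
  obtain ⟨ψ⟩ := exists_lift hM G F (GHom.id M)
  exact ⟨GIso.ofBijective (F.isGraded_ext j hN) (G.isGraded_ext j hN) (ψ.extMap j N)
    ⟨Function.LeftInverse.injective (g := (φ.extMap j N).toLin) (φ.extMap_extMap ψ j N),
      Function.RightInverse.surjective (g := (φ.extMap j N).toLin) (ψ.extMap_extMap φ j N)⟩⟩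

end FreeRes

/-- Isomorphic modules have isomorphic local cohomology. -/
theorem exists_locCohIso {r : ℕ} (t : Fin r → ι) (i : ℤ) {A B : GMod K w} (hA : A.IsGraded)
    (hB : B.IsGraded) (e : GIso A B) : Nonempty (GIso (locCoh t i A) (locCoh t i B)) := by
  have h1 := locCohMap_congr t i (f := e.hom) (g := e.symm.hom) (f' := GHom.id A) (g' := GHom.id A)
    e.toEquiv.symm_apply_apply
  have h2 := locCohMap_congr t i (f := e.symm.hom) (g := e.hom) (f' := GHom.id B) (g' := GHom.id B)
    e.toEquiv.apply_symm_apply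
  have hid : ∀ {A : GMod K w} (x : locCoh t i A), (locCohMap t i (GHom.id A)).toLin x = x := by
    intro A x
    obtain ⟨z, rfl⟩ := GMod.sqMk_surjective _ _ x
    exact congrArg (Submodule.Quotient.mk) (Subtype.ext (cechObjMap_id t i z.1))
  exact ⟨GIso.ofBijective (isGraded_locCoh t hA i) (isGraded_locCoh t hB i) (locCohMap t i e.hom)
    ⟨Function.LeftInverse.injective (g := (locCohMap t i e.symm.hom).toLin) fun x => by
        rw [h1, hid, hid],
      Function.RightInverse.surjective (g := (locCohMap t i e.symm.hom).toLin) fun x => by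
        rw [h2, hid, hid]⟩⟩

/-! ### The residue pairing -/

section Residue

open Laurent

variable {r s : ℕ} (t : Fin r → ι) (t' : Fin s → ι) {N : Type u} [AddCommGroup N]
  [Module (MvPolynomial ι K) N]

/-- The top term of the Čech complex is a single localization. -/
def cechTop : CechObj K t N r →ₗ[MvPolynomial ι K] CechLoc K t N Finset.univ :=
  LinearMap.proj (⟨Finset.univ, by simp⟩ : {I : Finset (Fin r) // (I.card : ℤ) = r})

/-- The cochain of top degree with a given component. -/
def cechOfTop (z : CechLoc K t N Finset.univ) : CechObj K t N r := fun I =>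
  cechRes t N (fun k _ => by
    have h := (Finset.card_eq_iff_eq_univ I.1).1 (by rw [Fintype.card_fin]; exact_mod_cast I.2)
    rw [h]
    exact Finset.mem_univ k) z

theorem cechRes_refl {I : Finset (Fin r)} (h : I ⊆ I) (z : CechLoc K t N I) :
    cechRes t N h z = z := by
  induction z using LocalizedModule.induction_on with
  | h y s => rw [cechRes_mk]

@[simp] theorem cechTop_cechOfTop (z : CechLoc K t N Finset.univ) :
    cechTop t (cechOfTop t z) = z :=
  cechRes_refl t (Finset.Subset.refl _) z

theorem cechTop_injective : Function.Injective (cechTop t : CechObj K t N r → _) := by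
  intro x y h
  funext I
  obtain ⟨I, hI⟩ := I
  obtain rfl : I = Finset.univ :=
    (Finset.card_eq_iff_eq_univ I).1 (by rw [Fintype.card_fin]; exact_mod_cast hI)
  exact h

theorem mem_ker_cechD_top (x : CechObj K t N r) : cechD t N r (r + 1) x = 0 := by
  have := subsingleton_cechObj_of_gt (K := K) (N := N) t (lt_add_one (r : ℤ))
  exact Subsingleton.elim _ _

theorem coef_cechD_top (c : N →ₗ[MvPolynomial ι K] MvPolynomial ι K) {p : ℤ}
    (ht : Function.Injective t) (x : CechObj K t N p) {a : ι →₀ ℤ} (ha : ∀ k, a (t k) < 0) :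
    coef a (lauOf t c Finset.univ (cechTop t (cechD t N p r x))) = 0 := by
  by_cases h : p + 1 = r
  · have hc : ((Finset.univ : Finset (Fin r)).card : ℤ) = r := by simp
    refine (cechCoef_of t c a _ hc).symm.trans ((cechCoef_cechD t c a h x hc).trans ?_)
    refine Finset.sum_eq_zero fun k _ => ?_
    rw [cechCoef_eq_zero t c x (i := t k) (fun l hl h => Finset.ne_of_mem_erase hl (ht h)) (ha k),
      smul_zero]
  · have h0 : cechD t N p r x = 0 := by rw [cechD, dif_neg h]; rfl
    rw [h0, map_zero, map_zero, map_zero]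

/-- A cochain of top degree without terms in which all variables have negative exponents is a
coboundary. -/
theorem mem_range_cechD_top {k : ℕ} (b : Module.Basis (Fin k) (MvPolynomial ι K) N)
    (x : CechObj K t N r) (hx : ∀ j a, (∀ l, a (t l) < 0) →
      coef a (lauOf t (b.coord j) Finset.univ (cechTop t x)) = 0) :
    x ∈ LinearMap.range (cechD t N (r - 1) r) := by
  refine mem_range_cechD t b (sub_add_cancel _ 1) rfl x (mem_ker_cechD_top t x) fun I hI j a ha => ?_
  obtain rfl : I = Finset.univ :=
    (Finset.card_eq_iff_eq_univ I).1 (by rw [Fintype.card_fin]; exact_mod_cast hI)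
  exact (cechCoef_of t _ a x hI).trans (hx j a ha)

/-- The extension of functionals to a localization, as a linear map in the functional. -/
def lauOfHom (J : Finset (Fin r)) : (N →ₗ[MvPolynomial ι K] MvPolynomial ι K) →ₗ[MvPolynomial ι K]
    CechLoc K t N J →ₗ[MvPolynomial ι K] Laurent K ι where
  toFun φ := lauOf t φ J
  map_add' φ ψ := LinearMap.ext fun z => by
    induction z using LocalizedModule.induction_on with
    | h y s =>
      obtain ⟨e, he, -⟩ := exists_monomial_of_mem_cechMonoid t s.2
      rw [LinearMap.add_apply, lauOf_mk t _ J y s he, lauOf_mk t _ J y s he, lauOf_mk t _ J y s he,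
        LinearMap.add_apply, map_add, mul_add]
  map_smul' f φ := LinearMap.ext fun z => by
    induction z using LocalizedModule.induction_on with
    | h y s =>
      obtain ⟨e, he, -⟩ := exists_monomial_of_mem_cechMonoid t s.2
      rw [RingHom.id_apply, LinearMap.smul_apply, lauOf_mk t _ J y s he, lauOf_mk t _ J y s he,
        LinearMap.smul_apply, smul_eq_mul, map_mul, smul_laurent, mul_left_comm]

/-- The evaluation pairing between `Hom(N, S)` and `N`, extended to localizations. -/
def locPair (I : Finset (Fin s)) (J : Finset (Fin r)) :
    CechLoc K t' (N →ₗ[MvPolynomial ι K] MvPolynomial ι K) I →ₗ[MvPolynomial ι K]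
      CechLoc K t N J →ₗ[MvPolynomial ι K] Laurent K ι :=
  lauLift t' (lauOfHom t J) I

theorem locPair_mk (I : Finset (Fin s)) (J : Finset (Fin r))
    (φ : N →ₗ[MvPolynomial ι K] MvPolynomial ι K) (d : cechMonoid K t' I) {e : ι →₀ ℕ}
    (he : (d : MvPolynomial ι K) = monomial e 1) (z : CechLoc K t N J) :
    locPair t t' I J (LocalizedModule.mk φ d) z = mono (-expo e) * lauOf t φ J z := by
  rw [locPair, lauLift_mk t' _ I φ d he]
  rfl

/-- Evaluation at an element. -/
def evalAt (y : N) : (N →ₗ[MvPolynomial ι K] MvPolynomial ι K) →ₗ[MvPolynomial ι K]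
    MvPolynomial ι K := LinearMap.applyₗ y

theorem locPair_mk_right (I : Finset (Fin s)) (J : Finset (Fin r)) (y : N) (d : cechMonoid K t J)
    {e : ι →₀ ℕ} (he : (d : MvPolynomial ι K) = monomial e 1)
    (x : CechLoc K t' (N →ₗ[MvPolynomial ι K] MvPolynomial ι K) I) :
    locPair t t' I J x (LocalizedModule.mk y d) = mono (-expo e) * lauOf t' (evalAt y) I x := by
  induction x using LocalizedModule.induction_on with
  | h φ d' =>
    obtain ⟨e', he', -⟩ := exists_monomial_of_mem_cechMonoid t' d'.2
    rw [locPair_mk t t' I J φ d' he', lauOf_mk t φ J y d he, lauOf_mk t' _ I φ d' he',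
      mul_left_comm]
    rfl

theorem locPair_lauMono (I : Finset (Fin s)) (J : Finset (Fin r)) (y : N) (a : ι →₀ ℤ)
    (ha : ∀ i, a i < 0 → ∃ k ∈ J, t k = i)
    (x : CechLoc K t' (N →ₗ[MvPolynomial ι K] MvPolynomial ι K) I) :
    locPair t t' I J x (lauMono t J y a ha) = mono a * lauOf t' (evalAt y) I x := by
  induction x using LocalizedModule.induction_on with
  | h φ d' =>
    obtain ⟨e', he', -⟩ := exists_monomial_of_mem_cechMonoid t' d'.2
    rw [locPair_mk t t' I J φ d' he', lauOf_lauMono, lauOf_mk t' _ I φ d' he', mul_left_comm]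
    rfl

theorem locPair_cechLocMap {N' : Type u} [AddCommGroup N'] [Module (MvPolynomial ι K) N']
    (f : N →ₗ[MvPolynomial ι K] N') (I : Finset (Fin s)) (J : Finset (Fin r))
    (x : CechLoc K t' (N' →ₗ[MvPolynomial ι K] MvPolynomial ι K) I) (z : CechLoc K t N J) :
    locPair t t' I J (cechLocMap t' (LinearMap.lcomp (MvPolynomial ι K) (MvPolynomial ι K) f) I x) z =
      locPair t t' I J x (cechLocMap t f J z) := by
  induction x using LocalizedModule.induction_on with
  | h φ d' =>
    obtain ⟨e', he', -⟩ := exists_monomial_of_mem_cechMonoid t' d'.2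
    rw [cechLocMap_mk, locPair_mk t t' I J _ d' he', locPair_mk t t' I J _ d' he', lauOf,
      lauOf, lauLift_cechLocMap]
    rfl

end Residue

/-! ### Duality between the top local cohomology modules -/

section Duality

open Laurent

/-- The functional on a subquotient induced by a functional that kills the denominator. -/
def GMod.sqFunctional (M : GMod K w) (Z W : Submodule (MvPolynomial ι K) M) (f : M →ₗ[K] K)
    (h : ∀ x ∈ W, f x = 0) : FullDual (M.subquotient Z W) :=
  (((W.submoduleOf Z).restrictScalars K).liftQ (f ∘ₗ Z.subtype.restrictScalars K)
    fun _ hx => h _ hx) ∘ₗ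
    (Submodule.Quotient.restrictScalarsEquiv K (W.submoduleOf Z)).symm.toLinearMap

theorem GMod.fullDual_ext {M : GMod K w} {Z W : Submodule (MvPolynomial ι K) M}
    {φ ψ : FullDual (M.subquotient Z W)} (h : ∀ x, φ.ev (M.sqMk Z W x) = ψ.ev (M.sqMk Z W x)) :
    φ = ψ := LinearMap.ext fun x => by
  obtain ⟨z, rfl⟩ := GMod.sqMk_surjective _ _ x
  exact h z

variable {m n : ℕ} {w : Fin m ⊕ Fin n → Γ}

variable (m n) in
/-- The exponent `(-1, …, -1)`. -/
def negOnes : (Fin m ⊕ Fin n) →₀ ℤ := Finsupp.equivFunOnFinite.symm fun _ => -1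

@[simp] theorem negOnes_apply (i : Fin m ⊕ Fin n) : negOnes m n i = -1 := rfl

theorem weight_negOnes : Finsupp.weight w (negOnes m n) = -∑ k, w k := by
  rw [Finsupp.weight_apply, Finsupp.sum_fintype _ _ (by simp)]
  simp

section MonoCochain

variable {N : Type u} [AddCommGroup N] [Module (MvPolynomial (Fin m ⊕ Fin n) K) N]

theorem admissible_inl (c : (Fin m ⊕ Fin n) →₀ ℤ) (hc : ∀ k, 0 ≤ c (Sum.inr k)) (i : Fin m ⊕ Fin n)
    (hi : c i < 0) : ∃ k ∈ (Finset.univ : Finset (Fin m)), Sum.inl k = i := by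
  rcases i with k | k
  · exact ⟨k, Finset.mem_univ k, rfl⟩
  · exact absurd hi (not_lt.2 (hc k))

/-- The cochain of top degree given by the multiple of an element by a Laurent monomial. -/
def monoCochain (y : N) (c : (Fin m ⊕ Fin n) →₀ ℤ) (hc : ∀ k, 0 ≤ c (Sum.inr k)) :
    CechObj K (Sum.inl : Fin m → Fin m ⊕ Fin n) N m :=
  cechOfTop Sum.inl (lauMono Sum.inl Finset.univ y c (admissible_inl c hc))

theorem lauOf_monoCochain (φ : N →ₗ[MvPolynomial (Fin m ⊕ Fin n) K] MvPolynomial (Fin m ⊕ Fin n) K)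
    (y : N) (c : (Fin m ⊕ Fin n) →₀ ℤ) (hc : ∀ k, 0 ≤ c (Sum.inr k)) :
    lauOf Sum.inl φ Finset.univ (cechTop Sum.inl (monoCochain y c hc)) =
      mono c * toLaurent K _ (φ y) := by
  rw [monoCochain, cechTop_cechOfTop, lauOf_lauMono]

theorem coord_dualBasis {k : ℕ} (b : Module.Basis (Fin k) (MvPolynomial (Fin m ⊕ Fin n) K) N)
    (j : Fin k) : b.dualBasis.coord j = evalAt (b j) := b.dualBasis.ext fun i => by
  rw [Module.Basis.coord_apply, Module.Basis.repr_self]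
  change _ = b.dualBasis i (b j)
  rw [Module.Basis.dualBasis_apply_self, Finsupp.single_apply]
  exact if_congr eq_comm rfl rfl

end MonoCochain

section Form

variable (N : Type u) [AddCommGroup N] [Module K N] [Module (MvPolynomial (Fin m ⊕ Fin n) K) N]
  [IsScalarTower K (MvPolynomial (Fin m ⊕ Fin n) K) N]

/-- The residue pairing: the coefficient at `(-1, …, -1)` of the evaluation pairing. -/
def resForm (a : CechObj K (Sum.inr : Fin n → Fin m ⊕ Fin n)
    (N →ₗ[MvPolynomial (Fin m ⊕ Fin n) K] MvPolynomial (Fin m ⊕ Fin n) K) n) :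
    CechObj K (Sum.inl : Fin m → Fin m ⊕ Fin n) N m →ₗ[K] K :=
  coef (negOnes m n) ∘ₗ (locPair Sum.inl Sum.inr Finset.univ Finset.univ
    (cechTop Sum.inr a) ∘ₗ cechTop Sum.inl).restrictScalars K

variable {N} (a a' : CechObj K (Sum.inr : Fin n → Fin m ⊕ Fin n)
    (N →ₗ[MvPolynomial (Fin m ⊕ Fin n) K] MvPolynomial (Fin m ⊕ Fin n) K) n)
  (z : CechObj K (Sum.inl : Fin m → Fin m ⊕ Fin n) N m)

theorem resForm_apply : resForm N a z = coef (negOnes m n) (locPair Sum.inl Sum.inr Finset.univ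
    Finset.univ (cechTop Sum.inr a) (cechTop Sum.inl z)) := rfl

theorem resForm_add : resForm N (a + a') z = resForm N a z + resForm N a' z := by
  rw [resForm_apply, resForm_apply, resForm_apply, map_add, map_add, LinearMap.add_apply, map_add]

theorem resForm_smul (p : MvPolynomial (Fin m ⊕ Fin n) K) :
    resForm N (p • a) z = resForm N a (p • z) := by
  rw [resForm_apply, resForm_apply, map_smul, map_smul, map_smul, map_smul, LinearMap.smul_apply]

theorem expo_apply_eq_zero {α : Type*} {t : α → ι} {I : Finset α} {e : ι →₀ ℕ}
    (he : ∀ i, e i ≠ 0 → ∃ k ∈ I, t k = i) {i : ι} (hi : ∀ k, t k ≠ i) : expo e i = 0 := by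
  have h0 : e i = 0 := by
    by_contra h
    obtain ⟨l, -, hl⟩ := he _ h
    exact hi l hl
  rw [expo_apply, h0, Nat.cast_zero]

theorem resForm_cechD {p : ℤ} (z : CechObj K (Sum.inl : Fin m → Fin m ⊕ Fin n) N p) :
    resForm N a (cechD Sum.inl N p m z) = 0 := by
  rw [resForm_apply]
  induction cechTop Sum.inr a using LocalizedModule.induction_on with
  | h φ d =>
    obtain ⟨e, he, he'⟩ := exists_monomial_of_mem_cechMonoid _ d.2
    rw [locPair_mk _ _ _ _ φ d he, coef_mono_mul, coef_cechD_top _ _ Sum.inl_injective]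
    intro k
    simp [expo_apply_eq_zero he' (i := Sum.inl k) fun _ => Sum.inr_ne_inl]

theorem resForm_cechD_left {p : ℤ} (a : CechObj K (Sum.inr : Fin n → Fin m ⊕ Fin n)
      (N →ₗ[MvPolynomial (Fin m ⊕ Fin n) K] MvPolynomial (Fin m ⊕ Fin n) K) p) :
    resForm N (cechD Sum.inr _ p n a) z = 0 := by
  rw [resForm_apply]
  induction cechTop Sum.inl z using LocalizedModule.induction_on with
  | h y d =>
    obtain ⟨e, he, he'⟩ := exists_monomial_of_mem_cechMonoid _ d.2
    rw [locPair_mk_right _ _ _ _ y d he, coef_mono_mul, coef_cechD_top _ _ Sum.inr_injective]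
    intro k
    simp [expo_apply_eq_zero he' (i := Sum.inr k) fun _ => Sum.inl_ne_inr]

theorem resForm_cechObjMap {N' : Type u} [AddCommGroup N'] [Module K N']
    [Module (MvPolynomial (Fin m ⊕ Fin n) K) N'] [IsScalarTower K (MvPolynomial (Fin m ⊕ Fin n) K) N']
    (f : N →ₗ[MvPolynomial (Fin m ⊕ Fin n) K] N') (a : CechObj K (Sum.inr : Fin n → Fin m ⊕ Fin n)
      (N' →ₗ[MvPolynomial (Fin m ⊕ Fin n) K] MvPolynomial (Fin m ⊕ Fin n) K) n) :
    resForm N (cechObjMap Sum.inr (LinearMap.lcomp _ _ f) n a) z =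
      resForm N' a (cechObjMap Sum.inl f m z) :=
  congrArg (coef (negOnes m n)) (locPair_cechLocMap _ _ f _ _ _ _)

theorem resForm_monoCochain (y : N) (c : (Fin m ⊕ Fin n) →₀ ℤ) (hc : ∀ k, 0 ≤ c (Sum.inr k)) :
    resForm N a (monoCochain y c hc) =
      coef (negOnes m n - c) (lauOf Sum.inr (evalAt y) Finset.univ (cechTop Sum.inr a)) := by
  rw [resForm_apply, monoCochain, cechTop_cechOfTop, locPair_lauMono, coef_mono_mul]

/-- The left kernel of the residue pairing consists of the coboundaries. -/
theorem mem_range_of_resForm_eq_zero {k : ℕ}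
    (b : Module.Basis (Fin k) (MvPolynomial (Fin m ⊕ Fin n) K) N) (h : ∀ z, resForm N a z = 0) :
    a ∈ LinearMap.range (cechD Sum.inr
      (N →ₗ[MvPolynomial (Fin m ⊕ Fin n) K] MvPolynomial (Fin m ⊕ Fin n) K) (n - 1) n) := by
  refine mem_range_cechD_top Sum.inr b.dualBasis a fun j c hc => ?_
  have h1 := resForm_monoCochain a (b j) (negOnes m n - c) (fun k => by
    have := hc k
    rw [Finsupp.sub_apply, negOnes_apply]
    omega)
  rw [h, sub_sub_cancel] at h1
  rw [coord_dualBasis]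
  exact h1.symm

/-- Functionals on the cochains of top degree are determined by their values on Laurent
monomials. -/
theorem functional_ext {k : ℕ} (b : Module.Basis (Fin k) (MvPolynomial (Fin m ⊕ Fin n) K) N)
    {f g : CechObj K (Sum.inl : Fin m → Fin m ⊕ Fin n) N m →ₗ[K] K}
    (h : ∀ j c hc, f (monoCochain (b j) c hc) = g (monoCochain (b j) c hc)) : f = g := by
  refine LinearMap.ext fun z => ?_
  have key : ∀ x ∈ monoSums (K := K) (Sum.inl : Fin m → Fin m ⊕ Fin n) b Finset.univ,
      f (cechOfTop Sum.inl x) = g (cechOfTop Sum.inl x) := by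
    intro x hx
    induction hx using AddSubmonoid.closure_induction with
    | mem x hx =>
      obtain ⟨e, j, c, hc, rfl⟩ := hx
      have hc' : ∀ k, 0 ≤ c (Sum.inr k) := fun k => by
        by_contra hk
        obtain ⟨l, -, hl⟩ := hc _ (not_le.1 hk)
        exact Sum.inl_ne_inr hl
      have h1 : (cechOfTop Sum.inl ((C e : MvPolynomial (Fin m ⊕ Fin n) K) •
          lauMono Sum.inl Finset.univ (b j) c hc) : CechObj K (Sum.inl : Fin m → Fin m ⊕ Fin n) N m) =
          e • monoCochain (b j) c hc' := by
        refine cechTop_injective _ ?_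
        rw [cechTop_cechOfTop, ← algebraMap_smul (MvPolynomial (Fin m ⊕ Fin n) K) e, map_smul,
          monoCochain, cechTop_cechOfTop]
        rfl
      rw [h1, map_smul, map_smul, h]
    | zero =>
      have h0 : (cechOfTop Sum.inl 0 : CechObj K (Sum.inl : Fin m → Fin m ⊕ Fin n) N m) = 0 :=
        cechTop_injective _ (by rw [cechTop_cechOfTop, map_zero])
      rw [h0, map_zero, map_zero]
    | add x y _ _ hx hy =>
      have h0 : (cechOfTop Sum.inl (x + y) : CechObj K (Sum.inl : Fin m → Fin m ⊕ Fin n) N m) =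
          cechOfTop Sum.inl x + cechOfTop Sum.inl y :=
        cechTop_injective _ (by simp only [cechTop_cechOfTop, map_add])
      rw [h0, map_add, map_add, hx, hy]
  have hz : z = cechOfTop Sum.inl (cechTop Sum.inl z) :=
    cechTop_injective _ (cechTop_cechOfTop _ _).symm
  rw [hz]
  exact key _ (mem_monoSums _ b _)

end Form

end Duality

section Duality

open Laurent

theorem weight_eq_of_coef_toLaurent_ne_zero {p : MvPolynomial ι K} {δ : Γ}
    (hp : p ∈ weightedHomogeneousSubmodule K w δ) {a : ι →₀ ℤ} (ha : coef a (toLaurent K ι p) ≠ 0) :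
    Finsupp.weight w a = δ := by
  by_cases h : ∀ i, 0 ≤ a i
  · obtain ⟨e, rfl⟩ := exists_expo_eq h
    rw [coef_toLaurent] at ha
    rw [weight_expo]
    exact hp ha
  · push Not at h
    obtain ⟨i, hi⟩ := h
    exact absurd (coef_toLaurent_eq_zero hi p) ha

theorem weight_eq_of_monomial_mem [Nontrivial K] {e : ι →₀ ℕ} {δ : Γ}
    (h : monomial e (1 : K) ∈ weightedHomogeneousSubmodule K w δ) : Finsupp.weight w e = δ := by
  classical
  exact h (by rw [coeff_monomial, if_pos rfl]; exact one_ne_zero)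

variable {m n : ℕ} {w : Fin m ⊕ Fin n → Γ}

/-- The residue pairing is homogeneous. -/
theorem resForm_eq_zero_of_mem_piece {A : GMod K w} (hA : A.IsFiniteFree) {γ δ : Γ} (h : δ ≠ -γ)
    {a : CechObj K (Sum.inr : Fin n → Fin m ⊕ Fin n) (homMod A (canonicalMod K w)) n}
    (ha : a ∈ (cechMod Sum.inr (homMod A (canonicalMod K w)) n).piece γ)
    {z : CechObj K (Sum.inl : Fin m → Fin m ⊕ Fin n) A m} (hz : z ∈ (cechMod Sum.inl A m).piece δ) :
    resForm A a z = 0 := by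
  by_contra hne
  have : Nontrivial K := ⟨_, _, hne⟩
  have hω : (canonicalMod K w).IsGraded := isGraded_shiftS _
  obtain ⟨δ₁, d, φ, hd, hφ, hφd⟩ := mem_locMod_piece (isGraded_homMod hA hω)
    (ha ⟨Finset.univ, by simp⟩ trivial)
  obtain ⟨δ₂, s, y, hs, hy, hys⟩ := mem_locMod_piece hA.isGraded (hz ⟨Finset.univ, by simp⟩ trivial)
  obtain ⟨e₁, he₁, -⟩ := exists_monomial_of_mem_cechMonoid _ d.2
  obtain ⟨e₂, he₂, -⟩ := exists_monomial_of_mem_cechMonoid _ s.2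
  have hφy : homFun φ y ∈ weightedHomogeneousSubmodule K w (δ + δ₂ + (γ + δ₁) - ∑ k, w k) :=
    hφ _ _ hy
  have h1 : locPair (N := A) Sum.inl Sum.inr Finset.univ Finset.univ (cechTop Sum.inr a)
      (cechTop Sum.inl z) = mono (-expo e₁) * (mono (-expo e₂) * toLaurent K _ (homFun φ y)) := by
    have hz' : cechTop Sum.inl z = LocalizedModule.mk y s := hys
    rw [hz']
    refine (congrArg (fun x => locPair (N := A) Sum.inl Sum.inr Finset.univ Finset.univ x
      (LocalizedModule.mk y s)) (hφd : cechTop Sum.inr a = _)).trans ?_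
    exact (locPair_mk (N := A) _ _ _ _ φ d he₁ _).trans
      (congrArg _ (lauOf_mk _ (homFun φ) _ y s he₂))
  have h2 : coef (negOnes m n - -expo e₁ - -expo e₂) (toLaurent K _ (homFun φ y)) ≠ 0 := by
    rw [← coef_mono_mul, ← coef_mono_mul, ← h1]
    exact hne
  have h3 := weight_eq_of_coef_toLaurent_ne_zero hφy h2
  rw [he₁] at hd
  rw [he₂] at hs
  rw [map_sub, map_sub, map_neg, map_neg, weight_negOnes, weight_expo, weight_expo,
    weight_eq_of_monomial_mem hd, weight_eq_of_monomial_mem hs] at h3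
  refine h (eq_neg_of_add_eq_zero_left ?_)
  have h4 : δ + δ₂ + (γ + δ₁) - ∑ k, w k = (δ + γ) + (-∑ k, w k - -δ₁ - -δ₂) := by abel
  rw [h4] at h3
  exact left_eq_add.1 (h3.trans (add_comm _ _))

theorem monoCochain_mem_piece {A : GMod K w} (hA : A.IsGraded) {y : A} {γ : Γ} (hy : y ∈ A.piece γ)
    (c : (Fin m ⊕ Fin n) →₀ ℤ) (hc : ∀ k, 0 ≤ c (Sum.inr k)) :
    monoCochain y c hc ∈ (cechMod Sum.inl A m).piece (Finsupp.weight w c + γ) := by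
  intro I _
  refine cechRes_mem_piece _ hA _ ?_
  refine locMod_mk_mem_piece (isWeightedHomogeneous_monomial w _ 1 rfl)
    (hA.smul_mem _ _ _ _ (isWeightedHomogeneous_monomial w _ 1 rfl) hy) ?_
  have h := congrArg (Finsupp.weight w) (expo_sub_expo c)
  rw [map_sub, weight_expo, weight_expo] at h
  rw [← h]
  abel

/-- Sharpness means that only finitely many Laurent monomials contribute to each piece of the top
local cohomology. -/
theorem finite_exponents [Nontrivial K] (hsharp : IsSharp K w (Sum.inl : Fin m → Fin m ⊕ Fin n))
    (δ : Γ) : {c : (Fin m ⊕ Fin n) →₀ ℤ | (∀ k, c (Sum.inl k) < 0) ∧ (∀ k, 0 ≤ c (Sum.inr k)) ∧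
      Finsupp.weight w c = δ}.Finite := by
  obtain ⟨G, hG⟩ := hsharp m δ
  let L : CechObj K (Sum.inl : Fin m → Fin m ⊕ Fin n) (MvPolynomial (Fin m ⊕ Fin n) K) m
      →ₗ[MvPolynomial (Fin m ⊕ Fin n) K] Laurent K (Fin m ⊕ Fin n) :=
    lauOf Sum.inl (LinearMap.id : MvPolynomial (Fin m ⊕ Fin n) K →ₗ[MvPolynomial (Fin m ⊕ Fin n) K]
      MvPolynomial (Fin m ⊕ Fin n) K) Finset.univ ∘ₗ cechTop Sum.inl
  let Z := LinearMap.ker (cechD (K := K) (Sum.inl : Fin m → Fin m ⊕ Fin n)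
    (MvPolynomial (Fin m ⊕ Fin n) K) (m : ℤ) (m + 1))
  let q : Z →ₗ[MvPolynomial (Fin m ⊕ Fin n) K]
      locCoh (Sum.inl : Fin m → Fin m ⊕ Fin n) m (shiftS K w 0) :=
    GMod.sqMk (cechMod Sum.inl (shiftS K w 0) m) _ _
  have hq : Function.Surjective q := GMod.sqMk_surjective _ _
  choose rep hrep using hq
  -- All exponents that occur in representatives of a finite generating set of the piece.
  let D := ⋃ g ∈ G, {c | coef c (L (rep g).1) ≠ 0}
  have hD : D.Finite := Set.Finite.biUnion G.finite_toSet fun g _ => finite_support _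
  refine hD.subset fun c hc => ?_
  by_contra hcD
  obtain ⟨h1, h2, h3⟩ := hc
  have key : ∀ x ∈ Submodule.span K (G : Set (locCoh Sum.inl m (shiftS K w 0))),
      ∃ z : Z, q z = x ∧ ∀ c ∉ D, coef c (L z.1) = 0 := by
    intro x hx
    induction hx using Submodule.span_induction with
    | mem x hx =>
      refine ⟨rep x, hrep x, fun c hc => ?_⟩
      by_contra hne
      exact hc (Set.mem_biUnion hx hne)
    | zero => exact ⟨0, rfl, fun c _ => by rw [Submodule.coe_zero, map_zero, map_zero]⟩
    | add x y _ _ hx hy =>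
      obtain ⟨z, rfl, hz⟩ := hx
      obtain ⟨z', rfl, hz'⟩ := hy
      refine ⟨z + z', rfl, fun c hc => ?_⟩
      rw [Submodule.coe_add, map_add, map_add, hz c hc, hz' c hc, add_zero]
    | smul r x _ hx =>
      obtain ⟨z, rfl, hz⟩ := hx
      refine ⟨(C r : MvPolynomial (Fin m ⊕ Fin n) K) • z, ?_, fun c hc => ?_⟩
      · exact algebraMap_smul (MvPolynomial (Fin m ⊕ Fin n) K) r (q z)
      · have h0 := algebraMap_smul (MvPolynomial (Fin m ⊕ Fin n) K) r (L z.1)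
        rw [Submodule.coe_smul, map_smul]
        refine (congrArg (coef c) h0).trans ?_
        rw [map_smul, hz c hc, smul_zero]
  let z₀ : Z := ⟨monoCochain (K := K) (1 : MvPolynomial (Fin m ⊕ Fin n) K) c h2, mem_ker_cechD_top _ _⟩
  have hz₀ : q z₀ ∈ (locCoh (Sum.inl : Fin m → Fin m ⊕ Fin n) m (shiftS K w 0)).piece δ := by
    have h1 : (1 : MvPolynomial (Fin m ⊕ Fin n) K) ∈ (shiftS K w 0).piece 0 := by
      change IsWeightedHomogeneous w (1 : MvPolynomial (Fin m ⊕ Fin n) K) (0 - 0)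
      rw [sub_zero]
      exact isWeightedHomogeneous_one K w
    have := monoCochain_mem_piece (isGraded_shiftS (K := K) (w := w) 0) h1 c h2
    rw [add_zero, h3] at this
    exact GMod.sqMk_mem_piece this
  rw [← hG] at hz₀
  obtain ⟨z, hz, hz'⟩ := key _ hz₀
  have h4 : ((z₀ - z : Z) : CechObj K (Sum.inl : Fin m → Fin m ⊕ Fin n)
      (MvPolynomial (Fin m ⊕ Fin n) K) m) ∈ LinearMap.range (cechD (Sum.inl : Fin m → Fin m ⊕ Fin n)
        (MvPolynomial (Fin m ⊕ Fin n) K) (m - 1) m) :=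
    (GMod.sqMk_eq_zero (M := cechMod Sum.inl (shiftS K w 0) m)).1
      ((map_sub q z₀ z).trans (sub_eq_zero.2 hz.symm))
  obtain ⟨y, hy⟩ := h4
  have h5 := coef_cechD_top Sum.inl LinearMap.id Sum.inl_injective y h1
  rw [hy, Submodule.coe_sub, map_sub, map_sub, map_sub, lauOf_monoCochain] at h5
  have h6 : coef c (lauOf Sum.inl LinearMap.id Finset.univ (cechTop Sum.inl z.1)) = 0 := hz' c hcD
  rw [h6, LinearMap.id_apply, map_one, mul_one, coef_mono_same, sub_zero] at h5
  exact one_ne_zero h5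

/-- The functional on local cohomology given by the residue pairing. -/
def resFullDual (A : GMod K w) :
    CechObj K (Sum.inr : Fin n → Fin m ⊕ Fin n) (homMod A (canonicalMod K w)) n
      →ₗ[MvPolynomial (Fin m ⊕ Fin n) K]
        FullDual (locCoh (Sum.inl : Fin m → Fin m ⊕ Fin n) m A) where
  toFun a := GMod.sqFunctional (cechMod Sum.inl A m) _ _ (resForm A a) (by
    rintro _ ⟨y, rfl⟩
    exact resForm_cechD a y)
  map_add' a a' := GMod.fullDual_ext fun z => resForm_add (N := A) a a' z.1
  map_smul' p a := GMod.fullDual_ext fun z => resForm_smul (N := A) a z.1 p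

theorem resFullDual_mem_dualPiece {A : GMod K w} (hA : A.IsFiniteFree) {γ : Γ}
    {a : CechObj K (Sum.inr : Fin n → Fin m ⊕ Fin n) (homMod A (canonicalMod K w)) n}
    (ha : a ∈ (cechMod Sum.inr (homMod A (canonicalMod K w)) n).piece γ) :
    resFullDual A a ∈ dualPiece _ γ := by
  intro δ hδ x hx
  obtain ⟨z, hz, rfl⟩ := GMod.mem_piece_subquotient hx
  exact resForm_eq_zero_of_mem_piece hA hδ ha hz

theorem resFullDual_mem_dualSub {A : GMod K w} (hA : A.IsFiniteFree)
    (a : CechObj K (Sum.inr : Fin n → Fin m ⊕ Fin n) (homMod A (canonicalMod K w)) n) :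
    resFullDual A a ∈ dualSub _ := by
  have hω : (canonicalMod K w).IsGraded := isGraded_shiftS _
  refine (isGraded_cechMod Sum.inr (isGraded_homMod hA hω) n).induction
    (motive := fun a => resFullDual A a ∈ dualSub _) a ?_ ?_ ?_
  · exact fun γ a ha => Submodule.subset_span (Set.mem_iUnion.2 ⟨γ, resFullDual_mem_dualPiece hA ha⟩)
  · exact Set.mem_of_eq_of_mem (map_zero (resFullDual A)) (zero_mem _)
  · exact fun a a' h h' => Set.mem_of_eq_of_mem (map_add (resFullDual A) a a') (add_mem h h')

/-- The residue pairing as a map of graded modules into the graded dual. -/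
def resDual {A : GMod K w} (hA : A.IsFiniteFree) :
    GHom (cechMod (Sum.inr : Fin n → Fin m ⊕ Fin n) (homMod A (canonicalMod K w)) n)
      (dual (locCoh (Sum.inl : Fin m → Fin m ⊕ Fin n) m A)) where
  toLin := ((resFullDual A).codRestrict (dualSub _) (resFullDual_mem_dualSub hA) :
    _ →ₗ[MvPolynomial (Fin m ⊕ Fin n) K] dualSub _)
  map_piece _ _ ha := resFullDual_mem_dualPiece hA ha

/-- The left kernel of the residue pairing consists of the coboundaries, so the pairing embeds
`H^n_Q(Hom_S(A, ω))` into the graded dual of `H^m_P(A)`. -/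
theorem resDual_eq_zero_iff {A : GMod K w} (hA : A.IsFiniteFree)
    (a : CechObj K (Sum.inr : Fin n → Fin m ⊕ Fin n) (homMod A (canonicalMod K w)) n) :
    (resDual hA).toLin a = 0 ↔ a ∈ LinearMap.range (cechD Sum.inr
      (homMod A (canonicalMod K w)) (n - 1) n) := by
  obtain ⟨_, k, b, -⟩ := id hA
  constructor
  · intro h
    refine mem_range_of_resForm_eq_zero (N := A) a b fun z => ?_
    have h' : resFullDual A a = 0 := congrArg Subtype.val h
    exact DFunLike.congr_fun (F := _ →ₗ[K] K) h' (GMod.sqMk (cechMod Sum.inl A m) _ _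
      ⟨z, mem_ker_cechD_top _ z⟩)
  · rintro ⟨y, rfl⟩
    exact Subtype.ext (GMod.fullDual_ext fun z => resForm_cechD_left (N := A) z.1 y)

theorem resDual_natural {A B : GMod K w} (hA : A.IsFiniteFree) (hB : B.IsFiniteFree) (f : GHom A B)
    (a : CechObj K (Sum.inr : Fin n → Fin m ⊕ Fin n) (homMod B (canonicalMod K w)) n) :
    (resDual hA).toLin ((cechMap Sum.inr (homModMap f (canonicalMod K w)) n).toLin a) =
      (dualMap (locCohMap (Sum.inl : Fin m → Fin m ⊕ Fin n) m f)).toLin ((resDual hB).toLin a) :=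
  Subtype.ext (GMod.fullDual_ext fun z => resForm_cechObjMap (N := A) z.1 f.toLin a)

/-- The residue pairing represents every functional of the graded dual: by sharpness a homogeneous
functional has only finitely many nonzero values on Laurent monomials, and these are the
coefficients of an element representing it. -/
theorem resDual_surjective (hsharp : IsSharp K w (Sum.inl : Fin m → Fin m ⊕ Fin n)) {A : GMod K w}
    (hA : A.IsFiniteFree) : Function.Surjective (resDual hA).toLin := by
  classical
  have hle : dualSub (locCoh (Sum.inl : Fin m → Fin m ⊕ Fin n) m A) ≤
      LinearMap.range (resFullDual A) := by
    refine Submodule.span_le.2 (Set.iUnion_subset fun γ Ψ hΨ => ?_)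
    rcases subsingleton_or_nontrivial K with hK | hK
    · exact ⟨0, LinearMap.ext fun _ => Subsingleton.elim _ _⟩
    obtain ⟨hA', k, b, hb⟩ := hA
    choose δ hδ using hb
    -- `Ψ`, as a functional on cochains.
    let f : CechObj K (Sum.inl : Fin m → Fin m ⊕ Fin n) A m →ₗ[K] K :=
      { toFun := fun z => Ψ.ev (GMod.sqMk (cechMod Sum.inl A m) _ _ ⟨z, mem_ker_cechD_top _ z⟩)
        map_add' := fun z z' => map_add Ψ.ev
          (GMod.sqMk (cechMod Sum.inl A m) _ _ ⟨z, mem_ker_cechD_top _ z⟩)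
          (GMod.sqMk (cechMod Sum.inl A m) _ _ ⟨z', mem_ker_cechD_top _ z'⟩)
        map_smul' := fun c z => map_smul Ψ.ev c
          (GMod.sqMk (cechMod Sum.inl A m) _ _ ⟨z, mem_ker_cechD_top _ z⟩) }
    have hf0 : ∀ j c hc, f (monoCochain (b j) c hc) ≠ 0 → (∀ k, c (Sum.inl k) < 0) ∧
        Finsupp.weight w c = -γ - δ j := by
      intro j c hc hne
      constructor
      · intro k
        by_contra! hk
        refine hne ?_
        have hr : monoCochain (K := K) (b j) c hc ∈ LinearMap.range (cechD (Sum.inl : Fin m → Fin m ⊕ Fin n)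
            A (m - 1) m) := by
          refine mem_range_cechD_top Sum.inl b _ fun i a ha => ?_
          rw [lauOf_monoCochain, coef_mono_mul]
          refine coef_toLaurent_eq_zero (i := Sum.inl k) ?_ _
          rw [Finsupp.sub_apply]
          have := ha k
          omega
        exact (congrArg Ψ.ev ((GMod.sqMk_eq_zero (M := cechMod Sum.inl A m)
          (x := ⟨monoCochain (K := K) (b j) c hc, mem_ker_cechD_top _ _⟩)).2 hr)).trans (map_zero _)
      · by_contra hw
        refine hne (hΨ (Finsupp.weight w c + δ j) (fun h => hw (eq_sub_iff_add_eq.2 h)) _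
          (GMod.sqMk_mem_piece ?_))
        exact monoCochain_mem_piece hA' (hδ j) c hc
    -- The pairing with the monomial of exponent `c` reads off the coefficient at `(-1, …, -1) - c`, so
    -- these have to be the coefficients of the element representing `Ψ`.
    let g : Fin k → ((Fin m ⊕ Fin n) →₀ ℤ) → K := fun j c =>
      if hc : ∀ k, 0 ≤ (negOnes m n - c) (Sum.inr k) then f (monoCochain (b j) (negOnes m n - c) hc)
      else 0
    have hg : ∀ j c, g j c ≠ 0 → (∀ k, (negOnes m n - c) (Sum.inl k) < 0) ∧
        (∀ k, 0 ≤ (negOnes m n - c) (Sum.inr k)) ∧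
        Finsupp.weight w (negOnes m n - c) = -γ - δ j := by
      intro j c hne
      by_cases hc : ∀ k, 0 ≤ (negOnes m n - c) (Sum.inr k)
      · have h := hf0 j _ hc (fun h0 => hne ((dif_pos hc).trans h0))
        exact ⟨h.1, hc, h.2⟩
      · exact absurd (dif_neg hc) hne
    have hgfin : ∀ j, {c | g j c ≠ 0}.Finite := fun j =>
      ((finite_exponents hsharp (-γ - δ j)).image fun c => negOnes m n - c).subset fun c hc =>
        ⟨_, hg j c hc, sub_sub_cancel _ _⟩
    choose G hG using fun j => Laurent.exists_coef_eq (g j) (hgfin j)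
    obtain ⟨x, hx⟩ := exists_lauOf_eq (I := Finset.univ) (Sum.inr : Fin n → Fin m ⊕ Fin n)
      b.dualBasis G (by
        intro j c hc i hi
        rw [hG] at hc
        have h := (hg j c hc).1
        rcases i with k | k
        · have := h k
          rw [Finsupp.sub_apply, negOnes_apply] at this
          omega
        · exact ⟨k, Finset.mem_univ k, rfl⟩)
    refine ⟨cechOfTop Sum.inr x, GMod.fullDual_ext fun z => ?_⟩
    have hfx : resForm A (cechOfTop Sum.inr x) = f := by
      refine functional_ext b fun j c hc => ?_
      rw [resForm_monoCochain, cechTop_cechOfTop, ← coord_dualBasis, hx, hG]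
      have hcc : negOnes m n - (negOnes m n - c) = c := sub_sub_cancel _ _
      refine (dif_pos fun k => by rw [hcc]; exact hc k).trans ?_
      congr 2
    exact DFunLike.congr_fun hfx z.1
  rintro ⟨Ψ, hΨ⟩
  obtain ⟨a, ha⟩ := hle hΨ
  exact ⟨a, Subtype.ext ha⟩

end Duality

/-! ### The graded dual -/

section Dual

variable {A B C N : GMod K w}

theorem fullDual_ext_piece (hN : N.IsGraded) {φ ψ : FullDual N}
    (h : ∀ γ, ∀ x ∈ N.piece γ, φ.ev x = ψ.ev x) : φ = ψ := LinearMap.ext fun x => by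
  refine hN.induction (motive := fun x => φ.ev x = ψ.ev x) x h ?_ fun x y hx hy => ?_
  · rw [map_zero, map_zero]
  · rw [map_add, map_add, hx, hy]

theorem smul_mem_dualPiece (hN : N.IsGraded) {a γ : Γ} {s : MvPolynomial ι K} {φ : FullDual N}
    (hs : s ∈ weightedHomogeneousSubmodule K w a) (hφ : φ ∈ dualPiece N γ) :
    s • φ ∈ dualPiece N (a + γ) := fun δ hδ x hx =>
  hφ (a + δ) (fun h => hδ (by rw [neg_add_rev, ← h]; abel)) _
    (hN.smul_mem _ _ _ _ hs hx)

theorem dual_mem_iSup (hN : N.IsGraded) (φ : dual N) : φ ∈ ⨆ γ, (dual N).piece γ := by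
  obtain ⟨φ, hφ⟩ := φ
  induction hφ using Submodule.span_induction with
  | mem φ h =>
    obtain ⟨γ, hγ⟩ := Set.mem_iUnion.1 h
    exact Submodule.mem_iSup_of_mem (M := dual N) (p := (dual N).piece) γ hγ
  | zero => exact zero_mem _
  | add φ ψ _ _ h h' => exact add_mem h h'
  | smul s φ hφ h =>
    have key : ∀ φ : dual N, φ ∈ ⨆ γ, (dual N).piece γ → s • φ ∈ ⨆ γ, (dual N).piece γ := by
      induction s using MvPolynomial.induction_on' with
      | monomial e c =>
        intro φ hφ
        induction hφ using Submodule.iSup_induction' with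
        | mem γ φ h =>
          exact Submodule.mem_iSup_of_mem _
            (smul_mem_dualPiece hN (isWeightedHomogeneous_monomial w e c rfl) h)
        | zero => rw [smul_zero]; exact zero_mem _
        | add φ ψ _ _ h h' => rw [smul_add]; exact add_mem h h'
      | add s s' h h' =>
        intro φ hφ
        rw [add_smul]
        exact add_mem (h φ hφ) (h' φ hφ)
    exact key _ h

theorem isGraded_dual (hN : N.IsGraded) : (dual N).IsGraded := by
  refine GMod.IsGraded.of_separating (M := dual N) (N := N →ₗ[K] K)
    (fun γ => LinearMap.lcomp K K (hN.proj (-γ)) ∘ₗ (dualSub N).subtype.restrictScalars K)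
    ?_ ?_ (dual_mem_iSup hN) fun a γ s φ hs hφ => smul_mem_dualPiece hN hs hφ
  · intro γ φ hφ h
    refine Subtype.ext (fullDual_ext_piece hN fun δ x hx => ?_)
    by_cases hδ : δ = -γ
    · subst hδ
      have := DFunLike.congr_fun h x
      exact (congrArg φ.1.ev (hN.proj_of_mem hx).symm).trans this
    · exact hφ δ hδ x hx
  · intro γ δ h φ hφ
    exact LinearMap.ext fun x => hφ _ (fun h' => h (neg_injective h').symm) _ (hN.proj_mem _ _)

/-- Functionals in the graded dual vanish on almost all pieces. -/
theorem exists_finite_of_mem_dualSub (hN : N.IsGraded) (φ : dual N) :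
    ∃ s : Finset Γ, ∀ δ ∉ s, ∀ x ∈ N.piece δ, φ.1.ev x = 0 := by
  classical
  refine (isGraded_dual hN).induction (motive := fun φ : dual N => ∃ s : Finset Γ, ∀ δ ∉ s,
    ∀ x ∈ N.piece δ, φ.1.ev x = 0) φ ?_ ?_ ?_
  · exact fun γ φ hφ => ⟨{-γ}, fun δ hδ => hφ δ (by simpa using hδ)⟩
  · exact ⟨∅, fun _ _ _ _ => rfl⟩
  · rintro φ ψ ⟨s, hs⟩ ⟨s', hs'⟩
    refine ⟨s ∪ s', fun δ hδ x hx => ?_⟩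
    rw [Finset.mem_union, not_or] at hδ
    change φ.1.ev x + ψ.1.ev x = 0
    rw [hs δ hδ.1 x hx, hs' δ hδ.2 x hx, add_zero]

/-- Functionals that vanish on almost all pieces belong to the graded dual. -/
theorem mem_dualSub_of_finite (hN : N.IsGraded) (φ : FullDual N) (s : Finset Γ)
    (h : ∀ δ ∉ s, ∀ x ∈ N.piece δ, φ.ev x = 0) : φ ∈ dualSub N := by
  classical
  have hφ : φ = ∑ δ ∈ s, (φ.ev ∘ₗ hN.proj δ : FullDual N) := by
    refine fullDual_ext_piece hN fun γ x hx => ?_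
    refine Eq.trans ?_ (LinearMap.sum_apply s (fun δ => φ.ev ∘ₗ hN.proj δ) x).symm
    by_cases hγ : γ ∈ s
    · rw [Finset.sum_eq_single_of_mem γ hγ]
      · exact congrArg φ.ev (hN.proj_of_mem hx).symm
      · intro δ _ hne
        exact (congrArg φ.ev (hN.proj_of_mem_ne hx hne.symm)).trans (map_zero _)
    · rw [h γ hγ x hx]
      refine (Finset.sum_eq_zero fun δ hδ => ?_).symm
      exact (congrArg φ.ev (hN.proj_of_mem_ne hx fun h => hγ (h ▸ hδ))).trans (map_zero _)
  rw [hφ]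
  refine Submodule.sum_mem _ fun δ _ => Submodule.subset_span (Set.mem_iUnion.2 ⟨-δ, ?_⟩)
  intro ε hε x hx
  rw [neg_neg] at hε
  exact (congrArg φ.ev (hN.proj_of_mem_ne hx hε)).trans (map_zero _)

/-- Every functional agrees with one of the graded dual on finitely many pieces. -/
theorem exists_truncation (hN : N.IsGraded) (φ : N →ₗ[K] K) (s : Finset Γ) :
    ∃ ψ : dual N, (∀ δ ∈ s, ∀ x ∈ N.piece δ, ψ.1.ev x = φ x) ∧
      ∀ δ ∉ s, ∀ x ∈ N.piece δ, ψ.1.ev x = 0 := by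
  classical
  let ψ : FullDual N := ∑ δ ∈ s, (φ ∘ₗ hN.proj δ : N →ₗ[K] K)
  have h2 : ∀ δ ∉ s, ∀ x ∈ N.piece δ, ψ.ev x = 0 := by
    intro γ hγ x hx
    refine (LinearMap.sum_apply s (fun δ => φ ∘ₗ hN.proj δ) x).trans
      (Finset.sum_eq_zero fun δ hδ => ?_)
    exact (congrArg φ (hN.proj_of_mem_ne hx fun h => hγ (h ▸ hδ))).trans (map_zero _)
  refine ⟨⟨ψ, mem_dualSub_of_finite hN ψ s h2⟩, fun γ hγ x hx => ?_, h2⟩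
  refine (LinearMap.sum_apply s (fun δ => φ ∘ₗ hN.proj δ) x).trans ?_
  rw [Finset.sum_eq_single_of_mem γ hγ]
  · exact congrArg φ (hN.proj_of_mem hx)
  · intro δ _ hne
    exact (congrArg φ (hN.proj_of_mem_ne hx hne.symm)).trans (map_zero _)

theorem exists_extend_of_isField (hK : IsField K) {V : Type*} [AddCommGroup V] [Module K V]
    (W : Submodule K V) (f : W →ₗ[K] K) : ∃ g : V →ₗ[K] K, ∀ x : W, g x = f x := by
  let _ := hK.toField
  obtain ⟨g, hg⟩ := LinearMap.exists_extend (K := K) f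
  exact ⟨g, fun x => DFunLike.congr_fun hg x⟩

theorem exists_factor_of_isField (hK : IsField K) {V V' : Type*} [AddCommGroup V] [Module K V]
    [AddCommGroup V'] [Module K V'] (g : V →ₗ[K] V') (f : V →ₗ[K] K)
    (h : LinearMap.ker g ≤ LinearMap.ker f) : ∃ f' : V' →ₗ[K] K, ∀ x, f' (g x) = f x := by
  obtain ⟨f', hf'⟩ := exists_extend_of_isField hK (LinearMap.range g)
    ((LinearMap.ker g).liftQ f h ∘ₗ g.quotKerEquivRange.symm.toLinearMap)
  refine ⟨f', fun x => (hf' ⟨g x, x, rfl⟩).trans ?_⟩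
  have : g.quotKerEquivRange.symm ⟨g x, x, rfl⟩ = (LinearMap.ker g).mkQ x := by
    rw [LinearEquiv.symm_apply_eq]
    rfl
  change (LinearMap.ker g).liftQ f h (g.quotKerEquivRange.symm ⟨g x, x, rfl⟩) = f x
  rw [this]
  rfl

/-- A functional that kills the boundaries induces one on homology. -/
def dualHomologyMap (hA : A.IsGraded) (hB : B.IsGraded) (hC : C.IsGraded) (f : GHom A B)
    (g : GHom B C) :
    LinearMap.ker (dualMap f).toLin →ₗ[MvPolynomial ι K] dual (homology f.toLin g.toLin) where
  toFun φ := ⟨B.sqFunctional (LinearMap.ker g.toLin) (LinearMap.range f.toLin) φ.1.1.ev (by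
      rintro _ ⟨x, rfl⟩
      have h : (dualMap f).toLin φ.1 = 0 := φ.2
      exact DFunLike.congr_fun (F := A →ₗ[K] K) (congrArg (Subtype.val (p := (· ∈ dualSub A))) h) x),
    by
      obtain ⟨s, hs⟩ := exists_finite_of_mem_dualSub hB φ.1
      refine mem_dualSub_of_finite (isGraded_homology f g hA hB hC) _ s fun δ hδ x hx => ?_
      obtain ⟨z, hz, rfl⟩ := GMod.mem_piece_subquotient hx
      exact hs δ hδ _ hz⟩
  map_add' _ _ := Subtype.ext (GMod.fullDual_ext fun _ => rfl)
  map_smul' _ _ := Subtype.ext (GMod.fullDual_ext fun _ => rfl)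

/-- Over a field the graded dual is exact. Functionals are extended and factored as in the ungraded
case and then truncated to finitely many degrees. -/
theorem exists_dualHomologyIso (hK : IsField K) (hA : A.IsGraded) (hB : B.IsGraded)
    (hC : C.IsGraded) (f : GHom A B) (g : GHom B C) (hgf : ∀ x, g.toLin (f.toLin x) = 0) :
    Nonempty (GIso (homology (dualMap g).toLin (dualMap f).toLin)
      (dual (homology f.toLin g.toLin))) := by
  have hH := isGraded_homology f g hA hB hC
  have hA' := isGraded_dual hA
  have hB' := isGraded_dual hB
  have hC' := isGraded_dual hC
  refine ⟨subquotientIso hB' ((dualMap f).isHomogeneous_ker hB' hA')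
    ((dualMap g).isHomogeneous_range hC' hB') (isGraded_dual hH) (dualHomologyMap hA hB hC f g)
    (fun φ => ⟨fun h => ?_, ?_⟩) (fun Ψ => ?_) fun γ φ hφ δ hδ x hx => ?_⟩
  · have h0 : ∀ x ∈ LinearMap.ker g.toLin, φ.1.1.ev x = 0 := fun x hx =>
      DFunLike.congr_fun (F := _ →ₗ[K] K) (congrArg Subtype.val h)
        (B.sqMk (LinearMap.ker g.toLin) (LinearMap.range f.toLin) ⟨x, hx⟩)
    obtain ⟨ψ, hψ⟩ := exists_factor_of_isField hK (g.toLin.restrictScalars K) φ.1.1.ev h0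
    obtain ⟨s, hs⟩ := exists_finite_of_mem_dualSub hB φ.1
    obtain ⟨ψ', h1, h2⟩ := exists_truncation hC ψ s
    refine ⟨ψ', Subtype.ext (fullDual_ext_piece hB fun δ x hx => ?_)⟩
    by_cases hδ : δ ∈ s
    · exact (h1 δ hδ _ (g.map_piece _ _ hx)).trans (hψ x)
    · exact (h2 δ hδ _ (g.map_piece _ _ hx)).trans (hs δ hδ x hx).symm
  · rintro ⟨ψ, hψ⟩
    refine Subtype.ext (GMod.fullDual_ext fun z => ?_)
    have h1 : φ.1.1.ev z.1 = ψ.1.ev (g.toLin z.1) :=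
      (DFunLike.congr_fun (F := B →ₗ[K] K) (congrArg Subtype.val hψ) z.1).symm
    exact h1.trans ((congrArg ψ.1.ev (LinearMap.mem_ker.1 z.2)).trans (map_zero _))
  · obtain ⟨φ, hφ⟩ := exists_extend_of_isField hK ((LinearMap.ker g.toLin).restrictScalars K)
      (Ψ.1.ev ∘ₗ (B.sqMk (LinearMap.ker g.toLin) (LinearMap.range f.toLin)).restrictScalars K)
    obtain ⟨s, hs⟩ := exists_finite_of_mem_dualSub hH Ψ
    obtain ⟨φ', h1, h2⟩ := exists_truncation hB φ s
    have hval : ∀ δ, ∀ z : LinearMap.ker g.toLin, z.1 ∈ B.piece δ →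
        φ'.1.ev z.1 = Ψ.1.ev (B.sqMk _ (LinearMap.range f.toLin) z) := by
      intro δ z hz
      by_cases hδ : δ ∈ s
      · exact (h1 δ hδ _ hz).trans (hφ z)
      · exact (h2 δ hδ _ hz).trans (hs δ hδ _ (GMod.sqMk_mem_piece hz)).symm
    have hker : (dualMap f).toLin φ' = 0 := Subtype.ext (fullDual_ext_piece hA fun δ x hx => by
      refine (hval δ ⟨f.toLin x, hgf x⟩ (f.map_piece _ _ hx)).trans ?_
      exact (congrArg Ψ.1.ev (GMod.sqMk_eq_zero.2 ⟨x, rfl⟩)).trans (map_zero _))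
    refine ⟨⟨φ', hker⟩, Subtype.ext (fullDual_ext_piece hH fun δ x hx => ?_)⟩
    obtain ⟨z, hz, rfl⟩ := GMod.mem_piece_subquotient hx
    exact hval δ z hz
  · obtain ⟨z, hz, rfl⟩ := GMod.mem_piece_subquotient hx
    exact hφ δ hδ _ hz

/-- The graded dual of an isomorphism. -/
theorem exists_dualIso (hA : A.IsGraded) (hB : B.IsGraded) (e : GIso A B) :
    Nonempty (GIso (dual B) (dual A)) :=
  ⟨GIso.ofBijective (isGraded_dual hB) (isGraded_dual hA) (dualMap e.hom)
    ⟨Function.LeftInverse.injective (g := (dualMap e.symm.hom).toLin) fun φ =>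
        Subtype.ext (LinearMap.ext fun x => congrArg φ.1.ev (e.toEquiv.apply_symm_apply x)),
      Function.RightInverse.surjective (g := (dualMap e.symm.hom).toLin) fun φ =>
        Subtype.ext (LinearMap.ext fun x => congrArg φ.1.ev (e.toEquiv.symm_apply_apply x))⟩⟩

end Dual

/-! ### The Čech double complex of a complex -/

theorem units_zsmul_eq_zero_iff {V : Type*} [AddCommGroup V] (e : ℤˣ) (x : V) :
    (e : ℤ) • x = 0 ↔ x = 0 := by
  rcases Int.units_eq_one_or e with rfl | rfl <;> simp

theorem exists_units_zsmul {V : Type*} [AddCommGroup V] (e : ℤˣ) (x : V) :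
    ∃ y, (e : ℤ) • y = x := by
  rcases Int.units_eq_one_or e with rfl | rfl
  · exact ⟨x, by simp⟩
  · exact ⟨-x, by simp⟩

theorem exists_units_smul_toLin_eq {A B : GMod K w} (e : ℤˣ) (f : GHom A B) {y : B} :
    (∃ x, (e • f).toLin x = y) ↔ ∃ x, f.toLin x = y := by
  constructor
  · rintro ⟨x, rfl⟩
    exact ⟨(e : ℤ) • x, map_zsmul _ _ _⟩
  · rintro ⟨x, rfl⟩
    obtain ⟨x, rfl⟩ := exists_units_zsmul e x
    exact ⟨x, (map_zsmul _ _ _).symm⟩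

section CechDouble

variable {r : ℕ} (t : Fin r → ι) (C : ℤ → GMod K w) (hC : ∀ q, (C q).IsGraded)
  (d : ∀ q q', GHom (C q) (C q'))
  (hd : ∀ q q' q'', q + 1 = q' → q' + 1 = q'' → ∀ x, (d q' q'').toLin ((d q q').toLin x) = 0)

/-- The Čech double complex of a complex `C` of graded modules, with the Čech differential in the
first direction and the differential of `C`, up to sign, in the second one. -/
def cechCx : DoubleCx K w where
  X p q := cechMod t (C q) p
  h p p' q := cechDHom t (hC q) p p'
  v p q q' := p.negOnePow • cechMap t (d q q') p
  hh p p' p'' q h h' x := cechD_cechD t h h' x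
  vv p q q' q'' h h' := fun (x : CechObj K t (C q) p) => by
    change (p.negOnePow : ℤ) • cechObjMap t (d q' q'').toLin p
      ((p.negOnePow : ℤ) • cechObjMap t (d q q').toLin p x) = 0
    have h0 : (d q' q'').toLin ∘ₗ (d q q').toLin = 0 := LinearMap.ext fun x => hd q q' q'' h h' x
    rw [map_zsmul, cechObjMap_comp_apply, h0, cechObjMap_zero]
    exact (units_zsmul_eq_zero_iff _ _).2 ((units_zsmul_eq_zero_iff _ _).2 rfl)
  anti p p' q q' h _ := fun (x : CechObj K t (C q) p) => by
    change (p'.negOnePow : ℤ) • cechObjMap t (d q q').toLin p' (cechD t (C q) p p' x) +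
      cechD t (C q') p p' ((p.negOnePow : ℤ) • cechObjMap t (d q q').toLin p x) = 0
    subst h
    rw [map_zsmul, cechObjMap_comm, Int.negOnePow_succ, Units.val_neg, neg_smul, neg_add_cancel]
  graded p q := isGraded_cechMod t (hC q) p
  bdd _ := ⟨0, r, fun p q _ hp => hp.elim (subsingleton_cechObj_of_neg t)
    (subsingleton_cechObj_of_gt t)⟩

/-- The second page of the spectral sequence of the Čech double complex. -/
def cechCxE2 (p q : ℤ) : GIso ((cechCx t C hC d hd).filt.page 2 p q)
    (locCoh t p (homology (d (q - 1) q).toLin (d q (q + 1)).toLin)) := by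
  have hker : ∀ p (a : LinearMap.ker ((cechCx t C hC d hd).v p q (q + 1)).toLin),
      (a : (cechCx t C hC d hd).X p q) ∈ LinearMap.ker (cechObjMap t (d q (q + 1)).toLin p) :=
    fun p a => (units_zsmul_eq_zero_iff p.negOnePow
      (cechObjMap t (d q (q + 1)).toLin p a.1)).1 a.2
  have hH := isGraded_homology (d (q - 1) q) (d q (q + 1)) (hC _) (hC _) (hC _)
  refine DoubleCx.e2Iso (A := cechCx t C hC d hd) p q
    (fun p => cechMod t (homology (d (q - 1) q).toLin (d q (q + 1)).toLin) p)
    (fun p p' => cechDHom t hH p p') (fun p => isGraded_cechMod t hH p)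
    (fun p => cechClass t (d (q - 1) q) (d q (q + 1)) p ∘ₗ Submodule.inclusion fun x hx =>
      hker p ⟨x, hx⟩) ?_ ?_ ?_ ?_
  · intro p c
    obtain ⟨a, rfl⟩ := cechClass_surjective t (d (q - 1) q) (d q (q + 1)) p c
    exact ⟨⟨a.1, (units_zsmul_eq_zero_iff p.negOnePow _).2 a.2⟩, rfl⟩
  · intro p a
    refine (cechClass_eq_zero t (d (q - 1) q) (d q (q + 1))
      (hd _ _ _ (sub_add_cancel q 1) rfl) p ⟨a.1, hker p a⟩).trans ?_
    exact (exists_units_smul_toLin_eq p.negOnePow (cechMap t (d (q - 1) q) p)).symm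
  · intro p γ a ha
    exact cechClass_mem_piece t (d (q - 1) q) (d q (q + 1)) (hC q) p ⟨a.1, hker p a⟩ ha
  · intro p p' _ a a' h
    exact cechClass_cechD t (d (q - 1) q) (d q (q + 1)) p p' ⟨a.1, hker p a⟩ ⟨a'.1, hker p' a'⟩ h

end CechDouble

namespace DoubleCx

variable {A B : DoubleCx K w} (ψ : ∀ p q, GHom (A.X p q) (B.X p q))

/-- The map of total complexes induced by maps of the terms. -/
def totMap : A.tot →ₗ[MvPolynomial ι K] B.tot :=
  (DFinsupp.mapRange.linearMap fun i : ℤ × ℤ => (ψ i.1 i.2).toLin :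
    (Π₀ i : ℤ × ℤ, A.X i.1 i.2) →ₗ[MvPolynomial ι K] (Π₀ i : ℤ × ℤ, B.X i.1 i.2))

theorem coord_totMap (p q : ℤ) (x : A.tot) :
    (B.coord p q).toLin (totMap ψ x) = (ψ p q).toLin ((A.coord p q).toLin x) := rfl

theorem totMap_mem_cycles
    (hh : ∀ p p' q, p + 1 = p' → ∀ x, (B.h p p' q).toLin ((ψ p q).toLin x) =
      (ψ p' q).toLin ((A.h p p' q).toLin x))
    (hv : ∀ p q q', q + 1 = q' → ∀ x, (B.v p q q').toLin ((ψ p q).toLin x) =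
      (ψ p q').toLin ((A.v p q q').toLin x)) {k : ℤ} {x : A.tot}
    (hx : x ∈ LinearMap.ker A.D.toLin ⊓ A.deg k) :
    totMap ψ x ∈ LinearMap.ker B.D.toLin ⊓ B.deg k := by
  refine ⟨LinearMap.mem_ker.2 (tot_ext fun p q => ?_), fun p q h => ?_⟩
  · rw [coord_D (sub_add_cancel p 1) (sub_add_cancel q 1), coord_totMap, coord_totMap,
      hh _ _ _ (sub_add_cancel p 1), hv _ _ _ (sub_add_cancel q 1), ← map_add,
      ← coord_D (sub_add_cancel p 1) (sub_add_cancel q 1), LinearMap.mem_ker.1 hx.1, map_zero,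
      map_zero, map_zero]
  · rw [coord_totMap, hx.2 p q h, map_zero]

end DoubleCx

/-! ### The Čech double complex of a resolution -/

namespace FreeRes

variable {r : ℕ} (t : Fin r → ι) {M M' : GMod K w}

/-- The augmentation, at an index that equals `0`. -/
def augAt (F : FreeRes M) {l : ℤ} (h : l = 0) : GHom (F.X l) M := h ▸ F.aug

theorem augAt_surjective (F : FreeRes M) {l : ℤ} (h : l = 0) :
    Function.Surjective (F.augAt h).toLin := by
  subst h
  exact F.surj

theorem ker_augAt (F : FreeRes M) {l l' : ℤ} (h : l = 0) (h' : l' = 1) :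
    LinearMap.ker (F.augAt h).toLin = LinearMap.range (F.d l' l).toLin := by
  subst h h'
  exact F.exact_zero.symm

theorem augAt_d (F : FreeRes M) {l l' : ℤ} (h : l = 0) (h' : l' = 1) (x : F.X l') :
    (F.augAt h).toLin ((F.d l' l).toLin x) = 0 :=
  LinearMap.mem_ker.1 ((F.ker_augAt h h').symm ▸ LinearMap.mem_range_self _ x)

theorem Lift.comm_augAt {F : FreeRes M} {F' : FreeRes M'} {f : GHom M M'} (φ : F.Lift F' f) {l : ℤ}
    (h : l = 0) (x : F.X l) :
    f.toLin ((F.augAt h).toLin x) = (F'.augAt h).toLin ((φ.φ l).toLin x) := by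
  subst h
  exact φ.comm_aug x

/-- The Čech double complex of a resolution `F`, with the Čech complex of `F_{r - q}` in the row `q`.
So `F_0` sits in the row `r`, and the total degree of `H^i_I(M)` is `r + i`. -/
def cechDouble (F : FreeRes M) : DoubleCx K w :=
  cechCx t (fun q => F.X (r - q)) (fun q => (F.finiteFree _).isGraded)
    (fun q q' => F.d (r - q) (r - q'))
    fun q q' q'' h h' x => F.d_d (i := r - q) (j := r - q') (l := r - q'') (by omega) (by omega) x

/-- The class in the top local cohomology of a cochain of top degree. -/
def topClass (N : GMod K w) : GHom (cechMod t N r) (locCoh t r N) where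
  toLin := GMod.sqMk (cechMod t N r) _ _ ∘ₗ
    (LinearMap.id : CechObj K t N r →ₗ[MvPolynomial ι K] CechObj K t N r).codRestrict
      (LinearMap.ker (cechD t N r (r + 1))) (mem_ker_cechD_top t)
  map_piece _ _ hx := GMod.sqMk_mem_piece hx

theorem topClass_surjective (N : GMod K w) : Function.Surjective (topClass t N).toLin := by
  intro y
  obtain ⟨z, rfl⟩ := GMod.sqMk_surjective _ _ y
  exact ⟨z.1, rfl⟩

theorem topClass_eq_zero (N : GMod K w) (x : cechMod t N r) :
    (topClass t N).toLin x = 0 ↔ ∃ y, cechD t N (r - 1) r y = x :=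
  GMod.sqMk_eq_zero

theorem topClass_natural {N N' : GMod K w} (f : GHom N N') (x : cechMod t N r) :
    (topClass t N').toLin ((cechMap t f r).toLin x) = (locCohMap t r f).toLin ((topClass t N).toLin x) :=
  rfl

theorem isGraded_homLocCoh (F : FreeRes M) (i k : ℤ) : (F.homLocCoh t i k).IsGraded :=
  isGraded_homology _ _ (isGraded_locCoh t (F.finiteFree _).isGraded i)
    (isGraded_locCoh t (F.finiteFree _).isGraded i) (isGraded_locCoh t (F.finiteFree _).isGraded i)

/-- Cycles of the top local cohomology, in terms of cochains; the sign `e` is the one in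
`cechCx`. -/
theorem mem_ker_locCohMap_iff (F : FreeRes M) {k l : ℤ} (hl : l = k - 1) (e : ℤˣ)
    (a : cechMod t (F.X k) r) :
    (topClass t (F.X k)).toLin a ∈ LinearMap.ker (locCohMap t r (F.d k (k - 1))).toLin ↔
      (e • cechMap t (F.d k l) r).toLin a ∈ LinearMap.range (cechD t (F.X l) (r - 1) r) := by
  subst hl
  refine (topClass_eq_zero t _ ((cechMap t (F.d k (k - 1)) r).toLin a)).trans ?_
  rcases Int.units_eq_one_or e with rfl | rfl
  · change _ ↔ ((1 : ℤˣ) : ℤ) • (cechMap t (F.d k (k - 1)) r).toLin a ∈ _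
    rw [Units.val_one, one_smul]
    exact Iff.rfl
  · change _ ↔ ((-1 : ℤˣ) : ℤ) • (cechMap t (F.d k (k - 1)) r).toLin a ∈ _
    rw [Units.val_neg, Units.val_one, neg_smul, one_smul]
    exact (neg_mem_iff (S := Submodule (MvPolynomial ι K) (CechObj K t (F.X (k - 1)) r))
      (H := LinearMap.range (cechD t (F.X (k - 1)) (r - 1) r))
      (x := (cechMap t (F.d k (k - 1)) r).toLin a)).symm

/-- Boundaries of the top local cohomology, in terms of cochains; the sign `e` is the one in
`cechCx`. -/
theorem mem_range_locCohMap_iff (F : FreeRes M) {k l : ℤ} (hl : l = k + 1) (e : ℤˣ)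
    (a : cechMod t (F.X k) r) :
    (topClass t (F.X k)).toLin a ∈ LinearMap.range (locCohMap t r (F.d (k + 1) k)).toLin ↔
      ∃ b c, (e • cechMap t (F.d l k) r).toLin b +
        (cechDHom t (F.finiteFree k).isGraded (r - 1) r).toLin c = a := by
  subst hl
  constructor
  · rintro ⟨y, hy⟩
    obtain ⟨b, rfl⟩ := topClass_surjective t _ y
    obtain ⟨b', hb'⟩ := (exists_units_smul_toLin_eq e (cechMap t (F.d (k + 1) k) r)).2 ⟨b, rfl⟩
    have hy' : (topClass t (F.X k)).toLin (a - (cechMap t (F.d (k + 1) k) r).toLin b) = 0 := by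
      rw [map_sub, topClass_natural, hy, sub_self]
    obtain ⟨c, hc⟩ := (topClass_eq_zero t _ _).1 hy'
    refine ⟨b', c, ?_⟩
    rw [hb']
    exact (congrArg _ hc).trans (add_sub_cancel _ _)
  · rintro ⟨b, c, rfl⟩
    obtain ⟨b', hb'⟩ := (exists_units_smul_toLin_eq e (cechMap t (F.d (k + 1) k) r)).1 ⟨b, rfl⟩
    refine ⟨(topClass t _).toLin b', ?_⟩
    have h0 : (topClass t (F.X k)).toLin
      ((cechDHom t (F.finiteFree k).isGraded (r - 1) r).toLin c) = 0 :=
      (topClass_eq_zero t _ _).2 ⟨c, rfl⟩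
    rw [← topClass_natural, hb', map_add, h0, add_zero]

/-- The total complex of the Čech double complex computes the homology of the top local
cohomology. -/
theorem exists_homLocCohIso (ht : Function.Injective t) (F : FreeRes M) (i : ℤ) :
    ∃ (e : GIso ((F.cechDouble t).filt.coh (r + i)) (F.homLocCoh t r (r - i)))
      (hx : ∀ x : (LinearMap.ker (F.cechDouble t).D.toLin ⊓ (F.cechDouble t).deg (r + i) :
        Submodule _ _), (topClass t (F.X (r - i))).toLin (((F.cechDouble t).coord r i).toLin x) ∈
          LinearMap.ker (locCohMap t r (F.d (r - i) (r - i - 1))).toLin),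
      ∀ x, e.toEquiv ((F.cechDouble t).tot.sqMk _ _ x) =
        GMod.sqMk (locCoh t r (F.X (r - i))) _
          (LinearMap.range (locCohMap t r (F.d (r - i + 1) (r - i))).toLin) ⟨_, hx x⟩ := by
  have hg : ∀ k, (locCoh t r (F.X k)).IsGraded := fun k =>
    isGraded_locCoh t (F.finiteFree k).isGraded r
  refine DoubleCx.exists_projIso (A := F.cechDouble t) (n := r) (q := i) rfl
    (fun p q hp => subsingleton_cechObj_of_gt t hp) ?_ (hg (r - i))
    ((locCohMap t r (F.d (r - i) (r - i - 1))).isHomogeneous_ker (hg _) (hg _))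
    ((locCohMap t r (F.d (r - i + 1) (r - i))).isHomogeneous_range (hg _) (hg _))
    (topClass t (F.X (r - i))) (topClass_surjective t _)
    (fun a => F.mem_ker_locCohMap_iff t (by omega) (r : ℤ).negOnePow a)
    (fun a => F.mem_range_locCohMap_iff t (by omega) (r : ℤ).negOnePow a)
  intro p q hp a ha
  obtain ⟨-, k, b, -⟩ := F.finiteFree (r - q)
  exact exact_cechD t b ht (sub_add_cancel p 1) rfl hp.ne a ha

/-- The total complex of the Čech double complex computes the local cohomology of the module
resolved. -/
theorem exists_cechDoubleIso (hM : M.IsGraded) (F : FreeRes M) (i : ℤ) :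
    ∃ (e : GIso ((F.cechDouble t).filt.coh (r + i)) (locCoh t i M))
      (hx : ∀ x : (LinearMap.ker (F.cechDouble t).D.toLin ⊓ (F.cechDouble t).deg (r + i) :
        Submodule _ _), (cechMap t (F.augAt (sub_self (r : ℤ))) i).toLin
          (((F.cechDouble t).coord i r).toLin x) ∈ LinearMap.ker (cechD t M i (i + 1))),
      ∀ x, e.toEquiv ((F.cechDouble t).tot.sqMk _ _ x) =
        GMod.sqMk (cechMod t M i) _ (LinearMap.range (cechD t M (i - 1) i)) ⟨_, hx x⟩ := by
  have hexact : ∀ p (a : CechObj K t (F.X (r - r)) p),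
      cechObjMap t (F.augAt (sub_self (r : ℤ))).toLin p a = 0 ↔
        a ∈ LinearMap.range (((F.cechDouble t).swap.h (r - 1) r p).toLin) := by
    intro p a
    have hk := F.ker_augAt (l := r - r) (l' := r - (r - 1)) (sub_self _) (by omega)
    constructor
    · intro h
      exact (exists_units_smul_toLin_eq _ _).2 (cechObjMap_exact t hk.le p h)
    · intro h
      obtain ⟨b, rfl⟩ := (exists_units_smul_toLin_eq _ _).1 h
      refine (cechObjMap_comp_apply t _ _ p b).trans ?_
      have h0 : (F.augAt (sub_self (r : ℤ))).toLin ∘ₗ (F.d (r - (r - 1)) (r - r)).toLin = 0 :=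
        LinearMap.ext (F.augAt_d _ (by omega))
      rw [h0]
      exact cechObjMap_zero t p (b : CechObj K t (F.X (r - (r - 1))) p)
  -- Localization is exact, so the columns of the double complex are exact except at `F_0`.
  obtain ⟨e, heZ, he⟩ := DoubleCx.exists_projIso (A := (F.cechDouble t).swap) (n := r) (q := i)
    (k := r + i) rfl (fun p q hp => by
      have := F.neg (r - p) (by omega)
      exact subsingleton_cechObj t q) (fun p q hp a ha => by
      have h1 := (units_zsmul_eq_zero_iff q.negOnePow _).1 ha
      exact (exists_units_smul_toLin_eq _ _).2 (cechObjMap_exact t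
        (f := (F.d (r - (p - 1)) (r - p)).toLin) (g := (F.d (r - p) (r - (p + 1))).toLin)
        (fun x hx => F.exists_d_eq (by omega) (by omega) (by omega) x hx) q h1))
    (isGraded_cechMod t hM i)
    ((cechDHom t hM i (i + 1)).isHomogeneous_ker (isGraded_cechMod t hM _)
      (isGraded_cechMod t hM _))
    ((cechDHom t hM (i - 1) i).isHomogeneous_range (isGraded_cechMod t hM _)
      (isGraded_cechMod t hM _))
    (cechMap t (F.augAt (sub_self (r : ℤ))) i)
    (cechObjMap_surjective t (F.augAt_surjective _) i)
    (fun a => by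
      refine Iff.trans ?_ (hexact (i + 1) (cechD t _ i (i + 1) a))
      exact Eq.congr_left (cechObjMap_comm t (F.augAt (sub_self (r : ℤ))).toLin i (i + 1)
        (a : CechObj K t (F.X (r - r)) i)).symm)
    (fun (a : CechObj K t (F.X (r - r)) i) => by
      constructor
      · rintro ⟨y, hy⟩
        obtain ⟨b, rfl⟩ := cechObjMap_surjective t (F.augAt_surjective (sub_self (r : ℤ))) (i - 1) y
        have hy' : cechD t M (i - 1) i (cechObjMap t (F.augAt (sub_self (r : ℤ))).toLin (i - 1) b) =
          cechObjMap t (F.augAt (sub_self (r : ℤ))).toLin i a := hy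
        rw [← cechObjMap_comm, eq_comm, ← sub_eq_zero, ← map_sub] at hy'
        obtain ⟨c, hc⟩ := (hexact i _).1 hy'
        exact ⟨b, c, (congrArg _ hc).trans (add_sub_cancel _ _)⟩
      · rintro ⟨b, c, rfl⟩
        refine ⟨cechObjMap t (F.augAt (sub_self (r : ℤ))).toLin (i - 1) b, ?_⟩
        refine (cechObjMap_comm t _ _ _ b).symm.trans ?_
        have h0 := (hexact i _).2 ⟨c, rfl⟩
        refine Eq.symm ((map_add _ _ _).trans ?_)
        exact (congrArg _ h0).trans (add_zero _))
  obtain ⟨s, hs⟩ := (F.cechDouble t).exists_swapIso (r + i)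
  have hc : ∀ x, (cechMap t (F.augAt (sub_self (r : ℤ))) i).toLin
      (((F.cechDouble t).swap.coord r i).toLin ((F.cechDouble t).swap.swapLin x)) =
      (cechMap t (F.augAt (sub_self (r : ℤ))) i).toLin (((F.cechDouble t).coord i r).toLin x) :=
    fun x => congrArg _ (DoubleCx.coord_swapLin (A := (F.cechDouble t).swap) r i x)
  refine ⟨s.symm.trans e, fun x => Set.mem_of_eq_of_mem (hc x.1).symm
    (heZ ⟨_, DoubleCx.swapLin_mem_cycles (A := (F.cechDouble t).swap) x.2⟩), fun x => ?_⟩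
  have hx' := DoubleCx.swapLin_mem_cycles (A := (F.cechDouble t).swap) x.2
  have h1 : s.symm.toEquiv ((F.cechDouble t).tot.sqMk _ _ x) =
      (F.cechDouble t).swap.tot.sqMk _ _ ⟨_, hx'⟩ := by
    refine (LinearEquiv.symm_apply_eq _).2 ((hs ⟨_, hx'⟩).trans ?_).symm
    exact congrArg _ (Subtype.ext (DoubleCx.swapLin_swapLin x.1))
  refine (congrArg e.toEquiv h1).trans ?_
  exact (he ⟨_, hx'⟩).trans (congrArg (GMod.sqMk (cechMod t M i) _ _) (Subtype.ext (hc x.1)))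

/-- The local cohomology of `M` is the homology of the top local cohomology of a resolution; both
are read off from a cycle `x` of the Čech double complex. -/
theorem exists_topIso (ht : Function.Injective t) (hM : M.IsGraded) (F : FreeRes M) (i : ℤ) :
    ∃ Φ : GIso (locCoh t i M) (F.homLocCoh t r (r - i)),
      (∀ x ∈ LinearMap.ker (F.cechDouble t).D.toLin ⊓ (F.cechDouble t).deg (r + i), ∃ hx hx',
        Φ.toEquiv (GMod.sqMk (cechMod t M i) (LinearMap.ker (cechD t M i (i + 1)))
          (LinearMap.range (cechD t M (i - 1) i))
          ⟨(cechMap t (F.augAt (sub_self (r : ℤ))) i).toLin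
            (((F.cechDouble t).coord i r).toLin x), hx⟩) =
        GMod.sqMk (locCoh t r (F.X (r - i)))
          (LinearMap.ker (locCohMap t r (F.d (r - i) (r - i - 1))).toLin)
          (LinearMap.range (locCohMap t r (F.d (r - i + 1) (r - i))).toLin)
          ⟨(topClass t (F.X (r - i))).toLin (((F.cechDouble t).coord r i).toLin x), hx'⟩) ∧
      ∀ y : locCoh t i M,
        ∃ x ∈ LinearMap.ker (F.cechDouble t).D.toLin ⊓ (F.cechDouble t).deg (r + i), ∃ hx,
          y = GMod.sqMk (cechMod t M i) (LinearMap.ker (cechD t M i (i + 1)))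
            (LinearMap.range (cechD t M (i - 1) i))
            ⟨(cechMap t (F.augAt (sub_self (r : ℤ))) i).toLin
              (((F.cechDouble t).coord i r).toLin x), hx⟩ := by
  obtain ⟨e, hx', he⟩ := F.exists_homLocCohIso t ht i
  obtain ⟨e', hx, he'⟩ := exists_cechDoubleIso t hM F i
  refine ⟨e'.symm.trans e, fun x hxc => ⟨hx ⟨x, hxc⟩, hx' ⟨x, hxc⟩, ?_⟩, fun y => ?_⟩
  · refine (congrArg e.toEquiv ?_).trans (he ⟨x, hxc⟩)
    exact (LinearEquiv.symm_apply_eq _).2 (he' ⟨x, hxc⟩).symm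
  · obtain ⟨c, rfl⟩ := e'.toEquiv.surjective y
    obtain ⟨x, rfl⟩ := GMod.sqMk_surjective _ _ c
    exact ⟨x.1, x.2, hx x, he' x⟩

/-- The chosen isomorphism between local cohomology and the homology of the top local cohomology
of a resolution. -/
def topIso (ht : Function.Injective t) (hM : M.IsGraded) (F : FreeRes M) (i : ℤ) :
    GIso (locCoh t i M) (F.homLocCoh t r (r - i)) := (exists_topIso t ht hM F i).choose

/-- A chain map induces a map of Čech double complexes, hence maps a cycle representing a class to
one representing its image. -/
theorem topIso_natural (ht : Function.Injective t) (hM : M.IsGraded) (hM' : M'.IsGraded)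
    {F : FreeRes M} {F' : FreeRes M'} {f : GHom M M'} (φ : F.Lift F' f) (i : ℤ)
    (y : locCoh t i M) :
    (topIso t ht hM' F' i).toEquiv ((locCohMap t i f).toLin y) =
      (φ.homLocCohMap t r (r - i)).toLin ((topIso t ht hM F i).toEquiv y) := by
  obtain ⟨h1, h2⟩ := (exists_topIso t ht hM F i).choose_spec
  obtain ⟨h1', -⟩ := (exists_topIso t ht hM' F' i).choose_spec
  obtain ⟨x, hxc, hx, rfl⟩ := h2 y
  obtain ⟨hx, hx', hΦ⟩ := h1 x hxc
  let ψ : ∀ p q, GHom ((F.cechDouble t).X p q) ((F'.cechDouble t).X p q) :=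
    fun p q => cechMap t (φ.φ (r - q)) p
  have hψ := DoubleCx.totMap_mem_cycles ψ
    (fun p p' q _ x => (cechObjMap_comm t (φ.φ (r - q)).toLin p p' x).symm)
    (fun p q q' h => fun (x : CechObj K t (F.X (r - q)) p) => by
      change (p.negOnePow : ℤ) • cechObjMap t (F'.d (r - q) (r - q')).toLin p
          (cechObjMap t (φ.φ (r - q)).toLin p x) = cechObjMap t (φ.φ (r - q')).toLin p
          ((p.negOnePow : ℤ) • cechObjMap t (F.d (r - q) (r - q')).toLin p x)
      rw [map_zsmul]
      exact congrArg ((p.negOnePow : ℤ) • ·) (cechObjMap_congr t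
        (fun y => (φ.comm (r - q) (r - q') (by omega) y).symm) p x)) hxc
  obtain ⟨hy, hy', hΦ'⟩ := h1' _ hψ
  have hcomm : (cechMap t f i).toLin ((cechMap t (F.augAt (sub_self (r : ℤ))) i).toLin
      (((F.cechDouble t).coord i r).toLin x)) = (cechMap t (F'.augAt (sub_self (r : ℤ))) i).toLin
      (((F'.cechDouble t).coord i r).toLin (DoubleCx.totMap ψ x)) :=
    cechObjMap_congr t (φ.comm_augAt (sub_self (r : ℤ))) i _
  have h3 : (locCohMap t i f).toLin (GMod.sqMk (cechMod t M i) (LinearMap.ker (cechD t M i (i + 1)))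
      (LinearMap.range (cechD t M (i - 1) i)) ⟨_, hx⟩) =
      GMod.sqMk (cechMod t M' i) (LinearMap.ker (cechD t M' i (i + 1)))
      (LinearMap.range (cechD t M' (i - 1) i)) ⟨_, hy⟩ :=
    congrArg (GMod.sqMk (cechMod t M' i) _ _) (Subtype.ext hcomm)
  refine ((congrArg (topIso t ht hM' F' i).toEquiv h3).trans hΦ').trans ?_
  exact congrArg (φ.homLocCohMap t r (r - i)).toLin hΦ.symm

end FreeRes

/-! ### The spectral sequence -/

namespace FreeRes

variable {M : GMod K w}

theorem homModMap_d_d (F : FreeRes M) (N : GMod K w) (q q' q'' : ℤ) (h : q + 1 = q')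
    (h' : q' + 1 = q'') (u : homMod (F.X q) N) :
    (homModMap (F.d q'' q') N).toLin ((homModMap (F.d q' q) N).toLin u) = 0 :=
  LinearMap.ext fun x => by
    change homFun u ((F.d q' q).toLin ((F.d q'' q').toLin x)) = 0
    rw [F.d_d h' h, map_zero]

variable {m n : ℕ} {w : Fin m ⊕ Fin n → Γ} {M : GMod K w}

theorem isGraded_canonicalMod : (canonicalMod K w).IsGraded := isGraded_shiftS _

/-- The Čech double complex with respect to the variables `y` of the complex `Hom(F, ω)`. -/
def extDouble (F : FreeRes M) : DoubleCx K w :=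
  cechCx (Sum.inr : Fin n → Fin m ⊕ Fin n) (fun q => homMod (F.X q) (canonicalMod K w))
    (fun q => isGraded_homMod (F.finiteFree q) isGraded_canonicalMod)
    (fun q q' => homModMap (F.d q' q) (canonicalMod K w)) (F.homModMap_d_d _)

theorem isGraded_cohDualLocCoh {r : ℕ} (t : Fin r → Fin m ⊕ Fin n) (F : FreeRes M) (i k : ℤ) :
    (F.cohDualLocCoh t i k).IsGraded :=
  isGraded_homology _ _ (isGraded_dual (isGraded_locCoh t (F.finiteFree _).isGraded i))
    (isGraded_dual (isGraded_locCoh t (F.finiteFree _).isGraded i))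
    (isGraded_dual (isGraded_locCoh t (F.finiteFree _).isGraded i))

/-- Under the residue pairing, cocycles of the dual of the top local cohomology are the Čech classes
whose image is a coboundary. -/
theorem mem_ker_dualMap_iff (F : FreeRes M) {k l : ℤ} (hl : l = k + 1) (e : ℤˣ)
    (a : cechMod (Sum.inr : Fin n → Fin m ⊕ Fin n) (homMod (F.X k) (canonicalMod K w)) n) :
    (resDual (F.finiteFree k)).toLin a ∈
        LinearMap.ker (dualMap (locCohMap Sum.inl m (F.d (k + 1) k))).toLin ↔
      (e • cechMap Sum.inr (homModMap (F.d l k) (canonicalMod K w)) n).toLin a ∈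
        LinearMap.range (cechDHom Sum.inr (isGraded_homMod (F.finiteFree l)
          isGraded_canonicalMod) (n - 1) n).toLin := by
  subst hl
  have h0 := resDual_eq_zero_iff (F.finiteFree (k + 1)) ((cechMap Sum.inr
    (homModMap (F.d (k + 1) k) (canonicalMod K w)) n).toLin a)
  rw [LinearMap.mem_ker]
  refine (Eq.congr_left (resDual_natural (F.finiteFree (k + 1)) (F.finiteFree k)
    (F.d (k + 1) k) a).symm).trans (h0.trans ?_)
  rcases Int.units_eq_one_or e with rfl | rfl
  · change _ ↔ ((1 : ℤˣ) : ℤ) • (cechMap Sum.inr (homModMap (F.d (k + 1) k) (canonicalMod K w))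
      n).toLin a ∈ _
    rw [Units.val_one, one_smul]
    exact Iff.rfl
  · change _ ↔ ((-1 : ℤˣ) : ℤ) • (cechMap Sum.inr (homModMap (F.d (k + 1) k) (canonicalMod K w))
      n).toLin a ∈ _
    rw [Units.val_neg, Units.val_one, neg_smul, one_smul]
    exact (neg_mem_iff (S := Submodule (MvPolynomial (Fin m ⊕ Fin n) K) (CechObj K Sum.inr
        (homMod (F.X (k + 1)) (canonicalMod K w)) n))
      (H := LinearMap.range (cechD Sum.inr (homMod (F.X (k + 1)) (canonicalMod K w)) (n - 1) n))
      (x := (cechMap Sum.inr (homModMap (F.d (k + 1) k) (canonicalMod K w)) n).toLin a)).symm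

/-- Under the residue pairing, coboundaries of the dual of the top local cohomology come from
coboundaries of the total complex. -/
theorem mem_range_dualMap_iff (hsharp : IsSharp K w (Sum.inl : Fin m → Fin m ⊕ Fin n))
    (F : FreeRes M) {k l : ℤ} (hl : l = k - 1) (e : ℤˣ)
    (a : cechMod (Sum.inr : Fin n → Fin m ⊕ Fin n) (homMod (F.X k) (canonicalMod K w)) n) :
    (resDual (F.finiteFree k)).toLin a ∈
        LinearMap.range (dualMap (locCohMap Sum.inl m (F.d k (k - 1)))).toLin ↔
      ∃ b c, (e • cechMap Sum.inr (homModMap (F.d k l) (canonicalMod K w)) n).toLin b +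
        (cechDHom Sum.inr (isGraded_homMod (F.finiteFree k)
          isGraded_canonicalMod) (n - 1) n).toLin c = a := by
  subst hl
  constructor
  · rintro ⟨ψ, hψ⟩
    obtain ⟨b, rfl⟩ := resDual_surjective hsharp (F.finiteFree (k - 1)) ψ
    obtain ⟨b', hb'⟩ := (exists_units_smul_toLin_eq e (cechMap Sum.inr
      (homModMap (F.d k (k - 1)) (canonicalMod K w)) n)).2 ⟨b, rfl⟩
    have h0 : (resDual (F.finiteFree k)).toLin (a - (cechMap Sum.inr
        (homModMap (F.d k (k - 1)) (canonicalMod K w)) n).toLin b) = 0 := by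
      rw [map_sub, sub_eq_zero]
      exact hψ.symm.trans (resDual_natural (F.finiteFree k) (F.finiteFree (k - 1)) _ b).symm
    obtain ⟨c, hc⟩ := (resDual_eq_zero_iff (F.finiteFree k) _).1 h0
    refine ⟨b', c, ?_⟩
    rw [hb']
    exact (congrArg _ hc).trans (add_sub_cancel _ _)
  · rintro ⟨b, c, rfl⟩
    obtain ⟨b', hb'⟩ := (exists_units_smul_toLin_eq e (cechMap Sum.inr
      (homModMap (F.d k (k - 1)) (canonicalMod K w)) n)).1 ⟨b, rfl⟩
    refine ⟨(resDual (F.finiteFree (k - 1))).toLin b', ?_⟩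
    have h0 : (resDual (F.finiteFree k)).toLin ((cechDHom Sum.inr (isGraded_homMod (F.finiteFree k)
        isGraded_canonicalMod) (n - 1) n).toLin c) = 0 :=
      (resDual_eq_zero_iff (F.finiteFree k) _).2 ⟨c, rfl⟩
    rw [map_add, h0, add_zero, ← hb']
    exact (resDual_natural (F.finiteFree k) (F.finiteFree (k - 1)) _ b').symm

/-- By the residue pairing the total complex computes the cohomology of the dual of the top local
cohomology. -/
theorem exists_abutmentIso (hsharp : IsSharp K w (Sum.inl : Fin m → Fin m ⊕ Fin n))
    (F : FreeRes M) (k : ℤ) :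
    Nonempty (GIso (F.extDouble.filt.coh k)
      (F.cohDualLocCoh (Sum.inl : Fin m → Fin m ⊕ Fin n) m (k - n))) := by
  have hg : ∀ q, (dual (locCoh (Sum.inl : Fin m → Fin m ⊕ Fin n) m (F.X q))).IsGraded := fun q =>
    isGraded_dual (isGraded_locCoh _ (F.finiteFree q).isGraded m)
  obtain ⟨e, -⟩ := DoubleCx.exists_projIso (A := F.extDouble) (n := n) (q := k - n) (k := k)
    (by omega) (fun p q hp => subsingleton_cechObj_of_gt _ hp) (fun p q hp a ha => by
      classical
      obtain ⟨-, l, b, -⟩ := F.finiteFree q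
      exact exact_cechD (N := F.X q →ₗ[MvPolynomial (Fin m ⊕ Fin n) K]
        MvPolynomial (Fin m ⊕ Fin n) K) Sum.inr b.dualBasis Sum.inr_injective
        (sub_add_cancel p 1) rfl hp.ne a ha) (hg (k - n))
    ((dualMap (locCohMap Sum.inl m (F.d (k - n + 1) (k - n)))).isHomogeneous_ker (hg _) (hg _))
    ((dualMap (locCohMap Sum.inl m (F.d (k - n) (k - n - 1)))).isHomogeneous_range (hg _) (hg _))
    (resDual (F.finiteFree (k - n))) (resDual_surjective hsharp _)
    (fun a => F.mem_ker_dualMap_iff rfl (n : ℤ).negOnePow a)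
    (fun a => F.mem_range_dualMap_iff hsharp rfl (n : ℤ).negOnePow a)
  exact ⟨e⟩

/-- The spectral sequence `H^i_Q(Ext^j(M, ω)) ⇒ H^{i+j-n}(H^m_P(F)^*)`. -/
theorem exists_specSeq (hsharp : IsSharp K w (Sum.inl : Fin m → Fin m ⊕ Fin n)) (hM : M.IsGraded)
    (F G : FreeRes M) :
    ∃ E : SpecSeq K w,
      (∀ i j : ℤ, Nonempty (GIso (E.E 2 i j)
        (locCoh (Sum.inr : Fin n → Fin m ⊕ Fin n) i (G.ext j (canonicalMod K w))))) ∧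
      E.ConvergesTo fun k => F.cohDualLocCoh (Sum.inl : Fin m → Fin m ⊕ Fin n) m (k - n) := by
  refine ⟨F.extDouble.filt.specSeq, fun i j => ?_, ?_⟩
  · obtain ⟨e⟩ := exists_extIso hM F G j (isGraded_canonicalMod (K := K) (w := w))
    obtain ⟨e'⟩ := exists_locCohIso (Sum.inr : Fin n → Fin m ⊕ Fin n) i
      (F.isGraded_ext j isGraded_canonicalMod) (G.isGraded_ext j isGraded_canonicalMod) e
    exact ⟨(cechCxE2 _ _ _ _ _ i j).trans e'⟩
  · exact F.extDouble.filt.convergesTo.congr F.extDouble.filt.graded_coh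
      (fun k => (F.exists_abutmentIso hsharp k).some) fun k => F.isGraded_cohDualLocCoh _ m (k - n)

/-- Over a field, the abutment is the graded dual of the local cohomology of `M`. -/
theorem exists_dualLocCohIso (hK : IsField K) (hM : M.IsGraded) (F : FreeRes M) (k : ℤ) :
    Nonempty (GIso (F.cohDualLocCoh (Sum.inl : Fin m → Fin m ⊕ Fin n) m (k - n))
      (dual (locCoh (Sum.inl : Fin m → Fin m ⊕ Fin n) ((m + n : ℕ) - k) M))) := by
  have hg : ∀ q, (locCoh (Sum.inl : Fin m → Fin m ⊕ Fin n) m (F.X q)).IsGraded := fun q =>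
    isGraded_locCoh _ (F.finiteFree q).isGraded m
  obtain ⟨e⟩ := exists_dualHomologyIso hK (hg _) (hg _) (hg _)
    (locCohMap (Sum.inl : Fin m → Fin m ⊕ Fin n) m (F.d (k - n + 1) (k - n)))
    (locCohMap (Sum.inl : Fin m → Fin m ⊕ Fin n) m (F.d (k - n) (k - n - 1))) (fun x => by
      obtain ⟨z, rfl⟩ := Submodule.Quotient.mk_surjective _ x
      refine congrArg Submodule.Quotient.mk (Subtype.ext ?_)
      refine (cechObjMap_comp_apply Sum.inl (F.d (k - n + 1) (k - n)).toLin
        (F.d (k - n) (k - n - 1)).toLin m z.1).trans ?_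
      have h0 : (F.d (k - n) (k - n - 1)).toLin ∘ₗ (F.d (k - n + 1) (k - n)).toLin = 0 :=
        LinearMap.ext fun y => F.d_d rfl (by omega) y
      rw [h0]
      exact cechObjMap_zero Sum.inl m (z.1 : CechObj K _ _ _))
  have hi : (m : ℤ) - ((m + n : ℕ) - k) = k - n := by push_cast; ring
  obtain ⟨e'⟩ := exists_dualIso (isGraded_locCoh _ hM ((m + n : ℕ) - k))
    (F.isGraded_homLocCoh _ _ _) (topIso Sum.inl Sum.inl_injective hM F ((m + n : ℕ) - k))
  rw [hi] at e'
  exact ⟨e.trans e'⟩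

end FreeRes

end

end GradedDuality

theorem theorem1p4 {K : Type u} [CommRing K] [IsNoetherianRing K]
    {Γ : Type v} [AddCommGroup Γ] (m n : ℕ) (w : Fin m ⊕ Fin n → Γ)
    (hsharp : IsSharp K w (Sum.inl : Fin m → Fin m ⊕ Fin n)) :
    -- the functorial isomorphism `H^i_P(M) ≅ H_{m-i}(H^m_P(F))`
    (∃ Φ : ∀ (M : GMod K w), M.IsGraded → Module.Finite (MvPolynomial (Fin m ⊕ Fin n) K) M →
        ∀ (F : FreeRes M) (i : ℤ),
          GIso (locCoh (Sum.inl : Fin m → Fin m ⊕ Fin n) i M) (F.homLocCoh Sum.inl m (m - i)),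
      ∀ (M M' : GMod K w) (hM : M.IsGraded) (hM' : M'.IsGraded)
        (fM : Module.Finite (MvPolynomial (Fin m ⊕ Fin n) K) M)
        (fM' : Module.Finite (MvPolynomial (Fin m ⊕ Fin n) K) M')
        (F : FreeRes M) (F' : FreeRes M') (f : GHom M M') (φ : F.Lift F' f) (i : ℤ)
        (x : locCoh (Sum.inl : Fin m → Fin m ⊕ Fin n) i M),
        (Φ M' hM' fM' F' i).toEquiv ((locCohMap Sum.inl i f).toLin x) =
          (φ.homLocCohMap Sum.inl m (m - i)).toLin ((Φ M hM fM F i).toEquiv x)) ∧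
    -- the spectral sequences; `Ext` may be computed from any graded free resolution `G`
    ∀ (M : GMod K w), M.IsGraded → Module.Finite (MvPolynomial (Fin m ⊕ Fin n) K) M →
      ∀ F G : FreeRes M,
        (∃ E : SpecSeq K w,
          (∀ i j : ℤ, Nonempty (GIso (E.E 2 i j)
            (locCoh (Sum.inr : Fin n → Fin m ⊕ Fin n) i (G.ext j (canonicalMod K w))))) ∧
          E.ConvergesTo fun k => F.cohDualLocCoh (Sum.inl : Fin m → Fin m ⊕ Fin n) m (k - n)) ∧
        (IsField K →
          ringKrullDim (MvPolynomial (Fin m ⊕ Fin n) K) = ((m + n : ℕ) : WithBot ℕ∞) ∧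
          ∃ E : SpecSeq K w,
            (∀ i j : ℤ, Nonempty (GIso (E.E 2 i j)
              (locCoh (Sum.inr : Fin n → Fin m ⊕ Fin n) i (G.ext j (canonicalMod K w))))) ∧
            E.ConvergesTo fun k =>
              dual (locCoh (Sum.inl : Fin m → Fin m ⊕ Fin n) ((m + n : ℕ) - k) M)) := by
  refine ⟨⟨fun M hM _ F i => FreeRes.topIso Sum.inl Sum.inl_injective hM F i, ?_⟩, ?_⟩
  · intro M M' hM hM' _ _ F F' f φ i x
    exact FreeRes.topIso_natural Sum.inl Sum.inl_injective hM hM' φ i x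
  · intro M hM _ F G
    obtain ⟨E, h2, hE⟩ := FreeRes.exists_specSeq hsharp hM F G
    refine ⟨⟨E, h2, hE⟩, fun hK => ⟨?_, E, h2, ?_⟩⟩
    · rw [MvPolynomial.ringKrullDim_of_isNoetherianRing, ringKrullDim_eq_zero_of_isField hK,
        Nat.card_eq_fintype_card, Fintype.card_sum, Fintype.card_fin, Fintype.card_fin, zero_add]
    · exact hE.congr (fun k => F.isGraded_cohDualLocCoh _ m (k - n))
        (fun k => (FreeRes.exists_dualLocCohIso hK hM F k).some)
        fun k => isGraded_dual (isGraded_locCoh _ hM _)
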